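/- **Setting.** Let $\alpha\in W^{1,\infty}(\mathbb R,[0,1))$. Fix smooth $\phi^\pm:\mathbb R\to[0,1]$ with $\phi^++\phi^-=1$, $\operatorname{supp}\phi^+\subset(-1,\infty)$, $\operatorname{supp}\phi^-\subset(-\infty,1)$, and put $E_2=\{f+a\phi^++b\phi^-: f\in H^1(\mathbb R),\,a,b\in\mathbb R\}$, $E_1^0=\{f+a\phi^+: f\in L^2(\mathbb R),\,a\in\mathbb R\}$ (these spaces do not depend on the choice of $\phi^\pm$). Let $\mathcal D^\alpha$ be the set of triplets $(u,\mu,\nu)$ with $u\in E_2$; $\mu\le\nu$ finite positive Radon measures on $\mathbb R$; $\mu_{\mathrm{ac}}\le\nu_{\mathrm{ac}}$; $d\mu_{\mathrm{ac}}=u_x^2\,dx$; $\mu((-\infty,\cdot)),\nu((-\infty,\cdot))\in E_1^0$; and $\frac{d\mu}{d\nu}>0$, and $\frac{d\mu_{\mathrm{ac}}}{d\nu_{\mathrm{ac}}}=1$ where $u_x<0$. Let $\mathcal D^\alpha_0=\{(u,\mu,\nu)\in\mathcal D^\alpha:\mu=\nu\}$. Write $F(x)=\mu((-\infty,x))$,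 $F_{\mathrm{ac}}(x)=\mu_{\mathrm{ac}}((-\infty,x))$, $F_\infty=\mu(\mathbb R)$, $G_\infty=\nu(\mathbb R)$. *Map $L$.* $L((u,\mu,\nu))=(y,U,V,H)$ with $y(\xi)=\sup\{x: x+\nu((-\infty,x))<\xi\}$, $U(\xi)=u(y(\xi))$, $H(\xi)=\xi-y(\xi)$, $V(\xi)=\int_{-\infty}^\xi\frac{d\mu}{d\nu}(y(\eta))H_\xi(\eta)\,d\eta$. *Projection.* Let $0<\Delta x\le1$, $x_k=k\Delta x$, $f_k=f(x_k)$, $Df_{2j}=\frac{f_{2j+2}-f_{2j}}{2\Delta x}$, $q_{2j}=\sqrt{DF_{\mathrm{ac},2j}-(Du_{2j})^2}$, and choose for each $j\in\mathbb Z$ an arbitrary sign $\sigma_j\in\{1,-1\}$. For $(u,\mu,\mu)\in\mathcal D_0^\alpha$ put $P_{\Delta x}((u,\mu,\mu))=(u_{\Delta x},\mu_{\Delta x},\mu_{\Delta x})$, where $$u_{\Delta x}(x)=\begin{cases}u_{2j}+(Du_{2j}-\sigma_jq_{2j})(x-x_{2j}),&x_{2j}<x\le x_{2j+1},\\u_{2j+2}+(Du_{2j}+\sigma_jq_{2j})(x-x_{2j+2}),&x_{2j+1}<x\le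 x_{2j+2},\end{cases}$$ and $\mu_{\Delta x}$ is the measure with $\mu_{\Delta x}((-\infty,x))=F_{\Delta x,\mathrm{ac}}(x)+F_{\Delta x,\mathrm{sing}}(x)$, where $F_{\Delta x,\mathrm{sing}}(x)=F_{2j+2}-F_{\mathrm{ac},2j+2}$ for $x_{2j}<x\le x_{2j+2}$ and $$F_{\Delta x,\mathrm{ac}}(x)=\begin{cases}F_{\mathrm{ac},2j}+(Du_{2j}-\sigma_jq_{2j})^2(x-x_{2j}),&x_{2j}<x\le x_{2j+1},\\\tfrac12(F_{\mathrm{ac},2j+2}+F_{\mathrm{ac},2j})-2\sigma_jDu_{2j}q_{2j}\Delta x+(Du_{2j}+\sigma_jq_{2j})^2(x-x_{2j+1}),&x_{2j+1}<x\le x_{2j+2}.\end{cases}$$ *Solution operator.* For initial data $\bar X=(\bar y,\bar U,\bar V,\bar H)$ let $\tau(\xi)=0$ if $\bar y_\xi(\xi)=\bar U_\xi(\xi)=0$, $\tau(\xi)=-2\bar y_\xi(\xi)/\bar U_\xi(\xi)$ if $\bar U_\xi(\xi)<0$, and $\tau(\xi)=\infty$ otherwise. $S_t(\bar X)=X(t)=(y,U,V,H)(t)$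 denotes the solution, with $(y-\mathrm{id},U,V,H)(t)\in[W^{1,\infty}(\mathbb R)]^4$ and $X(0)=\bar X$, of $$y_t=U,\quad U_t=\tfrac12V-\tfrac14V_\infty(t),\quad V(t,\xi)=\int_{-\infty}^\xi\big(1-\alpha(y(\tau(\eta),\eta))\chi_{\{t\ge\tau(\eta)>0\}}\big)\bar V_\xi(\eta)\,d\eta,\quad H_t=0,$$ where $V_\infty(t)=\lim_{\xi\to\infty}V(t,\xi)$ and the second equation is understood in integrated form. *Relabeling.* Let $(\bar u,\bar\mu,\bar\nu)\in\mathcal D_0^\alpha$, $(\bar u_{\Delta x},\bar\mu_{\Delta x},\bar\nu_{\Delta x})=P_{\Delta x}((\bar u,\bar\mu,\bar\nu))$, $\bar X=L((\bar u,\bar\mu,\bar\nu))$, $\bar X_{\Delta x}=L(P_{\Delta x}((\bar u,\bar\mu,\bar\nu)))$ with first components $\bar y,\bar y_{\Delta x}$, and $$\phi(r)=\sup\{\xi:\bar y(\xi')<\bar y_{\Delta x}(2r-\xi')\text{ for all }\xi'<\xi\},\qquad\psi(r)=2r-\phi(r).$$ Let $\bar{\mathcal X}=(\bar{\mathcal Y},\bar{\mathcal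 U},\bar{\mathcal V},\bar{\mathcal H})=\bar X\circ\phi$ and $\bar{\mathcal X}_{\Delta x}=(\bar{\mathcal Y}_{\Delta x},\bar{\mathcal U}_{\Delta x},\bar{\mathcal V}_{\Delta x},\bar{\mathcal H}_{\Delta x})=\bar X_{\Delta x}\circ\psi$ (componentwise composition), $\mathcal B=\{r:\bar{\mathcal Y}_r(r)=0\}$, and $\mathcal B^c=\mathbb R\setminus\mathcal B$. For $\mathcal X=(\mathcal Y,\mathcal U,\mathcal V,\mathcal H)$ let $g(\mathcal X)(r)=(1-\alpha(\mathcal Y(r)))\mathcal V_r(r)$ if $\mathcal U_r(r)<0$ and $g(\mathcal X)(r)=\mathcal V_r(r)$ if $\mathcal U_r(r)\ge0$. **Theorem.** Let $0\le t\le T$, let $\mathcal X(t)=S_t(\bar{\mathcal X})$ and $\hat{\mathcal X}_{\Delta x}(t)=S_t(\bar{\mathcal X}_{\Delta x})$, with third components $\mathcal V$ and $\hat{\mathcal V}_{\Delta x}$, and let $\bar F_\infty=\bar\mu(\mathbb R)$, $\bar G_\infty=\bar\nu(\mathbb R)$. Then $$\begin{aligned}\int_0^t\|\mathcal V_r(s)-\hat{\mathcal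 V}_{\Delta x,r}(s)\|_{L^1(\mathcal B^c)}ds\le\Big(&T\big(4+T\|\alpha'\|_\infty(\|\bar u\|_\infty+\tfrac14T\bar F_\infty)\big)\|\bar{\mathcal H}_r-\bar{\mathcal H}_{\Delta x,r}\|_{L^1(\mathcal B^c)}\\&+T\|g(\bar{\mathcal X})-g(\bar{\mathcal X}_{\Delta x})\|_{L^1(\mathcal B^c)}\\&+4\big(1+T\|\alpha'\|_\infty(\|\bar u\|_\infty+(1+\sqrt2)\bar F_\infty^{1/2}\Delta x^{1/2}+\tfrac14T\bar F_\infty)\big)\big(1+\tfrac12T\big)\bar G_\infty^{1/2}\|\bar{\mathcal U}_r-\bar{\mathcal U}_{\Delta x,r}\|_{L^2(\mathcal B^c)}\\&+T^2\|\alpha'\|_\infty\bar F_\infty\|\bar u-\bar u_{\Delta x}\|_\infty+4T\|\alpha'\|_\infty\bar G_\infty\Delta x\Big)\,e^{\frac14T^2\|\alpha'\|_\infty\bar G_\infty}.\end{aligned}$$ -/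

import Mathlib

open MeasureTheory Set Filter Topology
open scoped ENNReal

noncomputable section

namespace HunterSaxton

/-! ### Function spaces -/

/-- `f ∈ W^{1,∞}(ℝ)`, for the continuous representative: bounded and Lipschitz continuous. -/
def MemW1inf (f : ℝ → ℝ) : Prop :=
  (∃ K : NNReal, LipschitzWith K f) ∧ ∃ C : ℝ, ∀ x, |f x| ≤ C

/-- `f ∈ H¹(ℝ)`, for the continuous representative: `f ∈ L²(ℝ)` is the primitive of a function
in `L²(ℝ)`. -/
def MemH1 (f : ℝ → ℝ) : Prop :=
  MemLp f 2 volume ∧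
    ∃ f' : ℝ → ℝ, MemLp f' 2 volume ∧ ∀ a b : ℝ, f b - f a = ∫ x in a..b, f' x

/-- The function `φ⁺` of a smooth partition of unity `φ⁺ + φ⁻ = 1` with
`supp φ⁺ ⊆ (-1, ∞)` and `supp φ⁻ ⊆ (-∞, 1)`. The spaces below do not depend on its choice. -/
def cutPlus (x : ℝ) : ℝ := Real.smoothTransition (x + 1 / 2)

/-- The function `φ⁻ = 1 - φ⁺` of the partition of unity. -/
def cutMinus (x : ℝ) : ℝ := 1 - cutPlus x

/-- `f ∈ E₂`: `f = h + a φ⁺ + b φ⁻` with `h ∈ H¹(ℝ)` and `a, b ∈ ℝ`. -/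
def MemE2 (f : ℝ → ℝ) : Prop :=
  ∃ (h : ℝ → ℝ) (a b : ℝ), MemH1 h ∧ ∀ x, f x = h x + a * cutPlus x + b * cutMinus x

/-- `f ∈ E₁⁰`: `f = h + a φ⁺` with `h ∈ L²(ℝ)` and `a ∈ ℝ`. -/
def MemE10 (f : ℝ → ℝ) : Prop :=
  ∃ (h : ℝ → ℝ) (a : ℝ), MemLp h 2 volume ∧ ∀ x, f x = h x + a * cutPlus x

/-- The norm of `L^∞(ℝ)`. -/
def supNorm (f : ℝ → ℝ) : ℝ := (eLpNorm f ∞ volume).toReal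

/-- The norm of `L^p(A)`, as a real number. -/
def normOn (p : ℝ≥0∞) (A : Set ℝ) (f : ℝ → ℝ) : ℝ := (eLpNorm f p (volume.restrict A)).toReal

/-! ### Eulerian coordinates -/

/-- A triplet `(u, μ, ν)`. -/
structure Eulerian where
  u : ℝ → ℝ
  μ : Measure ℝ
  ν : Measure ℝ

/-- The part of `μ` that is absolutely continuous with respect to Lebesgue measure. -/
def acPart (μ : Measure ℝ) : Measure ℝ := volume.withDensity (μ.rnDeriv volume)

/-- The cumulative function `x ↦ μ((-∞, x))`. -/
def cumul (μ : Measure ℝ) (x : ℝ) : ℝ := μ.real (Iio x)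

/-- The set `𝒟^α` of Eulerian coordinates. -/
structure MemD (d : Eulerian) : Prop where
  memE2 : MemE2 d.u
  finite_nu : IsFiniteMeasure d.ν
  le : d.μ ≤ d.ν
  ac_le : acPart d.μ ≤ acPart d.ν
  ac_eq : acPart d.μ = volume.withDensity (fun x => ENNReal.ofReal (deriv d.u x ^ 2))
  cumul_mu : MemE10 (cumul d.μ)
  cumul_nu : MemE10 (cumul d.ν)
  density_pos : ∀ᵐ x ∂d.ν, 0 < d.μ.rnDeriv d.ν x
  density_ac : ∀ᵐ x ∂(acPart d.ν), deriv d.u x < 0 → (acPart d.μ).rnDeriv (acPart d.ν) x = 1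

/-- The set `𝒟₀^α` of Eulerian coordinates with `μ = ν`. -/
def MemD0 (d : Eulerian) : Prop := MemD d ∧ d.μ = d.ν

/-! ### The projection operator -/

/-- The mesh point `x_k = k Δx`. -/
def mesh (Δx : ℝ) (k : ℤ) : ℝ := k * Δx

/-- The difference quotient `D f_{2j} = (f(x_{2j+2}) - f(x_{2j})) / (2 Δx)`. -/
def diffQuot (Δx : ℝ) (f : ℝ → ℝ) (j : ℤ) : ℝ :=
  (f (mesh Δx (2 * j + 2)) - f (mesh Δx (2 * j))) / (2 * Δx)

/-- The index `j` of the cell `(x_{2j}, x_{2j+2}]` that contains `x`. -/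
def cellIndex (Δx x : ℝ) : ℤ := ⌈x / (2 * Δx)⌉ - 1

/-- `q_{2j} = √(D F_{ac,2j} - (D u_{2j})²)`. -/
def qCoeff (Δx : ℝ) (d : Eulerian) (j : ℤ) : ℝ :=
  √(diffQuot Δx (cumul (acPart d.μ)) j - diffQuot Δx d.u j ^ 2)

/-- The projected wave profile. On the `j`-th cell the upper signs in `∓`, `±` are used if
`σ j = 1` and the lower ones if `σ j = -1`. -/
def projU (Δx : ℝ) (σ : ℤ → ℝ) (d : Eulerian) (x : ℝ) : ℝ :=
  let j := cellIndex Δx x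
  if x ≤ mesh Δx (2 * j + 1) then
    d.u (mesh Δx (2 * j))
      + (diffQuot Δx d.u j - σ j * qCoeff Δx d j) * (x - mesh Δx (2 * j))
  else
    d.u (mesh Δx (2 * j + 2))
      + (diffQuot Δx d.u j + σ j * qCoeff Δx d j) * (x - mesh Δx (2 * j + 2))

/-- The absolutely continuous part of the projected cumulative energy. -/
def projFac (Δx : ℝ) (σ : ℤ → ℝ) (d : Eulerian) (x : ℝ) : ℝ :=
  let j := cellIndex Δx x
  let Fac := cumul (acPart d.μ)
  if x ≤ mesh Δx (2 * j + 1) then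
    Fac (mesh Δx (2 * j))
      + (diffQuot Δx d.u j - σ j * qCoeff Δx d j) ^ 2 * (x - mesh Δx (2 * j))
  else
    (Fac (mesh Δx (2 * j + 2)) + Fac (mesh Δx (2 * j))) / 2
      - σ j * (2 * diffQuot Δx d.u j * qCoeff Δx d j * Δx)
      + (diffQuot Δx d.u j + σ j * qCoeff Δx d j) ^ 2 * (x - mesh Δx (2 * j + 1))

/-- The singular part of the projected cumulative energy. -/
def projFsing (Δx : ℝ) (d : Eulerian) (x : ℝ) : ℝ :=
  let j := cellIndex Δx x
  cumul d.μ (mesh Δx (2 * j + 2)) - cumul (acPart d.μ) (mesh Δx (2 * j + 2))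

/-- The projected cumulative energy. -/
def projF (Δx : ℝ) (σ : ℤ → ℝ) (d : Eulerian) (x : ℝ) : ℝ :=
  projFac Δx σ d x + projFsing Δx d x

open Classical in
/-- The measure with left-continuous cumulative function `F`: the Lebesgue-Stieltjes measure of
the increasing function `F`. (The projected cumulative energy of a triplet in `𝒟₀^α` is
increasing and left-continuous, with limit `0` at `-∞`.) -/
def cumulMeasure (F : ℝ → ℝ) : Measure ℝ :=
  if hF : Monotone F then hF.stieltjesFunction.measure else 0

/-- The projection operator `P_Δx`, for a choice `σ` of signs. -/
def proj (Δx : ℝ) (σ : ℤ → ℝ) (d : Eulerian) : Eulerian where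
  u := projU Δx σ d
  μ := cumulMeasure (projF Δx σ d)
  ν := cumulMeasure (projF Δx σ d)

/-! ### Lagrangian coordinates -/

/-- A quadruplet `(y, U, V, H)`. -/
structure Lagrangian where
  y : ℝ → ℝ
  U : ℝ → ℝ
  V : ℝ → ℝ
  H : ℝ → ℝ

/-- First component of the map `L`: `y(ξ) = sup {x | x + ν((-∞, x)) < ξ}`. -/
def charY (ν : Measure ℝ) (ξ : ℝ) : ℝ := sSup {x : ℝ | x + cumul ν x < ξ}

/-- The map `L` from Eulerian to Lagrangian coordinates. -/
def mapL (d : Eulerian) : Lagrangian where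
  y := charY d.ν
  U := fun ξ => d.u (charY d.ν ξ)
  V := fun ξ => ∫ η in Iic ξ,
    (d.μ.rnDeriv d.ν (charY d.ν η)).toReal * deriv (fun ζ => ζ - charY d.ν ζ) η
  H := fun ξ => ξ - charY d.ν ξ

/-- Relabeling `X • f = (y ∘ f, U ∘ f, V ∘ f, H ∘ f)`. -/
def Lagrangian.relabel (X : Lagrangian) (f : ℝ → ℝ) : Lagrangian where
  y := fun r => X.y (f r)
  U := fun r => X.U (f r)
  V := fun r => X.V (f r)
  H := fun r => X.H (f r)

open Classical in
/-- The wave breaking function of the initial data `X₀`. -/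
def breakTime (X₀ : Lagrangian) (ξ : ℝ) : ℝ≥0∞ :=
  if deriv X₀.y ξ = 0 ∧ deriv X₀.U ξ = 0 then 0
  else if deriv X₀.U ξ < 0 then ENNReal.ofReal (-(2 * deriv X₀.y ξ / deriv X₀.U ξ))
  else ⊤

open Classical in
/-- `1 - α(y(τ(η), η)) χ_{t ≥ τ > 0}(η)`: the fraction of the initial energy density at `η` that
is left at time `t`. -/
def energyFactor (α : ℝ → ℝ) (X₀ : Lagrangian) (X : ℝ → Lagrangian) (t η : ℝ) : ℝ :=
  if 0 < breakTime X₀ η ∧ breakTime X₀ η ≤ ENNReal.ofReal t then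
    1 - α ((X (breakTime X₀ η).toReal).y η)
  else 1

/-- `X(t) = S_t(X₀)` for all `t ≥ 0`: `X` is the global solution of the Lagrangian system with
initial data `X₀`. Since `V` may jump in time, the equation `U_t = V/2 - V_∞/4` is understood in
integrated form. -/
structure IsLagrangianSolution (α : ℝ → ℝ) (X₀ : Lagrangian) (X : ℝ → Lagrangian) : Prop where
  regular : ∀ t, 0 ≤ t → MemW1inf (fun ξ => (X t).y ξ - ξ) ∧ MemW1inf (X t).U ∧
    MemW1inf (X t).V ∧ MemW1inf (X t).H
  initial : X 0 = X₀
  y_eq : ∀ t, 0 ≤ t → ∀ ξ, HasDerivWithinAt (fun s => (X s).y ξ) ((X t).U ξ) (Ici 0) t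
  U_eq : ∃ Vinf : ℝ → ℝ, (∀ t, 0 ≤ t → Tendsto (X t).V atTop (𝓝 (Vinf t))) ∧
    ∀ t, 0 ≤ t → ∀ ξ,
      (X t).U ξ = X₀.U ξ + ∫ s in (0 : ℝ)..t, (1 / 2 * (X s).V ξ - 1 / 4 * Vinf s)
  V_eq : ∀ t, 0 ≤ t → ∀ ξ,
    (X t).V ξ = ∫ η in Iic ξ, energyFactor α X₀ X t η * deriv X₀.V η
  H_eq : ∀ t, 0 ≤ t → ∀ ξ, (X t).H ξ = X₀.H ξ

/-! ### The additional change of variables -/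

/-- `φ(r) = sup {ξ | y(ξ') < y_Δx(2r - ξ') for all ξ' < ξ}`. -/
def phiMap (X XΔ : Lagrangian) (r : ℝ) : ℝ :=
  sSup {ξ : ℝ | ∀ ξ' < ξ, X.y ξ' < XΔ.y (2 * r - ξ')}

/-- `ψ(r) = 2r - φ(r)`. -/
def psiMap (X XΔ : Lagrangian) (r : ℝ) : ℝ := 2 * r - phiMap X XΔ r

/-- The set `{r | 𝒴_r(r) = 0}`; it is only used up to null sets, and `𝒴` is Lipschitz. -/
def flatSet (X : Lagrangian) : Set ℝ := {r | deriv X.y r = 0}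

open Classical in
/-- The function `g(𝒳)`. -/
def gFun (α : ℝ → ℝ) (X : Lagrangian) (r : ℝ) : ℝ :=
  if deriv X.U r < 0 then (1 - α (X.y r)) * deriv X.V r else deriv X.V r

end HunterSaxton

end

open HunterSaxton

noncomputable section

namespace HunterSaxton

/-! ### Real analysis -/

/-! The relabelings are chosen so that both initial data have the same first component 𝒴, and φ + ψ
= 2r turns into 2𝒴 + 𝒱 + 𝒱_Δ = 2r (`hsum`). Since μ = ν, also 𝒱 = ℋ for both data. Almost everywhere
off the flat set both satisfy 𝒰_r² = 𝒴_r 𝒱_r. A breaking time τ = -2𝒴_r/𝒰_r therefore obeys τ𝒱_r =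
-2𝒰_r and τ²𝒱_r = 4𝒴_r. These two identities trade the possibly large factor τ for quantities that
are controlled.

Where 𝒴_r = 0 the energy density never changes, so only the complement of the flat set matters.
There the order of integration is exchanged, and the gap of the densities is integrated in time at a
fixed point r (`lintegral_energyDensity_sub_le`). If neither solution breaks, the gap is constant.
If exactly one breaks, the slopes have opposite signs, the jump is compared with g, and the
displacement of the characteristic up to τ costs at most a multiple of |𝒰_r - 𝒰_Δ,r|. If both break,
the steeper one breaks first; the time between the two breakings costs 2|𝒰_r - 𝒰_Δ,r|, and
afterwards α is evaluated at two positions whose distance is bounded by the speed of one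
characteristic and by the distance of the two characteristics.

The distance of the characteristics comes from integrating the system twice in time
(`abs_y_sub_le`). It involves the initial gaps and the time integral of the unknown `cumulGap`
itself, so the final estimate closes with Grönwall's inequality.

It remains to integrate in r (`cumulGap_le`). The slope terms live on the set where some solution
breaks before T; its part off the flat set has measure at most G(1 + T²/2), so Cauchy-Schwarz gives
the L² norm (`lintegral_breakSet_le`). The term 𝒴_r|𝒱 - 𝒱_Δ| becomes the integral of |F - F_Δ| after
the substitution x = 𝒴(r). Both cumulative functions lie between the values of F at the ends of a
cell, and the integral is of order Δx (`lintegral_deriv_mul_abs_sub_V_le`). -/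

theorem intervalIntegral_deriv_of_lipschitz {f : ℝ → ℝ} {K : NNReal} (hf : LipschitzWith K f)
    (a b : ℝ) : ∫ x in a..b, deriv f x = f b - f a :=
  (hf.lipschitzOnWith.absolutelyContinuousOnInterval).integral_deriv_eq_sub

theorem intervalIntegrable_deriv_of_lipschitz {f : ℝ → ℝ} {K : NNReal} (hf : LipschitzWith K f)
    (a b : ℝ) : IntervalIntegrable (deriv f) volume a b :=
  (hf.lipschitzOnWith.absolutelyContinuousOnInterval).intervalIntegrable_deriv

theorem integrable_deriv_of_monotone {f : ℝ → ℝ} {K : NNReal} (hf : LipschitzWith K f)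
    (hm : Monotone f) {l m : ℝ} (hl : Tendsto f atBot (𝓝 l)) (hu : Tendsto f atTop (𝓝 m)) :
    Integrable (deriv f) := by
  refine integrable_of_intervalIntegral_norm_tendsto (m - l) (a := fun x : ℝ => -x)
    (b := fun x : ℝ => x) (l := atTop)
    (fun i => ?_) tendsto_neg_atTop_atBot tendsto_id ?_
  · have := intervalIntegrable_deriv_of_lipschitz hf (-i) i
    exact this.1
  · have : ∀ i : ℝ, ∫ x in (-i)..i, ‖deriv f x‖ = f i - f (-i) := by
      intro i
      rw [← intervalIntegral_deriv_of_lipschitz hf]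
      refine intervalIntegral.integral_congr fun x _ => ?_
      simp only [Real.norm_eq_abs]
      exact abs_of_nonneg hm.deriv_nonneg
    simp_rw [this]
    exact hu.sub (hl.comp tendsto_neg_atTop_atBot)

theorem setIntegral_Iic_deriv_of_monotone {f : ℝ → ℝ} {K : NNReal} (hf : LipschitzWith K f)
    (hm : Monotone f) {l m : ℝ} (hl : Tendsto f atBot (𝓝 l)) (hu : Tendsto f atTop (𝓝 m)) (x : ℝ) :
    ∫ z in Iic x, deriv f z = f x - l := by
  have h1 := intervalIntegral_tendsto_integral_Iic x
    (integrable_deriv_of_monotone hf hm hl hu).integrableOn tendsto_id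
  refine tendsto_nhds_unique h1 ?_
  simp_rw [intervalIntegral_deriv_of_lipschitz hf]
  exact tendsto_const_nhds.sub hl

theorem integral_deriv_of_monotone {f : ℝ → ℝ} {K : NNReal} (hf : LipschitzWith K f)
    (hm : Monotone f) {l m : ℝ} (hl : Tendsto f atBot (𝓝 l)) (hu : Tendsto f atTop (𝓝 m)) :
    ∫ z, deriv f z = m - l := by
  have h1 := intervalIntegral_tendsto_integral
    (integrable_deriv_of_monotone hf hm hl hu) tendsto_neg_atTop_atBot tendsto_id
  refine tendsto_nhds_unique h1 ?_
  simp_rw [intervalIntegral_deriv_of_lipschitz hf]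
  exact hu.sub (hl.comp tendsto_neg_atTop_atBot)

theorem ae_hasDerivAt_setIntegral_Iic {f : ℝ → ℝ} (hf : Integrable f) :
    ∀ᵐ x, HasDerivAt (fun x => ∫ z in Iic x, f z) (f x) x := by
  filter_upwards [LocallyIntegrable.ae_hasDerivAt_integral hf.locallyIntegrable] with x hx
  have := (hx 0).const_add (∫ z in Iic 0, f z)
  refine this.congr_of_eventuallyEq (Eventually.of_forall fun y => ?_)
  simp only
  rw [← intervalIntegral.integral_Iic_sub_Iic hf.integrableOn hf.integrableOn]
  ring

/-- The area formula for a monotone map, applied on its set of differentiability, which has full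
measure. Only an inequality remains because the image of that set need not be the whole line. -/
theorem lintegral_deriv_mul_comp_le {Y : ℝ → ℝ} (hY : Monotone Y) (f : ℝ → ℝ≥0∞) :
    ∫⁻ r, ENNReal.ofReal (deriv Y r) * f (Y r) ≤ ∫⁻ x, f x := by
  have hs : MeasurableSet {r | DifferentiableAt ℝ Y r} := measurableSet_of_differentiableAt ℝ Y
  have h1 := lintegral_image_eq_lintegral_deriv_mul_of_monotoneOn (f' := deriv Y) hs
    (fun x hx => (DifferentiableAt.hasDerivAt hx).hasDerivWithinAt) (hY.monotoneOn _) f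
  have h2 : ∫⁻ r, ENNReal.ofReal (deriv Y r) * f (Y r)
      = ∫⁻ r in {r | DifferentiableAt ℝ Y r}, ENNReal.ofReal (deriv Y r) * f (Y r) := by
    rw [Measure.restrict_eq_self_of_ae_mem]
    exact hY.ae_differentiableAt
  rw [h2, ← h1]
  exact setLIntegral_le_lintegral _ _

/-- If N is null, the integral of `deriv Y` times the indicator of N at `Y` is at most |N| = 0.
Almost everywhere statements in x can thus be pulled back to r wherever `deriv Y` does not vanish.
-/
theorem ae_comp_of_deriv_ne_zero {Y : ℝ → ℝ} (hY : Monotone Y) {P : ℝ → Prop}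
    (hP : ∀ᵐ x, P x) : ∀ᵐ r, deriv Y r ≠ 0 → P (Y r) := by
  set N := toMeasurable volume {x | ¬ P x} with hN
  have hN0 : volume N = 0 := by rw [hN, measure_toMeasurable]; exact hP
  have hm : MeasurableSet N := measurableSet_toMeasurable _ _
  have h := lintegral_deriv_mul_comp_le hY (N.indicator 1)
  rw [lintegral_indicator_one hm, hN0, nonpos_iff_eq_zero, lintegral_eq_zero_iff] at h
  · filter_upwards [h] with r hr h0
    by_contra hc
    have : Y r ∈ N := subset_toMeasurable _ _ hc
    simp only [Pi.zero_apply, mul_eq_zero, ENNReal.ofReal_eq_zero, indicator_of_mem this,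
      Pi.one_apply, one_ne_zero, or_false] at hr
    exact h0 (le_antisymm hr hY.deriv_nonneg)
  · exact (measurable_deriv Y).ennreal_ofReal.mul
      ((measurable_one.indicator hm).comp hY.measurable)

/-- Grönwall's inequality in integral form. -/
theorem le_mul_exp_of_le_add_integral {f : ℝ → ℝ} (hf : Continuous f) {C K t : ℝ} (ht : 0 ≤ t)
    (hK : 0 ≤ K) (h : ∀ s ∈ Icc 0 t, f s ≤ C + K * ∫ x in (0 : ℝ)..s, f x) :
    f t ≤ C * Real.exp (K * t) := by
  have hd : ∀ x, HasDerivAt (fun s => ∫ x in (0 : ℝ)..s, f x) (f x) x := fun x =>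
    intervalIntegral.integral_hasDerivAt_right (hf.intervalIntegrable _ _)
      hf.stronglyMeasurable.stronglyMeasurableAtFilter hf.continuousAt
  set R : ℝ → ℝ := fun s => C + K * ∫ x in (0 : ℝ)..s, f x with hR
  have hRd : ∀ x, HasDerivAt R (K * f x) x := fun x => ((hd x).const_mul K).const_add C
  have hE : ∀ x, HasDerivAt (fun s => R s * Real.exp (-(K * s)))
      (K * f x * Real.exp (-(K * x)) + R x * (Real.exp (-(K * x)) * -(K * 1))) x := fun x =>
    (hRd x).mul (((hasDerivAt_id x).const_mul K).neg.exp)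
  -- The right-hand side R satisfies R' = K f ≤ K R, so R(s) exp(-K s) is nonincreasing. No sign of
  -- f or C enters.
  have hanti : AntitoneOn (fun s => R s * Real.exp (-(K * s))) (Icc 0 t) := by
    refine antitoneOn_of_deriv_nonpos (convex_Icc 0 t)
      (fun x _ => (hE x).continuousAt.continuousWithinAt)
      (fun x _ => (hE x).differentiableAt.differentiableWithinAt) fun x hx => ?_
    rw [interior_Icc] at hx
    rw [(hE x).deriv]
    have h1 := h x ⟨hx.1.le, hx.2.le⟩
    have h2 : K * Real.exp (-(K * x)) * (f x - R x) ≤ 0 :=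
      mul_nonpos_of_nonneg_of_nonpos (by positivity) (by simp only [hR]; linarith)
    linarith
  have h3 := hanti (left_mem_Icc.2 ht) (right_mem_Icc.2 ht) ht
  simp only [mul_zero, neg_zero, Real.exp_zero, mul_one] at h3
  have h4 : R 0 = C := by simp [hR]
  rw [h4, Real.exp_neg] at h3
  calc f t ≤ R t := h t (right_mem_Icc.2 ht)
    _ = R t * (Real.exp (K * t))⁻¹ * Real.exp (K * t) := by
      rw [mul_assoc, inv_mul_cancel₀ (Real.exp_pos _).ne', mul_one]
    _ ≤ C * Real.exp (K * t) := by gcongr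

/-! ### Cumulative functions -/

theorem cumul_nonneg (ν : Measure ℝ) (x : ℝ) : 0 ≤ cumul ν x := measureReal_nonneg

theorem bddAbove_charY_set (ν : Measure ℝ) (ξ : ℝ) : BddAbove {x : ℝ | x + cumul ν x < ξ} :=
  ⟨ξ, fun x hx => by
    have := cumul_nonneg ν x
    simp only [mem_ofPred_eq] at hx; linarith⟩

section Cumul
variable (ν : Measure ℝ) [IsFiniteMeasure ν]

theorem cumul_mono : Monotone (cumul ν) := fun _ _ h =>
  measureReal_mono (Iio_subset_Iio h)

theorem cumul_le_univ (x : ℝ) : cumul ν x ≤ ν.real univ := measureReal_mono (subset_univ _)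

theorem Iic_le_cumul {x y : ℝ} (h : x < y) : ν.real (Iic x) ≤ cumul ν y :=
  measureReal_mono (Iic_subset_Iio.2 h)

theorem tendsto_cumul_left (x : ℝ) : Tendsto (cumul ν) (𝓝[<] x) (𝓝 (cumul ν x)) := by
  have h : Tendsto (fun z => ν (Iio z)) (𝓝[<] x) (𝓝 (ν (Iio x))) := by
    rw [← map_coe_Iio_atTop x, tendsto_map'_iff]
    have h1 : Iio x = ⋃ z : Iio x, Iio (z : ℝ) := by
      ext w
      simp only [mem_Iio, mem_iUnion, Subtype.exists, exists_prop]
      constructor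
      · intro hw
        obtain ⟨z, hz⟩ := exists_between hw
        exact ⟨z, hz.2, hz.1⟩
      · rintro ⟨z, hz, hw⟩
        exact hw.trans hz
    conv_rhs => rw [h1]
    exact tendsto_measure_iUnion_atTop fun a b hab => Iio_subset_Iio hab
  exact (ENNReal.tendsto_toReal (measure_ne_top _ _)).comp h

theorem tendsto_cumul_right (x : ℝ) : Tendsto (cumul ν) (𝓝[>] x) (𝓝 (ν.real (Iic x))) := by
  have h1 : Iic x = ⋂ z > x, Iio z := by
    ext w
    simp only [mem_Iic, mem_iInter, mem_Iio]
    exact ⟨fun h z hz => h.trans_lt hz, fun h => le_of_forall_gt h⟩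
  have h : Tendsto (fun z => ν (Iio z)) (𝓝[>] x) (𝓝 (ν (Iic x))) := by
    conv_rhs => rw [h1]
    exact tendsto_measure_biInter_gt (fun r _ => measurableSet_Iio.nullMeasurableSet)
      (fun i j _ hij => Iio_subset_Iio hij) ⟨x + 1, by simp, measure_ne_top _ _⟩
  exact (ENNReal.tendsto_toReal (measure_ne_top _ _)).comp h

theorem tendsto_cumul_atTop : Tendsto (cumul ν) atTop (𝓝 (ν.real univ)) := by
  have h : Tendsto (fun z => ν (Iio z)) atTop (𝓝 (ν univ)) := by
    rw [← iUnion_Iio (α := ℝ)]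
    exact tendsto_measure_iUnion_atTop fun a b hab => Iio_subset_Iio hab
  exact (ENNReal.tendsto_toReal (measure_ne_top _ _)).comp h

theorem tendsto_cumul_atBot : Tendsto (cumul ν) atBot (𝓝 0) := by
  have h : Tendsto (fun z => ν (Iio z)) atBot (𝓝 0) := by
    have := tendsto_measure_iInter_atBot (μ := ν) (s := fun z : ℝ => Iio z)
      (fun i => measurableSet_Iio.nullMeasurableSet)
      (fun a b hab => Iio_subset_Iio hab) ⟨0, measure_ne_top _ _⟩
    have h2 : ⋂ z : ℝ, Iio z = ∅ := by
      ext w; simp only [mem_iInter, mem_Iio, mem_empty_iff_false, iff_false, not_forall, not_lt]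
      exact ⟨w, le_rfl⟩
    rwa [h2, measure_empty] at this
  have := (ENNReal.tendsto_toReal ENNReal.zero_ne_top).comp h
  exact this

/-- `cumul` is left-continuous while Stieltjes functions are right-continuous; the right limit of
`cumul` at x is the mass of `Iic x`, which is what a Stieltjes function should record. -/
theorem stieltjesFunction_cumul_measure : (cumul_mono ν).stieltjesFunction.measure = ν := by
  have h0 : Tendsto (cumul_mono ν).stieltjesFunction atBot (𝓝 0) := by
    exact tendsto_rightLim_atBot_of_tendsto (tendsto_cumul_atBot ν)
  have h1 : ∀ x, (cumul_mono ν).stieltjesFunction.measure (Iic x) = ν (Iic x) := by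
    intro x
    rw [StieltjesFunction.measure_Iic _ h0, Monotone.stieltjesFunction_eq,
      rightLim_eq_of_tendsto (tendsto_cumul_right ν x), sub_zero]
    simp [measureReal_def]
  have htop : Tendsto (cumul_mono ν).stieltjesFunction atTop (𝓝 (ν.real univ)) := by
    exact tendsto_rightLim_atTop_of_tendsto (tendsto_cumul_atTop ν)
  have : IsFiniteMeasure (cumul_mono ν).stieltjesFunction.measure :=
    ⟨by rw [StieltjesFunction.measure_univ _ h0 htop]; exact ENNReal.ofReal_lt_top⟩
  exact Measure.ext_of_Iic _ _ h1

theorem ae_hasDerivAt_cumul :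
    ∀ᵐ x, HasDerivAt (cumul ν) (ν.rnDeriv volume x).toReal x := by
  have := (cumul_mono ν).ae_hasDerivAt
  rwa [stieltjesFunction_cumul_measure] at this

/-! ### The characteristics -/

theorem nonempty_charY_set (ξ : ℝ) : {x : ℝ | x + cumul ν x < ξ}.Nonempty :=
  ⟨ξ - ν.real univ - 1, by
    have := cumul_le_univ ν (ξ - ν.real univ - 1)
    simp only [mem_ofPred_eq]; linarith⟩

/-- Together with `le_charY_add_Iic` this characterises y(ξ): ξ lies between the left and the right
limit of x + ν((-∞, x)) at x = y(ξ). Everything about y and H follows from these two inequalities.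
-/
theorem charY_add_cumul_le (ξ : ℝ) : charY ν ξ + cumul ν (charY ν ξ) ≤ ξ := by
  have h1 : Tendsto (fun x => x + cumul ν x) (𝓝[<] (charY ν ξ))
      (𝓝 (charY ν ξ + cumul ν (charY ν ξ))) :=
    (tendsto_id.mono_left nhdsWithin_le_nhds).add (tendsto_cumul_left ν _)
  refine le_of_tendsto h1 ?_
  filter_upwards [self_mem_nhdsWithin] with x hx
  obtain ⟨z, hz, hxz⟩ := exists_lt_of_lt_csSup (nonempty_charY_set ν ξ) hx
  have := cumul_mono ν hxz.le
  simp only [mem_ofPred_eq] at hz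
  linarith

theorem le_charY_add_Iic (ξ : ℝ) : ξ ≤ charY ν ξ + ν.real (Iic (charY ν ξ)) := by
  have h1 : Tendsto (fun x => x + cumul ν x) (𝓝[>] (charY ν ξ))
      (𝓝 (charY ν ξ + ν.real (Iic (charY ν ξ)))) :=
    (tendsto_id.mono_left nhdsWithin_le_nhds).add (tendsto_cumul_right ν _)
  refine ge_of_tendsto h1 ?_
  filter_upwards [self_mem_nhdsWithin] with x hx
  by_contra hc
  exact absurd (le_csSup (bddAbove_charY_set ν ξ) (not_le.1 hc)) (not_le.2 hx)

theorem charY_mono : Monotone (charY ν) := fun a b hab =>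
  csSup_le_csSup (bddAbove_charY_set ν b) (nonempty_charY_set ν a) fun _ hx => lt_of_lt_of_le hx hab

theorem charY_sub_le {a b : ℝ} (hab : a ≤ b) : charY ν b - charY ν a ≤ b - a := by
  rcases (charY_mono ν hab).eq_or_lt with h | h
  · rw [h]; linarith
  · have h1 := charY_add_cumul_le ν b
    have h2 := le_charY_add_Iic ν a
    have h3 := Iic_le_cumul ν h
    linarith

theorem lipschitzWith_charY : LipschitzWith 1 (charY ν) :=
  LipschitzWith.of_dist_le_mul fun a b => by
    rw [Real.dist_eq, Real.dist_eq, NNReal.coe_one, one_mul]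
    rcases le_total a b with h | h
    · have h1 := charY_sub_le ν h
      have h2 := charY_mono ν h
      rw [abs_sub_comm, abs_sub_comm a, abs_of_nonneg (by linarith), abs_of_nonneg (by linarith)]
      exact h1
    · have h1 := charY_sub_le ν h
      have h2 := charY_mono ν h
      rw [abs_of_nonneg (by linarith), abs_of_nonneg (by linarith)]
      exact h1

theorem charY_le (ξ : ℝ) : charY ν ξ ≤ ξ := by
  linarith [charY_add_cumul_le ν ξ, cumul_nonneg ν (charY ν ξ)]

theorem sub_le_charY (ξ : ℝ) : ξ - ν.real univ ≤ charY ν ξ := by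
  have : ν.real (Iic (charY ν ξ)) ≤ ν.real univ := measureReal_mono (subset_univ _)
  linarith [le_charY_add_Iic ν ξ]

theorem tendsto_charY_atTop : Tendsto (charY ν) atTop atTop :=
  tendsto_atTop_mono (sub_le_charY ν) (tendsto_atTop_add_const_right _ _ tendsto_id)

theorem tendsto_charY_atBot : Tendsto (charY ν) atBot atBot :=
  tendsto_atBot_mono (charY_le ν) tendsto_id

/-- The cumulative energy `H(ξ) = ξ - y(ξ)`. -/
def charH (ξ : ℝ) : ℝ := ξ - charY ν ξ

theorem cumul_le_charH (ξ : ℝ) : cumul ν (charY ν ξ) ≤ charH ν ξ := by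
  unfold charH; linarith [charY_add_cumul_le ν ξ]

theorem charH_le_Iic (ξ : ℝ) : charH ν ξ ≤ ν.real (Iic (charY ν ξ)) := by
  unfold charH; linarith [le_charY_add_Iic ν ξ]

theorem charH_mono : Monotone (charH ν) := fun a b hab => by
  unfold charH; linarith [charY_sub_le ν hab]

theorem lipschitzWith_charH : LipschitzWith 2 (charH ν) := by
  have := LipschitzWith.id.sub (lipschitzWith_charY ν)
  rw [one_add_one_eq_two] at this
  exact this

theorem tendsto_charH_atTop : Tendsto (charH ν) atTop (𝓝 (ν.real univ)) :=
  tendsto_of_tendsto_of_tendsto_of_le_of_le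
    ((tendsto_cumul_atTop ν).comp (tendsto_charY_atTop ν)) tendsto_const_nhds
    (cumul_le_charH ν) fun ξ => (charH_le_Iic ν ξ).trans (measureReal_mono (subset_univ _))

theorem tendsto_charH_atBot : Tendsto (charH ν) atBot (𝓝 0) := by
  have h1 : Tendsto (fun ξ => cumul ν (charY ν ξ + 1)) atBot (𝓝 0) :=
    (tendsto_cumul_atBot ν).comp
      (tendsto_atBot_add_const_right _ _ (tendsto_charY_atBot ν))
  exact tendsto_of_tendsto_of_tendsto_of_le_of_le tendsto_const_nhds h1
    (fun ξ => (cumul_nonneg ν _).trans (cumul_le_charH ν ξ))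
    fun ξ => (charH_le_Iic ν ξ).trans (Iic_le_cumul ν (by linarith))

theorem charY_le_iff (x ξ : ℝ) : charY ν ξ ≤ x ↔ ξ ≤ x + ν.real (Iic x) := by
  constructor
  · intro h
    have : ν.real (Iic (charY ν ξ)) ≤ ν.real (Iic x) := measureReal_mono (Iic_subset_Iic.2 h)
    linarith [le_charY_add_Iic ν ξ]
  · intro h
    by_contra hc
    linarith [charY_add_cumul_le ν ξ, Iic_le_cumul ν (not_le.1 hc), not_le.1 hc]

theorem charY_apply_jump (x : ℝ) : charY ν (x + ν.real (Iic x)) = x := by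
  have h := (charY_le_iff ν x _).2 le_rfl
  refine le_antisymm h ?_
  by_contra hc
  have := le_charY_add_Iic ν (x + ν.real (Iic x))
  have h2 : ν.real (Iic (charY ν (x + ν.real (Iic x)))) ≤ ν.real (Iic x) :=
    measureReal_mono (Iic_subset_Iic.2 h)
  linarith [not_le.1 hc]

/-- The preimage of `Iic x` under y is `Iic (x + ν(Iic x))`, and H takes the value ν(`Iic x`) at its
endpoint, because y equals x there. -/
theorem map_charY_withDensity :
    (volume.withDensity fun η => ENNReal.ofReal (deriv (charH ν) η)).map (charY ν) = ν := by
  have hint := integrable_deriv_of_monotone (lipschitzWith_charH ν) (charH_mono ν)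
    (tendsto_charH_atBot ν) (tendsto_charH_atTop ν)
  have hfin : IsFiniteMeasure
      (volume.withDensity fun η => ENNReal.ofReal (deriv (charH ν) η)) :=
    isFiniteMeasure_withDensity_ofReal hint.2
  have hm : Measurable (charY ν) := (charY_mono ν).measurable
  refine Measure.ext_of_Iic _ _ fun x => ?_
  rw [Measure.map_apply hm measurableSet_Iic]
  have h1 : charY ν ⁻¹' Iic x = Iic (x + ν.real (Iic x)) := by
    ext ξ; exact charY_le_iff ν x ξ
  rw [h1, withDensity_apply _ measurableSet_Iic, ← ofReal_integral_eq_lintegral_ofReal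
    hint.integrableOn (Eventually.of_forall fun _ => (charH_mono ν).deriv_nonneg),
    setIntegral_Iic_deriv_of_monotone (lipschitzWith_charH ν) (charH_mono ν)
    (tendsto_charH_atBot ν) (tendsto_charH_atTop ν)]
  unfold charH
  rw [charY_apply_jump, sub_zero, add_sub_cancel_left]
  simp [measureReal_def]

/-- This is V = H when μ = ν. The density of ν with respect to itself is 1 only ν-almost everywhere;
by the pushforward identity it is 1 along y almost everywhere with respect to H_ξ dξ, and where H_ξ
= 0 the product vanishes anyway. -/
theorem setIntegral_rnDeriv_self_charY (ξ : ℝ) :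
    ∫ η in Iic ξ, (ν.rnDeriv ν (charY ν η)).toReal * deriv (fun ζ => ζ - charY ν ζ) η
      = charH ν ξ := by
  have hm : Measurable (charY ν) := (charY_mono ν).measurable
  have h1 : ∀ᵐ x ∂ν, ν.rnDeriv ν x = 1 := Measure.rnDeriv_self ν
  have h2 : ∀ᵐ η ∂(volume.withDensity fun η => ENNReal.ofReal (deriv (charH ν) η)),
      ν.rnDeriv ν (charY ν η) = 1 := by
    refine ae_of_ae_map (p := fun z => ν.rnDeriv ν z = 1) hm.aemeasurable ?_
    rwa [map_charY_withDensity]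
  rw [ae_withDensity_iff (measurable_deriv _).ennreal_ofReal] at h2
  have h3 : ∀ᵐ η, (ν.rnDeriv ν (charY ν η)).toReal * deriv (fun ζ => ζ - charY ν ζ) η
      = deriv (charH ν) η := by
    filter_upwards [h2] with η hη
    change _ * deriv (charH ν) η = _
    rcases eq_or_ne (deriv (charH ν) η) 0 with h0 | h0
    · rw [h0, mul_zero]
    · rw [hη]
      · simp
      · have : 0 < deriv (charH ν) η := lt_of_le_of_ne (charH_mono ν).deriv_nonneg h0.symm
        simpa using this
  rw [setIntegral_congr_ae (g := deriv (charH ν)) measurableSet_Iic (h3.mono fun _ h _ => h),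
    setIntegral_Iic_deriv_of_monotone (lipschitzWith_charH ν) (charH_mono ν)
      (tendsto_charH_atBot ν) (tendsto_charH_atTop ν), sub_zero]

end Cumul

/-- H(ξ) is squeezed between ν((-∞, y(ξ))) and ν((-∞, y(ξ)]), which coincide when y(ξ) is a
continuity point. -/
theorem charH_eq_cumul (ν : Measure ℝ) [IsFiniteMeasure ν] {ξ : ℝ}
    (h : ContinuousAt (cumul ν) (charY ν ξ)) : charH ν ξ = cumul ν (charY ν ξ) := by
  refine le_antisymm ?_ (cumul_le_charH ν _)
  have h1 := h.tendsto.mono_left (nhdsWithin_le_nhds (s := Ioi (charY ν ξ)))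
  rw [tendsto_nhds_unique h1 (tendsto_cumul_right ν _)]
  exact charH_le_Iic ν _

/-- Since H ≥ F(y) everywhere, with equality at continuity points of F, the difference has a minimum
there and its derivative vanishes. Hence H_r = F'(Y) Y_r = u_x² Y_r, while U_r = u_x Y_r. -/
theorem deriv_sq_eq_of_relabel (ν : Measure ℝ) [IsFiniteMeasure ν] {u f : ℝ → ℝ} (hf : Monotone f)
    (hu : ∀ᵐ x, ∃ v, HasDerivAt u v x ∧ HasDerivAt (cumul ν) (v ^ 2) x) :
    ∀ᵐ r, deriv (fun r => charY ν (f r)) r ≠ 0 →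
      deriv (fun r => u (charY ν (f r))) r ^ 2
        = deriv (fun r => charY ν (f r)) r * deriv (fun r => charH ν (f r)) r := by
  have hY : Monotone fun r => charY ν (f r) := (charY_mono ν).comp hf
  have hH : Monotone fun r => charH ν (f r) := (charH_mono ν).comp hf
  filter_upwards [ae_comp_of_deriv_ne_zero hY hu, hH.ae_differentiableAt] with r hr hHr hp
  obtain ⟨v, hv, hF⟩ := hr hp
  have hYr := (differentiableAt_of_deriv_ne_zero hp).hasDerivAt
  have hU : HasDerivAt (fun r => u (charY ν (f r)))
      (v * deriv (fun r => charY ν (f r)) r) r :=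
    HasDerivAt.comp (h₂ := u) (h := fun r => charY ν (f r)) r hv hYr
  have hFY : HasDerivAt (fun r => cumul ν (charY ν (f r)))
      (v ^ 2 * deriv (fun r => charY ν (f r)) r) r :=
    HasDerivAt.comp (h₂ := cumul ν) (h := fun r => charY ν (f r)) r hF hYr
  have heq : charH ν (f r) = cumul ν (charY ν (f r)) := charH_eq_cumul ν hF.continuousAt
  have hmin : IsLocalMin (fun r => charH ν (f r) - cumul ν (charY ν (f r))) r :=
    Eventually.of_forall fun z => by
      simp only
      rw [heq, sub_self]
      exact sub_nonneg.2 (cumul_le_charH ν _)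
  have h0 := hmin.hasDerivAt_eq_zero (hHr.hasDerivAt.sub hFY)
  rw [hU.deriv]
  linear_combination -(deriv (fun r => charY ν (f r)) r) * h0

/-! ### Sup norms -/

/-- The a priori bound C keeps the essential supremum finite, so that its conversion to a real
number is not the default value 0. -/
theorem ae_abs_le_supNorm {f : ℝ → ℝ} {C : ℝ} (hC : ∀ x, |f x| ≤ C) :
    ∀ᵐ x, |f x| ≤ supNorm f := by
  have h1 : eLpNorm f ∞ volume ≠ ∞ := by
    rw [eLpNorm_exponent_top]
    exact (eLpNormEssSup_lt_top_of_ae_bound (C := C) (Eventually.of_forall hC)).ne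
  rw [eLpNorm_exponent_top] at h1
  filter_upwards [ae_le_eLpNormEssSup (f := f) (μ := volume)] with x hx
  unfold supNorm
  rw [eLpNorm_exponent_top]
  have := ENNReal.toReal_mono h1 hx
  rwa [toReal_enorm, Real.norm_eq_abs] at this

theorem abs_le_supNorm {f : ℝ → ℝ} {C : ℝ} (hf : Continuous f) (hC : ∀ x, |f x| ≤ C) (x : ℝ) :
    |f x| ≤ supNorm f := by
  have h1 : Dense {x | |f x| ≤ supNorm f} := Measure.dense_of_ae (ae_abs_le_supNorm hC)
  have h2 : IsClosed {x | |f x| ≤ supNorm f} := isClosed_le hf.abs continuous_const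
  have := h2.closure_eq ▸ h1.closure_eq
  exact (this ▸ mem_univ x : x ∈ {x | |f x| ≤ supNorm f})

theorem supNorm_nonneg (f : ℝ → ℝ) : 0 ≤ supNorm f := ENNReal.toReal_nonneg

theorem abs_sub_le_supNorm_deriv {f : ℝ → ℝ} {K : NNReal} (hf : LipschitzWith K f) (x y : ℝ) :
    |f x - f y| ≤ supNorm (deriv f) * |x - y| := by
  have hb : ∀ x, |deriv f x| ≤ K := fun x => norm_deriv_le_of_lipschitz hf
  rw [← intervalIntegral_deriv_of_lipschitz hf y x]
  have := intervalIntegral.norm_integral_le_of_norm_le_const_ae (f := deriv f) (a := y) (b := x)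
    (C := supNorm (deriv f)) ((ae_abs_le_supNorm hb).mono fun x hx _ => hx)
  exact this

/-! ### The spaces of Eulerian coordinates -/

theorem cutPlus_mem (x : ℝ) : 0 ≤ cutPlus x ∧ cutPlus x ≤ 1 :=
  ⟨Real.smoothTransition.nonneg _, Real.smoothTransition.le_one _⟩

theorem contDiff_cutPlus : ContDiff ℝ 1 cutPlus :=
  Real.smoothTransition.contDiff.comp (contDiff_id.add contDiff_const)

theorem intervalIntegrable_of_locallyIntegrable {g : ℝ → ℝ} (hg : LocallyIntegrable g volume)
    (a b : ℝ) : IntervalIntegrable g volume a b :=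
  intervalIntegrable_iff.2
    ((hg.integrableOn_isCompact isCompact_uIcc).mono_set uIoc_subset_uIcc)

theorem intervalIntegrable_of_memLp_two {g : ℝ → ℝ} (hg : MemLp g 2 volume) (a b : ℝ) :
    IntervalIntegrable g volume a b := by
  exact intervalIntegrable_of_locallyIntegrable (hg.locallyIntegrable (by norm_num)) a b

/-- Compare h(x) with h(y) for y in [x, x + 1] and average over y; |g| ≤ 1 + g² replaces Hölder's
inequality. -/
theorem MemH1.bounded {h : ℝ → ℝ} (hh : MemH1 h) : ∃ C, ∀ x, |h x| ≤ C := by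
  obtain ⟨h2, g, hg, hgi⟩ := hh
  have hi := intervalIntegrable_of_memLp_two h2
  have hgI := intervalIntegrable_of_memLp_two hg
  have hsq : ∀ {g : ℝ → ℝ}, MemLp g 2 volume → Integrable fun x => g x ^ 2 :=
    fun hg => hg.integrable_sq
  have key : ∀ {g : ℝ → ℝ}, MemLp g 2 volume → ∀ {a b : ℝ}, a ≤ b → b ≤ a + 1 →
      ∫ x in a..b, |g x| ≤ 1 + ∫ x, g x ^ 2 := by
    intro g hg a b hab hb
    have hgI := intervalIntegrable_of_memLp_two hg a b
    calc ∫ x in a..b, |g x| ≤ ∫ x in a..b, (1 + g x ^ 2) := by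
          refine intervalIntegral.integral_mono_on hab hgI.abs
            (intervalIntegrable_const.add (hsq hg).intervalIntegrable) fun x _ => ?_
          rw [← sq_abs]; nlinarith [sq_nonneg (|g x| - 1)]
      _ = (b - a) + ∫ x in a..b, g x ^ 2 := by
          rw [intervalIntegral.integral_add intervalIntegrable_const
            (hsq hg).intervalIntegrable]
          simp
      _ ≤ 1 + ∫ x, g x ^ 2 := by
          refine add_le_add (by linarith) ?_
          rw [intervalIntegral.integral_of_le hab]
          exact setIntegral_le_integral (hsq hg) (Eventually.of_forall fun x => sq_nonneg _)
  refine ⟨(1 + ∫ x, h x ^ 2) + (1 + ∫ x, g x ^ 2), fun x => ?_⟩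
  have h1 : ∀ y ∈ Icc x (x + 1), |h x| ≤ |h y| + (1 + ∫ x, g x ^ 2) := by
    intro y hy
    have h3 : |h y - h x| ≤ 1 + ∫ x, g x ^ 2 := by
      rw [hgi]
      exact (intervalIntegral.abs_integral_le_integral_abs hy.1).trans (key hg hy.1 hy.2)
    have h4 := abs_sub_abs_le_abs_sub (h x) (h y)
    rw [abs_sub_comm] at h4
    linarith
  have h2' : ∫ y in x..(x + 1), |h x| ≤ ∫ y in x..(x + 1), (|h y| + (1 + ∫ x, g x ^ 2)) :=
    intervalIntegral.integral_mono_on (by linarith) intervalIntegrable_const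
      ((hi _ _).abs.add intervalIntegrable_const) h1
  rw [intervalIntegral.integral_add (hi _ _).abs intervalIntegrable_const] at h2'
  simp only [intervalIntegral.integral_const, add_sub_cancel_left, smul_eq_mul, one_mul] at h2'
  linarith [key h2 (show x ≤ x + 1 by linarith) le_rfl]

theorem MemE2.bounded {u : ℝ → ℝ} (hu : MemE2 u) : ∃ C, ∀ x, |u x| ≤ C := by
  obtain ⟨h, a, b, hh, hu⟩ := hu
  obtain ⟨C, hC⟩ := hh.bounded
  refine ⟨C + |a| + |b|, fun x => ?_⟩
  have hc := cutPlus_mem x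
  have h1 : |a * cutPlus x| ≤ |a| := by
    rw [abs_mul, abs_of_nonneg hc.1]; exact mul_le_of_le_one_right (abs_nonneg _) hc.2
  have h2 : |b * cutMinus x| ≤ |b| := by
    unfold cutMinus
    rw [abs_mul, abs_of_nonneg (sub_nonneg.2 hc.2)]
    exact mul_le_of_le_one_right (abs_nonneg _) (by linarith)
  rw [hu]
  exact (abs_add_le _ _).trans (add_le_add ((abs_add_le _ _).trans (add_le_add (hC x) h1)) h2)

theorem MemE2.exists_primitive {u : ℝ → ℝ} (hu : MemE2 u) :
    ∃ v : ℝ → ℝ, LocallyIntegrable v volume ∧ ∀ a b, u b - u a = ∫ x in a..b, v x := by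
  obtain ⟨h, a, b, ⟨-, g, hg, hgi⟩, hu⟩ := hu
  have hcd : Continuous (deriv cutPlus) := contDiff_cutPlus.continuous_deriv le_rfl
  refine ⟨fun x => g x + (a - b) * deriv cutPlus x,
    (hg.locallyIntegrable (by norm_num)).add (hcd.const_mul _).locallyIntegrable, fun c d => ?_⟩
  rw [intervalIntegral.integral_add (intervalIntegrable_of_memLp_two hg c d)
    ((hcd.const_mul _).intervalIntegrable _ _), intervalIntegral.integral_const_mul,
    intervalIntegral.integral_deriv_eq_sub
      (fun x _ => (contDiff_cutPlus.differentiable one_ne_zero).differentiableAt)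
      (hcd.intervalIntegrable _ _), ← hgi, hu, hu]
  unfold cutMinus
  ring

theorem MemE2.continuous {u : ℝ → ℝ} (hu : MemE2 u) : Continuous u := by
  obtain ⟨v, hv, hi⟩ := hu.exists_primitive
  have h1 : u = fun x => u 0 + ∫ z in (0 : ℝ)..x, v z := by
    funext x; rw [← hi]; ring
  rw [h1]
  exact continuous_const.add (intervalIntegral.continuous_primitive
    (intervalIntegrable_of_locallyIntegrable hv) 0)

theorem MemE2.ae_hasDerivAt {u : ℝ → ℝ} (hu : MemE2 u) :
    ∀ᵐ x, HasDerivAt u (deriv u x) x := by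
  obtain ⟨v, hv, hi⟩ := hu.exists_primitive
  have h1 : u = fun x => u 0 + ∫ z in (0 : ℝ)..x, v z := by
    funext x; rw [← hi]; ring
  filter_upwards [LocallyIntegrable.ae_hasDerivAt_integral hv] with x hx
  have : HasDerivAt u (v x) x := by
    rw [h1]; exact (hx 0).const_add _
  exact this.differentiableAt.hasDerivAt

theorem MemE2.integral_deriv {u : ℝ → ℝ} (hu : MemE2 u) (a b : ℝ) :
    IntervalIntegrable (deriv u) volume a b ∧ ∫ x in a..b, deriv u x = u b - u a := by
  obtain ⟨v, hv, hi⟩ := hu.exists_primitive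
  have h1 : u = fun x => u 0 + ∫ z in (0 : ℝ)..x, v z := by
    funext x; rw [← hi]; ring
  have h2 : deriv u =ᵐ[volume] v := by
    filter_upwards [LocallyIntegrable.ae_hasDerivAt_integral hv] with x hx
    have : HasDerivAt u (v x) x := by
      rw [h1]; exact (hx 0).const_add _
    exact this.deriv
  exact ⟨(intervalIntegrable_of_locallyIntegrable hv a b).congr_ae (ae_restrict_of_ae h2.symm), by
    rw [hi]; exact intervalIntegral.integral_congr_ae (h2.mono fun x hx _ => hx)⟩

theorem cumul_sub_cumul (ν : Measure ℝ) [IsFiniteMeasure ν] {a b : ℝ} (h : a ≤ b) :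
    cumul ν b - cumul ν a = ν.real (Ico a b) := by
  unfold cumul
  rw [← Iio_sdiff_Iio, measureReal_sdiff (Iio_subset_Iio h) measurableSet_Iio]

theorem acPart_le (μ : Measure ℝ) : acPart μ ≤ μ := Measure.withDensity_rnDeriv_le μ volume

theorem MemD0.finite_mu {d : Eulerian} (hd : MemD0 d) : IsFiniteMeasure d.μ := by
  rw [hd.2]; exact hd.1.finite_nu

theorem isFiniteMeasure_acPart (μ : Measure ℝ) [IsFiniteMeasure μ] : IsFiniteMeasure (acPart μ) :=
  isFiniteMeasure_of_le μ (acPart_le μ)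

theorem cumul_acPart_sub_le (μ : Measure ℝ) [IsFiniteMeasure μ] {a b : ℝ} (h : a ≤ b) :
    cumul (acPart μ) b - cumul (acPart μ) a ≤ cumul μ b - cumul μ a := by
  have := isFiniteMeasure_acPart μ
  rw [cumul_sub_cumul _ h, cumul_sub_cumul _ h]
  exact ENNReal.toReal_mono (measure_ne_top _ _) (acPart_le μ _)

theorem MemD0.ae_hasDerivAt {d : Eulerian} (hd : MemD0 d) :
    ∀ᵐ x, ∃ v, HasDerivAt d.u v x ∧ HasDerivAt (cumul d.μ) (v ^ 2) x := by
  have := hd.finite_mu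
  have h1 : d.μ.rnDeriv volume =ᵐ[volume] fun x => ENNReal.ofReal (deriv d.u x ^ 2) := by
    have h2 := hd.1.ac_eq
    unfold acPart at h2
    exact (withDensity_eq_iff_of_sigmaFinite (Measure.measurable_rnDeriv _ _).aemeasurable
      ((measurable_deriv d.u).pow_const 2).ennreal_ofReal.aemeasurable).1 h2
  filter_upwards [h1, hd.1.memE2.ae_hasDerivAt, ae_hasDerivAt_cumul d.μ] with x h2 h3 h4
  refine ⟨_, h3, ?_⟩
  rwa [h2, ENNReal.toReal_ofReal (sq_nonneg _)] at h4

theorem MemD0.integrable_deriv_sq {d : Eulerian} (hd : MemD0 d) :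
    Integrable fun x => deriv d.u x ^ 2 := by
  have := hd.finite_mu
  have := isFiniteMeasure_acPart d.μ
  have h1 := measure_lt_top (acPart d.μ) univ
  rw [hd.1.ac_eq, withDensity_apply _ MeasurableSet.univ, setLIntegral_univ] at h1
  refine ⟨((measurable_deriv d.u).pow_const 2).aestronglyMeasurable, ?_⟩
  rwa [hasFiniteIntegral_iff_ofReal (Eventually.of_forall fun x => sq_nonneg _)]

theorem MemD0.cumul_acPart_sub {d : Eulerian} (hd : MemD0 d) {a b : ℝ} (h : a ≤ b) :
    cumul (acPart d.μ) b - cumul (acPart d.μ) a = ∫ x in a..b, deriv d.u x ^ 2 := by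
  have := hd.finite_mu
  have := isFiniteMeasure_acPart d.μ
  rw [cumul_sub_cumul _ h, hd.1.ac_eq, measureReal_def, withDensity_apply _ measurableSet_Ico,
    ← ofReal_integral_eq_lintegral_ofReal hd.integrable_deriv_sq.integrableOn
      (Eventually.of_forall fun x => sq_nonneg _), ENNReal.toReal_ofReal
      (integral_nonneg fun x => sq_nonneg _), intervalIntegral.integral_of_le h,
    integral_Ico_eq_integral_Ioc]

/-- Cauchy-Schwarz, obtained from the nonnegativity of the integral of (u_x - m)² with m the mean
slope. It makes the radicand in `qCoeff` nonnegative. -/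
theorem MemD0.sq_sub_le {d : Eulerian} (hd : MemD0 d) {a b : ℝ} (h : a < b) :
    (d.u b - d.u a) ^ 2 ≤ (b - a) * (cumul (acPart d.μ) b - cumul (acPart d.μ) a) := by
  obtain ⟨hi, hv⟩ := hd.1.memE2.integral_deriv a b
  have hsq : IntervalIntegrable (fun x => deriv d.u x ^ 2) volume a b :=
    hd.integrable_deriv_sq.intervalIntegrable
  rw [hd.cumul_acPart_sub h.le]
  set m := (d.u b - d.u a) / (b - a) with hm
  have h0 : 0 ≤ ∫ x in a..b, (deriv d.u x - m) ^ 2 :=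
    intervalIntegral.integral_nonneg h.le fun x _ => sq_nonneg _
  have h1 : ∫ x in a..b, (deriv d.u x - m) ^ 2
      = (∫ x in a..b, deriv d.u x ^ 2) - 2 * m * (d.u b - d.u a) + (b - a) * m ^ 2 := by
    have : ∀ x, (deriv d.u x - m) ^ 2 = deriv d.u x ^ 2 - 2 * m * deriv d.u x + m ^ 2 :=
      fun x => by ring
    simp_rw [this]
    rw [intervalIntegral.integral_add (hsq.sub (hi.const_mul _)) intervalIntegrable_const,
      intervalIntegral.integral_sub hsq (hi.const_mul _), intervalIntegral.integral_const_mul,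
      hv, intervalIntegral.integral_const, smul_eq_mul]
  have hba : 0 < b - a := sub_pos.2 h
  have h2 : d.u b - d.u a = m * (b - a) := by rw [hm]; field_simp
  rw [h2] at h1 ⊢
  rw [h1] at h0
  nlinarith [mul_nonneg hba.le h0]

/-! ### The projection operator -/

theorem isFiniteMeasure_cumulMeasure {F : ℝ → ℝ} (hF : Monotone F) {G : ℝ}
    (h0 : Tendsto F atBot (𝓝 0)) (h1 : Tendsto F atTop (𝓝 G)) :
    IsFiniteMeasure (cumulMeasure F) ∧ (cumulMeasure F).real univ = G := by
  have hG : 0 ≤ G := (hF.le_of_tendsto h0 0).trans (hF.ge_of_tendsto h1 0)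
  have h2 : cumulMeasure F univ = ENNReal.ofReal G := by
    unfold cumulMeasure
    rw [dif_pos hF, StieltjesFunction.measure_univ _ (l := 0) (u := G), sub_zero]
    · exact tendsto_rightLim_atBot_of_tendsto h0
    · exact tendsto_rightLim_atTop_of_tendsto h1
  refine ⟨⟨by rw [h2]; exact ENNReal.ofReal_lt_top⟩, ?_⟩
  rw [measureReal_def, h2, ENNReal.toReal_ofReal hG]

theorem cumul_cumulMeasure {F : ℝ → ℝ} (hF : Monotone F)
    (h0 : Tendsto F atBot (𝓝 0)) (hl : ∀ x, Tendsto F (𝓝[<] x) (𝓝 (F x))) :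
    cumul (cumulMeasure F) = F := by
  funext x
  unfold cumul cumulMeasure
  rw [dif_pos hF, measureReal_def, StieltjesFunction.measure_Iio _ (l := 0)]
  · have h1 : Function.leftLim hF.stieltjesFunction x = F x := by
      have : (hF.stieltjesFunction : ℝ → ℝ) = Function.rightLim F := rfl
      rw [this, leftLim_rightLim (hF.tendsto_leftLim x)]
      exact leftLim_eq_of_tendsto (hl x)
    rw [h1, sub_zero, ENNReal.toReal_ofReal (hF.le_of_tendsto h0 x)]
  · exact tendsto_rightLim_atBot_of_tendsto h0

theorem cellIndex_spec {Δx : ℝ} (hΔ : 0 < Δx) (x : ℝ) :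
    mesh Δx (2 * cellIndex Δx x) < x ∧ x ≤ mesh Δx (2 * cellIndex Δx x + 2) := by
  unfold mesh cellIndex
  have h1 := Int.ceil_lt_add_one (x / (2 * Δx))
  have h2 := Int.le_ceil (x / (2 * Δx))
  have h3 : x / (2 * Δx) * (2 * Δx) = x := by field_simp
  push_cast
  constructor <;> nlinarith

theorem cellIndex_eq {Δx : ℝ} (hΔ : 0 < Δx) {x : ℝ} {j : ℤ} (h1 : mesh Δx (2 * j) < x) (h2 : x ≤ mesh Δx (2 * j + 2)) :
    cellIndex Δx x = j := by
  unfold mesh at h1 h2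
  unfold cellIndex
  rw [sub_eq_iff_eq_add, Int.ceil_eq_iff, lt_div_iff₀ (by positivity), div_le_iff₀ (by positivity)]
  push_cast at *
  constructor <;> nlinarith

theorem mesh_add_one (Δx : ℝ) (j : ℤ) : mesh Δx (2 * j + 1) = mesh Δx (2 * j) + Δx := by
  unfold mesh; push_cast; ring

theorem mesh_add_two (Δx : ℝ) (j : ℤ) : mesh Δx (2 * j + 2) = mesh Δx (2 * j) + 2 * Δx := by
  unfold mesh; push_cast; ring

theorem mesh_mono {Δx : ℝ} (hΔ : 0 < Δx) {j k : ℤ} (h : j ≤ k) : mesh Δx j ≤ mesh Δx k := by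
  unfold mesh
  have : (j : ℝ) ≤ k := by exact_mod_cast h
  gcongr

theorem MemD0.qCoeff_sq {d : Eulerian} (hd : MemD0 d) {Δx : ℝ} (hΔ : 0 < Δx) (j : ℤ) :
    qCoeff Δx d j ^ 2 = diffQuot Δx (cumul (acPart d.μ)) j - diffQuot Δx d.u j ^ 2 := by
  unfold qCoeff
  refine Real.sq_sqrt (sub_nonneg.2 ?_)
  unfold diffQuot
  rw [div_pow, div_le_div_iff₀ (by positivity) (by positivity)]
  have h := hd.sq_sub_le (a := mesh Δx (2 * j)) (b := mesh Δx (2 * j + 2))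
    (by rw [mesh_add_two]; linarith)
  have h2 : mesh Δx (2 * j + 2) - mesh Δx (2 * j) = 2 * Δx := by rw [mesh_add_two]; ring
  rw [h2] at h
  nlinarith

/-- The projected cumulative energy on the `j`-th cell, as a monotone and continuous function on
the whole line. -/
def projCell (Δx : ℝ) (σ : ℤ → ℝ) (d : Eulerian) (j : ℤ) (x : ℝ) : ℝ :=
  cumul (acPart d.μ) (mesh Δx (2 * j))
    + (diffQuot Δx d.u j - σ j * qCoeff Δx d j) ^ 2 * min (x - mesh Δx (2 * j)) Δx
    + (diffQuot Δx d.u j + σ j * qCoeff Δx d j) ^ 2 * max (x - mesh Δx (2 * j + 1)) 0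
    + (cumul d.μ (mesh Δx (2 * j + 2)) - cumul (acPart d.μ) (mesh Δx (2 * j + 2)))

theorem projCell_mono (Δx : ℝ) (σ : ℤ → ℝ) (d : Eulerian) (j : ℤ) :
    Monotone (projCell Δx σ d j) := fun x y h => by
  unfold projCell
  gcongr

theorem continuous_projCell (Δx : ℝ) (σ : ℤ → ℝ) (d : Eulerian) (j : ℤ) :
    Continuous (projCell Δx σ d j) := by
  unfold projCell
  fun_prop

/-- (D - σq)² + (D + σq)² = 2(D² + q²) = 2 DF_ac: the two slopes are designed to carry exactly the
absolutely continuous energy of the cell. This makes the projected energy exact at even mesh points.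
-/
theorem slope_sq_add_slope_sq {d : Eulerian} (hd : MemD0 d) {Δx : ℝ} (hΔ : 0 < Δx) {σ : ℤ → ℝ}
    (hσ : ∀ j, σ j = 1 ∨ σ j = -1) (j : ℤ) :
    (diffQuot Δx d.u j - σ j * qCoeff Δx d j) ^ 2 * Δx
      + (diffQuot Δx d.u j + σ j * qCoeff Δx d j) ^ 2 * Δx
      = cumul (acPart d.μ) (mesh Δx (2 * j + 2)) - cumul (acPart d.μ) (mesh Δx (2 * j)) := by
  have h1 := hd.qCoeff_sq hΔ j
  have h2 : σ j ^ 2 = 1 := by rcases hσ j with h | h <;> rw [h] <;> norm_num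
  have h3 : diffQuot Δx (cumul (acPart d.μ)) j * (2 * Δx)
      = cumul (acPart d.μ) (mesh Δx (2 * j + 2)) - cumul (acPart d.μ) (mesh Δx (2 * j)) := by
    unfold diffQuot; field_simp
  linear_combination h3 + 2 * Δx * h1 + 2 * Δx * qCoeff Δx d j ^ 2 * h2

theorem projF_eq_projCell {d : Eulerian} (hd : MemD0 d) {Δx : ℝ} (hΔ : 0 < Δx) {σ : ℤ → ℝ}
    (hσ : ∀ j, σ j = 1 ∨ σ j = -1) {x : ℝ} {j : ℤ} (hj : cellIndex Δx x = j) :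
    projF Δx σ d x = projCell Δx σ d j x := by
  have h1 := hd.qCoeff_sq hΔ j
  have h2 : σ j ^ 2 = 1 := by rcases hσ j with h | h <;> rw [h] <;> norm_num
  have h3 : diffQuot Δx (cumul (acPart d.μ)) j * (2 * Δx)
      = cumul (acPart d.μ) (mesh Δx (2 * j + 2)) - cumul (acPart d.μ) (mesh Δx (2 * j)) := by
    unfold diffQuot; field_simp
  unfold projF projFac projFsing projCell
  simp only [hj]
  split_ifs with h
  · rw [max_eq_right (sub_nonpos.2 h), min_eq_left (by rw [mesh_add_one] at h; linarith)]
    ring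
  · rw [not_le] at h
    rw [max_eq_left (by linarith), min_eq_right (by rw [mesh_add_one] at h; linarith)]
    linear_combination -(1/2) * h3 - Δx * h1 - Δx * qCoeff Δx d j ^ 2 * h2

theorem projCell_right {d : Eulerian} (hd : MemD0 d) {Δx : ℝ} (hΔ : 0 < Δx) {σ : ℤ → ℝ}
    (hσ : ∀ j, σ j = 1 ∨ σ j = -1) (j : ℤ) :
    projCell Δx σ d j (mesh Δx (2 * j + 2)) = cumul d.μ (mesh Δx (2 * j + 2)) := by
  have h := slope_sq_add_slope_sq hd hΔ hσ j
  unfold projCell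
  rw [mesh_add_two, mesh_add_one] at *
  rw [max_eq_left (by linarith), min_eq_right (by linarith)]
  linear_combination h

theorem le_projCell_left {d : Eulerian} (hd : MemD0 d) {Δx : ℝ} (hΔ : 0 < Δx) {σ : ℤ → ℝ}
    (j : ℤ) : cumul d.μ (mesh Δx (2 * j)) ≤ projCell Δx σ d j (mesh Δx (2 * j)) := by
  have := hd.finite_mu
  have h := cumul_acPart_sub_le d.μ (a := mesh Δx (2 * j)) (b := mesh Δx (2 * j + 2))
    (by rw [mesh_add_two]; linarith)
  unfold projCell
  rw [mesh_add_one, max_eq_right (by linarith), sub_self, min_eq_left hΔ.le]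
  linarith

/-- Trapping the projected energy between the values of F at the ends of the cell yields
monotonicity across cells, the limits at infinity and the error bound. -/
theorem projF_mem {d : Eulerian} (hd : MemD0 d) {Δx : ℝ} (hΔ : 0 < Δx) {σ : ℤ → ℝ}
    (hσ : ∀ j, σ j = 1 ∨ σ j = -1) (x : ℝ) :
    cumul d.μ (mesh Δx (2 * cellIndex Δx x)) ≤ projF Δx σ d x ∧
      projF Δx σ d x ≤ cumul d.μ (mesh Δx (2 * cellIndex Δx x + 2)) := by
  obtain ⟨h1, h2⟩ := cellIndex_spec hΔ x
  rw [projF_eq_projCell hd hΔ hσ rfl]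
  refine ⟨(le_projCell_left hd hΔ _).trans (projCell_mono _ _ _ _ h1.le), ?_⟩
  rw [← projCell_right hd hΔ hσ]
  exact projCell_mono _ _ _ _ h2

theorem projF_mono {d : Eulerian} (hd : MemD0 d) {Δx : ℝ} (hΔ : 0 < Δx) {σ : ℤ → ℝ}
    (hσ : ∀ j, σ j = 1 ∨ σ j = -1) : Monotone (projF Δx σ d) := by
  have := hd.finite_mu
  intro x y hxy
  have hle : cellIndex Δx x ≤ cellIndex Δx y := by
    unfold cellIndex
    have : x / (2 * Δx) ≤ y / (2 * Δx) := by gcongr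
    linarith [Int.ceil_le_ceil this]
  rcases hle.eq_or_lt with h | h
  · rw [projF_eq_projCell hd hΔ hσ h, projF_eq_projCell hd hΔ hσ rfl]
    exact projCell_mono _ _ _ _ hxy
  · exact (projF_mem hd hΔ hσ x).2.trans
      ((cumul_mono _ (mesh_mono hΔ (by lia))).trans (projF_mem hd hΔ hσ y).1)

theorem tendsto_projF_left {d : Eulerian} (hd : MemD0 d) {Δx : ℝ} (hΔ : 0 < Δx) {σ : ℤ → ℝ}
    (hσ : ∀ j, σ j = 1 ∨ σ j = -1) (x : ℝ) :
    Tendsto (projF Δx σ d) (𝓝[<] x) (𝓝 (projF Δx σ d x)) := by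
  obtain ⟨h1, h2⟩ := cellIndex_spec hΔ x
  rw [projF_eq_projCell hd hΔ hσ rfl]
  refine (((continuous_projCell Δx σ d (cellIndex Δx x)).tendsto x).mono_left
    nhdsWithin_le_nhds).congr' ?_
  filter_upwards [Ioo_mem_nhdsLT h1] with z hz
  exact (projF_eq_projCell hd hΔ hσ (cellIndex_eq hΔ hz.1 (hz.2.le.trans h2))).symm

theorem abs_cumul_sub_projF_le {d : Eulerian} (hd : MemD0 d) {Δx : ℝ} (hΔ : 0 < Δx) {σ : ℤ → ℝ}
    (hσ : ∀ j, σ j = 1 ∨ σ j = -1) (x : ℝ) :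
    cumul d.μ (x - 2 * Δx) ≤ projF Δx σ d x ∧ projF Δx σ d x ≤ cumul d.μ (x + 2 * Δx) ∧
    |cumul d.μ x - projF Δx σ d x| ≤ cumul d.μ (x + 2 * Δx) - cumul d.μ (x - 2 * Δx) := by
  have := hd.finite_mu
  obtain ⟨h1, h2⟩ := cellIndex_spec hΔ x
  obtain ⟨h3, h4⟩ := projF_mem hd hΔ hσ x
  rw [mesh_add_two] at h2 h4
  have h5 := cumul_mono d.μ (show x - 2 * Δx ≤ mesh Δx (2 * cellIndex Δx x) by linarith)
  have h6 := cumul_mono d.μ (show mesh Δx (2 * cellIndex Δx x) + 2 * Δx ≤ x + 2 * Δx by linarith)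
  have h7 := cumul_mono d.μ h1.le
  have h8 := cumul_mono d.μ h2
  refine ⟨by linarith, by linarith, ?_⟩
  rw [abs_le]
  constructor <;> linarith

theorem tendsto_projF_atBot {d : Eulerian} (hd : MemD0 d) {Δx : ℝ} (hΔ : 0 < Δx) {σ : ℤ → ℝ}
    (hσ : ∀ j, σ j = 1 ∨ σ j = -1) : Tendsto (projF Δx σ d) atBot (𝓝 0) := by
  have := hd.finite_mu
  exact tendsto_of_tendsto_of_tendsto_of_le_of_le
    ((tendsto_cumul_atBot d.μ).comp (tendsto_atBot_add_const_right _ (-(2 * Δx)) tendsto_id))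
    ((tendsto_cumul_atBot d.μ).comp (tendsto_atBot_add_const_right _ (2 * Δx) tendsto_id))
    (fun x => (abs_cumul_sub_projF_le hd hΔ hσ x).1)
    (fun x => (abs_cumul_sub_projF_le hd hΔ hσ x).2.1)

theorem tendsto_projF_atTop {d : Eulerian} (hd : MemD0 d) {Δx : ℝ} (hΔ : 0 < Δx) {σ : ℤ → ℝ}
    (hσ : ∀ j, σ j = 1 ∨ σ j = -1) : Tendsto (projF Δx σ d) atTop (𝓝 (d.μ.real univ)) := by
  have := hd.finite_mu
  exact tendsto_of_tendsto_of_tendsto_of_le_of_le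
    ((tendsto_cumul_atTop d.μ).comp (tendsto_atTop_add_const_right _ (-(2 * Δx)) tendsto_id))
    ((tendsto_cumul_atTop d.μ).comp (tendsto_atTop_add_const_right _ (2 * Δx) tendsto_id))
    (fun x => (abs_cumul_sub_projF_le hd hΔ hσ x).1)
    (fun x => (abs_cumul_sub_projF_le hd hΔ hσ x).2.1)

theorem proj_finite {d : Eulerian} (hd : MemD0 d) {Δx : ℝ} (hΔ : 0 < Δx) {σ : ℤ → ℝ}
    (hσ : ∀ j, σ j = 1 ∨ σ j = -1) :
    IsFiniteMeasure (proj Δx σ d).ν ∧ (proj Δx σ d).ν.real univ = d.μ.real univ :=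
  isFiniteMeasure_cumulMeasure (projF_mono hd hΔ hσ) (tendsto_projF_atBot hd hΔ hσ)
    (tendsto_projF_atTop hd hΔ hσ)

theorem cumul_proj {d : Eulerian} (hd : MemD0 d) {Δx : ℝ} (hΔ : 0 < Δx) {σ : ℤ → ℝ}
    (hσ : ∀ j, σ j = 1 ∨ σ j = -1) : cumul (proj Δx σ d).ν = projF Δx σ d :=
  cumul_cumulMeasure (projF_mono hd hΔ hσ) (tendsto_projF_atBot hd hΔ hσ)
    (tendsto_projF_left hd hΔ hσ)

/-- Away from the mesh points both functions are affine, and the slope of the energy is by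
construction the square of the slope of the profile. -/
theorem ae_hasDerivAt_proj (d : Eulerian) {Δx : ℝ} (hΔ : 0 < Δx) (σ : ℤ → ℝ) :
    ∀ᵐ x, ∃ v, HasDerivAt (projU Δx σ d) v x ∧ HasDerivAt (projF Δx σ d) (v ^ 2) x := by
  have hc : (range (mesh Δx)).Countable := countable_range _
  filter_upwards [hc.ae_notMem volume] with x hx
  set j := cellIndex Δx x with hj
  obtain ⟨h1, h2⟩ := cellIndex_spec hΔ x
  rw [← hj] at h1 h2
  replace h2 : x < mesh Δx (2 * j + 2) := lt_of_le_of_ne h2 fun h => hx ⟨_, h.symm⟩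
  have hne : x ≠ mesh Δx (2 * j + 1) := fun h => hx ⟨_, h.symm⟩
  have hx1 : HasDerivAt (fun z => z - mesh Δx (2 * j)) 1 x := (hasDerivAt_id x).sub_const _
  rcases lt_or_gt_of_ne hne with h | h
  · refine ⟨diffQuot Δx d.u j - σ j * qCoeff Δx d j, ?_, ?_⟩
    · have hd1 : HasDerivAt (fun z => d.u (mesh Δx (2 * j))
          + (diffQuot Δx d.u j - σ j * qCoeff Δx d j) * (z - mesh Δx (2 * j)))
          (diffQuot Δx d.u j - σ j * qCoeff Δx d j) x := by
        have := (hx1.const_mul (diffQuot Δx d.u j - σ j * qCoeff Δx d j)).const_add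
          (d.u (mesh Δx (2 * j)))
        rwa [mul_one] at this
      refine hd1.congr_of_eventuallyEq ?_
      filter_upwards [Ioo_mem_nhds h1 h] with z hz
      have hzj : cellIndex Δx z = j := cellIndex_eq hΔ hz.1
        (hz.2.le.trans (mesh_mono hΔ (by lia)))
      simp only [projU, hzj, if_pos hz.2.le]
    · have hd1 : HasDerivAt (fun z => cumul (acPart d.μ) (mesh Δx (2 * j))
          + (diffQuot Δx d.u j - σ j * qCoeff Δx d j) ^ 2 * (z - mesh Δx (2 * j))
          + (cumul d.μ (mesh Δx (2 * j + 2)) - cumul (acPart d.μ) (mesh Δx (2 * j + 2))))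
          ((diffQuot Δx d.u j - σ j * qCoeff Δx d j) ^ 2) x := by
        have := ((hx1.const_mul ((diffQuot Δx d.u j - σ j * qCoeff Δx d j) ^ 2)).const_add
          (cumul (acPart d.μ) (mesh Δx (2 * j)))).add_const
          (cumul d.μ (mesh Δx (2 * j + 2)) - cumul (acPart d.μ) (mesh Δx (2 * j + 2)))
        rwa [mul_one] at this
      refine hd1.congr_of_eventuallyEq ?_
      filter_upwards [Ioo_mem_nhds h1 h] with z hz
      have hzj : cellIndex Δx z = j := cellIndex_eq hΔ hz.1
        (hz.2.le.trans (mesh_mono hΔ (by lia)))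
      simp only [projF, projFac, projFsing, hzj, if_pos hz.2.le]
  · have hx2 : HasDerivAt (fun z => z - mesh Δx (2 * j + 2)) 1 x := (hasDerivAt_id x).sub_const _
    have hx3 : HasDerivAt (fun z => z - mesh Δx (2 * j + 1)) 1 x := (hasDerivAt_id x).sub_const _
    refine ⟨diffQuot Δx d.u j + σ j * qCoeff Δx d j, ?_, ?_⟩
    · have hd1 : HasDerivAt (fun z => d.u (mesh Δx (2 * j + 2))
          + (diffQuot Δx d.u j + σ j * qCoeff Δx d j) * (z - mesh Δx (2 * j + 2)))
          (diffQuot Δx d.u j + σ j * qCoeff Δx d j) x := by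
        have := (hx2.const_mul (diffQuot Δx d.u j + σ j * qCoeff Δx d j)).const_add
          (d.u (mesh Δx (2 * j + 2)))
        rwa [mul_one] at this
      refine hd1.congr_of_eventuallyEq ?_
      filter_upwards [Ioo_mem_nhds h h2] with z hz
      have hzj : cellIndex Δx z = j := cellIndex_eq hΔ
        ((mesh_mono hΔ (by lia)).trans_lt hz.1) hz.2.le
      simp only [projU, hzj, if_neg (not_le.2 hz.1)]
    · have hd1 := (((hx3.const_mul ((diffQuot Δx d.u j + σ j * qCoeff Δx d j) ^ 2)).const_add
          ((cumul (acPart d.μ) (mesh Δx (2 * j + 2)) + cumul (acPart d.μ) (mesh Δx (2 * j))) / 2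
            - σ j * (2 * diffQuot Δx d.u j * qCoeff Δx d j * Δx))).add_const
          (cumul d.μ (mesh Δx (2 * j + 2)) - cumul (acPart d.μ) (mesh Δx (2 * j + 2))))
      rw [mul_one] at hd1
      refine hd1.congr_of_eventuallyEq ?_
      filter_upwards [Ioo_mem_nhds h h2] with z hz
      have hzj : cellIndex Δx z = j := cellIndex_eq hΔ
        ((mesh_mono hΔ (by lia)).trans_lt hz.1) hz.2.le
      simp only [projF, projFac, projFsing, hzj, if_neg (not_le.2 hz.1)]

theorem abs_projU_le {d : Eulerian} (hd : MemD0 d) {Δx : ℝ} (hΔ : 0 < Δx) {σ : ℤ → ℝ}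
    (hσ : ∀ j, σ j = 1 ∨ σ j = -1) {u0 : ℝ} (hu : ∀ x, |d.u x| ≤ u0) (x : ℝ) :
    |projU Δx σ d x| ≤ u0 + √(d.μ.real univ) * √Δx := by
  have := hd.finite_mu
  have := isFiniteMeasure_acPart d.μ
  set j := cellIndex Δx x with hj
  obtain ⟨h1, h2⟩ := cellIndex_spec hΔ x
  rw [← hj] at h1 h2
  have hs := slope_sq_add_slope_sq hd hΔ hσ j
  have hG : cumul (acPart d.μ) (mesh Δx (2 * j + 2)) - cumul (acPart d.μ) (mesh Δx (2 * j))
      ≤ d.μ.real univ :=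
    (cumul_acPart_sub_le d.μ (mesh_mono hΔ (by lia))).trans
      (by linarith [cumul_le_univ d.μ (mesh Δx (2 * j + 2)), cumul_nonneg d.μ (mesh Δx (2 * j))])
  -- The energy of half a cell is s²Δx and is at most the total energy, so an increment over a
  -- length of at most Δx is at most √(F_∞ Δx).
  have key : ∀ s z : ℝ, s ^ 2 * Δx ≤ d.μ.real univ → |z| ≤ Δx →
      |s * z| ≤ √(d.μ.real univ) * √Δx := by
    intro s z hs hz
    rw [← Real.sqrt_mul measureReal_nonneg]
    refine Real.abs_le_sqrt ?_
    rw [mul_pow, ← sq_abs z]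
    calc s ^ 2 * |z| ^ 2 ≤ s ^ 2 * Δx ^ 2 := by gcongr
      _ = s ^ 2 * Δx * Δx := by ring
      _ ≤ _ := by gcongr
  have hp1 : 0 ≤ (diffQuot Δx d.u j - σ j * qCoeff Δx d j) ^ 2 * Δx := by positivity
  have hp2 : 0 ≤ (diffQuot Δx d.u j + σ j * qCoeff Δx d j) ^ 2 * Δx := by positivity
  have e1 := mesh_add_one Δx j
  have e2 := mesh_add_two Δx j
  unfold projU
  simp only [← hj]
  split_ifs with h
  · refine (abs_add_le _ _).trans (add_le_add (hu _) (key _ _ (by linarith) ?_))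
    rw [abs_le]; constructor <;> linarith
  · rw [not_le] at h
    refine (abs_add_le _ _).trans (add_le_add (hu _) (key _ _ (by linarith) ?_))
    rw [abs_le]; constructor <;> linarith

/-- The integral of an increment of a cumulative function. -/
theorem lintegral_cumul_sub (ν : Measure ℝ) [IsFiniteMeasure ν] (c : ℝ) (hc : 0 ≤ c) :
    ∫⁻ x, ENNReal.ofReal (cumul ν (x + c) - cumul ν (x - c)) = ENNReal.ofReal (2 * c) * ν univ := by
  have h1 : ∀ x, ENNReal.ofReal (cumul ν (x + c) - cumul ν (x - c))
      = ∫⁻ z, (Ico (x - c) (x + c)).indicator 1 z ∂ν := by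
    intro x
    rw [cumul_sub_cumul ν (by linarith), lintegral_indicator_one measurableSet_Ico]
    simp [measureReal_def]
  -- After exchanging the integrals, each mass point z is seen by those x with z - c < x ≤ z + c, a
  -- set of length 2c.
  have h2 : ∀ x z : ℝ, (Ico (x - c) (x + c)).indicator (1 : ℝ → ℝ≥0∞) z
      = (Ioc (z - c) (z + c)).indicator 1 x := by
    intro x z
    have : z ∈ Ico (x - c) (x + c) ↔ x ∈ Ioc (z - c) (z + c) := by
      simp only [mem_Ico, mem_Ioc]
      constructor <;> intro h <;> constructor <;> linarith
    by_cases h : z ∈ Ico (x - c) (x + c)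
    · rw [indicator_of_mem h, indicator_of_mem (this.1 h)]; rfl
    · rw [indicator_of_notMem h, indicator_of_notMem (mt this.2 h)]
  simp_rw [h1]
  rw [lintegral_lintegral_swap]
  · simp_rw [h2]
    simp_rw [lintegral_indicator_one measurableSet_Ioc, Real.volume_Ioc]
    have : ∀ z : ℝ, z + c - (z - c) = 2 * c := fun z => by ring
    simp_rw [this]
    rw [lintegral_const]
  · have hm : MeasurableSet {p : ℝ × ℝ | p.1 - c ≤ p.2 ∧ p.2 < p.1 + c} :=
      MeasurableSet.inter
        (measurableSet_le (f := fun p : ℝ × ℝ => p.1 - c) (g := fun p => p.2) (by fun_prop)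
          (by fun_prop))
        (measurableSet_lt (f := fun p : ℝ × ℝ => p.2) (g := fun p => p.1 + c) (by fun_prop)
          (by fun_prop))
    have : (Function.uncurry fun x z : ℝ => (Ico (x - c) (x + c)).indicator (1 : ℝ → ℝ≥0∞) z)
        = {p : ℝ × ℝ | p.1 - c ≤ p.2 ∧ p.2 < p.1 + c}.indicator 1 := by
      funext p; rfl
    rw [this]
    exact (measurable_one.indicator hm).aemeasurable

/-! ### The additional change of variables -/

section Relabel
variable {X Z : Lagrangian}

theorem nonempty_phiMap_set (hX0 : Tendsto X.y atBot atBot) (hX : Monotone X.y)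
    (hZ : Monotone Z.y) (r : ℝ) : {ξ : ℝ | ∀ ξ' < ξ, X.y ξ' < Z.y (2 * r - ξ')}.Nonempty := by
  obtain ⟨ξ, h1, h2⟩ := ((hX0.eventually_lt_atBot (Z.y (2 * r))).and (eventually_le_atBot 0)).exists
  exact ⟨ξ, fun ξ' h => (hX h.le).trans_lt (h1.trans_le (hZ (by linarith)))⟩

theorem bddAbove_phiMap_set (hX1 : Tendsto X.y atTop atTop) (hZ : Monotone Z.y) (r : ℝ) :
    BddAbove {ξ : ℝ | ∀ ξ' < ξ, X.y ξ' < Z.y (2 * r - ξ')} := by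
  obtain ⟨c, h1, h2⟩ :=
    ((hX1.eventually_ge_atTop (Z.y (2 * r))).and (eventually_ge_atTop 0)).exists
  refine ⟨c, fun ξ hξ => ?_⟩
  by_contra hc
  have h3 := hξ c (not_le.1 hc)
  have := hZ (show 2 * r - c ≤ 2 * r by linarith)
  linarith

theorem phiMap_mono (hX : Monotone X.y) (hX0 : Tendsto X.y atBot atBot)
    (hX1 : Tendsto X.y atTop atTop) (hZ : Monotone Z.y) : Monotone (phiMap X Z) := fun r s h =>
  csSup_le_csSup (bddAbove_phiMap_set hX1 hZ s) (nonempty_phiMap_set hX0 hX hZ r)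
    fun ξ hξ ξ' h' => (hξ ξ' h').trans_le (hZ (by linarith))

/-- Monotonicity of ψ = 2r - φ amounts to φ(s) ≤ φ(r) + 2(s - r): an admissible ξ for s, shifted
down by 2(s - r), is admissible for r. -/
theorem psiMap_mono (hX : Monotone X.y) (hX0 : Tendsto X.y atBot atBot)
    (hX1 : Tendsto X.y atTop atTop) (hZ : Monotone Z.y) : Monotone (psiMap X Z) := fun r s h => by
  have h1 : phiMap X Z s ≤ phiMap X Z r + 2 * (s - r) := by
    refine csSup_le (nonempty_phiMap_set hX0 hX hZ s) fun ξ hξ => ?_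
    rw [← sub_le_iff_le_add]
    refine le_csSup (bddAbove_phiMap_set hX1 hZ r) fun ξ' h' => ?_
    have h2 := hξ (ξ' + 2 * (s - r)) (by linarith)
    have h3 := hX (show ξ' ≤ ξ' + 2 * (s - r) by linarith)
    have h4 : 2 * s - (ξ' + 2 * (s - r)) = 2 * r - ξ' := by ring
    rw [h4] at h2
    linarith
  unfold psiMap
  linarith

/-- Below φ(r) the defining strict inequality holds. Above it the reverse inequality holds at every
point, since by monotonicity a single violation would make that point admissible. Continuity gives
equality at φ(r). -/
theorem apply_phiMap_eq (hX : Monotone X.y) (hX0 : Tendsto X.y atBot atBot)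
    (hX1 : Tendsto X.y atTop atTop) (hXc : Continuous X.y) (hZ : Monotone Z.y)
    (hZc : Continuous Z.y) (r : ℝ) : X.y (phiMap X Z r) = Z.y (psiMap X Z r) := by
  have hne := nonempty_phiMap_set hX0 hX hZ r
  have hbd := bddAbove_phiMap_set hX1 hZ r
  have hc : Continuous fun ξ => Z.y (2 * r - ξ) := by fun_prop
  refine le_antisymm ?_ ?_
  · refine le_of_tendsto_of_tendsto ((hXc.tendsto (phiMap X Z r)).mono_left
      (nhdsWithin_le_nhds (s := Iio (phiMap X Z r)))) ((hc.tendsto (phiMap X Z r)).mono_left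
      (nhdsWithin_le_nhds (s := Iio (phiMap X Z r)))) ?_
    filter_upwards [self_mem_nhdsWithin] with ξ hξ
    obtain ⟨ζ, hζ, h⟩ := exists_lt_of_lt_csSup hne hξ
    exact (hζ ξ h).le
  · refine le_of_tendsto_of_tendsto ((hc.tendsto (phiMap X Z r)).mono_left
      (nhdsWithin_le_nhds (s := Ioi (phiMap X Z r)))) ((hXc.tendsto (phiMap X Z r)).mono_left
      (nhdsWithin_le_nhds (s := Ioi (phiMap X Z r)))) ?_
    filter_upwards [self_mem_nhdsWithin] with ξ hξ
    by_contra hcon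
    rw [not_le] at hcon
    refine absurd (le_csSup hbd fun ξ' h' => ?_) (not_le.2 hξ)
    exact (hX h'.le).trans_lt (hcon.trans_le (hZ (by linarith)))

end Relabel

/-! ### Relabeled initial data -/

/-- The properties of the relabeled initial data that the dynamics depends on. -/
structure IsInitialDatum (X₀ : Lagrangian) (G : ℝ) : Prop where
  y_mono : Monotone X₀.y
  V_mono : Monotone X₀.V
  V_eq_H : X₀.V = X₀.H
  tendsto_atBot : Tendsto X₀.V atBot (𝓝 0)
  tendsto_atTop : Tendsto X₀.V atTop (𝓝 G)
  U_sq : ∀ᵐ r, deriv X₀.y r ≠ 0 → deriv X₀.U r ^ 2 = deriv X₀.y r * deriv X₀.V r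

theorem mapL_V (d : Eulerian) [IsFiniteMeasure d.ν] (h : d.μ = d.ν) :
    (mapL d).V = charH d.ν := by
  funext ξ
  unfold mapL
  simp only
  rw [h]
  exact setIntegral_rnDeriv_self_charY d.ν ξ

theorem isInitialDatum_relabel (d : Eulerian) [IsFiniteMeasure d.ν] (h : d.μ = d.ν)
    (hu : ∀ᵐ x, ∃ v, HasDerivAt d.u v x ∧ HasDerivAt (cumul d.ν) (v ^ 2) x) {f : ℝ → ℝ}
    (hf : Monotone f) (h0 : Tendsto f atBot atBot) (h1 : Tendsto f atTop atTop) :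
    IsInitialDatum ((mapL d).relabel f) (d.ν.real univ) where
  y_mono := (charY_mono d.ν).comp hf
  V_mono := by
    change Monotone fun r => (mapL d).V (f r)
    rw [mapL_V d h]
    exact (charH_mono d.ν).comp hf
  V_eq_H := by
    change (fun r => (mapL d).V (f r)) = fun r => (mapL d).H (f r)
    rw [mapL_V d h]
    rfl
  tendsto_atBot := by
    change Tendsto (fun r => (mapL d).V (f r)) _ _
    rw [mapL_V d h]
    exact (tendsto_charH_atBot d.ν).comp h0
  tendsto_atTop := by
    change Tendsto (fun r => (mapL d).V (f r)) _ _
    rw [mapL_V d h]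
    exact (tendsto_charH_atTop d.ν).comp h1
  U_sq := by
    have h2 := deriv_sq_eq_of_relabel d.ν hf hu
    have h3 : ((mapL d).relabel f).V = fun r => charH d.ν (f r) := by
      change (fun r => (mapL d).V (f r)) = _
      rw [mapL_V d h]
    rw [h3]
    exact h2

/-- Both relabelings are coercive, since `φ(r) + ψ(r) = 2 r` and
`|φ(r) - ψ(r)| = |H(φ(r)) - H_Δx(ψ(r))|` is bounded. -/
theorem tendsto_phiMap_psiMap (d e : Eulerian) [IsFiniteMeasure d.ν] [IsFiniteMeasure e.ν] :
    Tendsto (phiMap (mapL d) (mapL e)) atBot atBot ∧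
    Tendsto (phiMap (mapL d) (mapL e)) atTop atTop ∧
    Tendsto (psiMap (mapL d) (mapL e)) atBot atBot ∧
    Tendsto (psiMap (mapL d) (mapL e)) atTop atTop := by
  have heq : ∀ r, charY d.ν (phiMap (mapL d) (mapL e) r) = charY e.ν (psiMap (mapL d) (mapL e) r) :=
    apply_phiMap_eq (X := mapL d) (Z := mapL e) (charY_mono d.ν) (tendsto_charY_atBot d.ν)
      (tendsto_charY_atTop d.ν) (lipschitzWith_charY d.ν).continuous (charY_mono e.ν)
      (lipschitzWith_charY e.ν).continuous
  set φ := phiMap (mapL d) (mapL e) with hφ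
  set ψ := psiMap (mapL d) (mapL e) with hψ
  have hsum : ∀ r, φ r + ψ r = 2 * r := fun r => by
    rw [hψ]; unfold psiMap; rw [← hφ]; ring
  set C := d.ν.real univ + e.ν.real univ with hC
  have hC1 : 0 ≤ d.ν.real univ := measureReal_nonneg
  have hC2 : 0 ≤ e.ν.real univ := measureReal_nonneg
  have hb : ∀ r, φ r - ψ r ≤ C ∧ ψ r - φ r ≤ C := by
    intro r
    have h1 := sub_le_charY d.ν (φ r)
    have h2 := sub_le_charY e.ν (ψ r)
    have h3 := charY_le d.ν (φ r)
    have h4 := charY_le e.ν (ψ r)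
    have h5 := heq r
    constructor <;> linarith
  refine ⟨?_, ?_, ?_, ?_⟩
  · exact tendsto_atBot_mono (fun r => show φ r ≤ r + C by linarith [hsum r, hb r])
      (tendsto_atBot_add_const_right _ _ tendsto_id)
  · exact tendsto_atTop_mono (fun r => show r + -C ≤ φ r by linarith [hsum r, hb r])
      (tendsto_atTop_add_const_right _ _ tendsto_id)
  · exact tendsto_atBot_mono (fun r => show ψ r ≤ r + C by linarith [hsum r, hb r])
      (tendsto_atBot_add_const_right _ _ tendsto_id)
  · exact tendsto_atTop_mono (fun r => show r + -C ≤ ψ r by linarith [hsum r, hb r])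
      (tendsto_atTop_add_const_right _ _ tendsto_id)

/-! ### Solutions of the Lagrangian system -/

section Solution
variable {α : ℝ → ℝ} {X₀ : Lagrangian} {X : ℝ → Lagrangian} {G : ℝ}

theorem IsLagrangianSolution.lipschitz_V (hX : IsLagrangianSolution α X₀ X) :
    ∃ K, LipschitzWith K X₀.V := by
  have := (hX.regular 0 le_rfl).2.2.1.1
  rwa [hX.initial] at this

theorem IsInitialDatum.deriv_V_nonneg (h₀ : IsInitialDatum X₀ G) (r : ℝ) : 0 ≤ deriv X₀.V r :=
  h₀.V_mono.deriv_nonneg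

theorem IsInitialDatum.deriv_y_nonneg (h₀ : IsInitialDatum X₀ G) (r : ℝ) : 0 ≤ deriv X₀.y r :=
  h₀.y_mono.deriv_nonneg

theorem IsInitialDatum.integrable_deriv_V (h₀ : IsInitialDatum X₀ G)
    (hX : IsLagrangianSolution α X₀ X) : Integrable (deriv X₀.V) := by
  obtain ⟨K, hK⟩ := hX.lipschitz_V
  exact integrable_deriv_of_monotone hK h₀.V_mono h₀.tendsto_atBot h₀.tendsto_atTop

theorem IsInitialDatum.integral_deriv_V (h₀ : IsInitialDatum X₀ G)
    (hX : IsLagrangianSolution α X₀ X) : ∫ r, deriv X₀.V r = G := by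
  obtain ⟨K, hK⟩ := hX.lipschitz_V
  rw [integral_deriv_of_monotone hK h₀.V_mono h₀.tendsto_atBot h₀.tendsto_atTop, sub_zero]

theorem IsInitialDatum.setIntegral_deriv_V (h₀ : IsInitialDatum X₀ G)
    (hX : IsLagrangianSolution α X₀ X) (r : ℝ) : ∫ z in Iic r, deriv X₀.V z = X₀.V r := by
  obtain ⟨K, hK⟩ := hX.lipschitz_V
  rw [setIntegral_Iic_deriv_of_monotone hK h₀.V_mono h₀.tendsto_atBot h₀.tendsto_atTop, sub_zero]

theorem measurable_breakTime (X₀ : Lagrangian) : Measurable (breakTime X₀) := by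
  unfold breakTime
  refine Measurable.ite ?_ measurable_const (Measurable.ite ?_ ?_ measurable_const)
  · exact (measurableSet_eq_fun (measurable_deriv _) measurable_const).inter
      (measurableSet_eq_fun (measurable_deriv _) measurable_const)
  · exact measurableSet_lt (measurable_deriv _) measurable_const
  · exact (((measurable_deriv _).const_mul 2).div (measurable_deriv _)).neg.ennreal_ofReal

theorem IsLagrangianSolution.continuous_y (hX : IsLagrangianSolution α X₀ X) {s : ℝ}
    (hs : 0 ≤ s) : Continuous (X s).y := by
  obtain ⟨K, hK⟩ := (hX.regular s hs).1.1
  have := hK.continuous.add continuous_id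
  exact this.congr fun ξ => by simp

theorem IsLagrangianSolution.measurable_y (hX : IsLagrangianSolution α X₀ X) :
    Measurable (Function.uncurry fun s r => (X (max s 0)).y r) := by
  refine measurable_uncurry_of_continuous_of_measurable (fun r => ?_)
    fun s => (hX.continuous_y (le_max_right _ _)).measurable
  have h1 : ContinuousOn (fun s => (X s).y r) (Ici 0) := fun s hs =>
    (hX.y_eq s hs r).continuousWithinAt
  exact h1.comp_continuous (continuous_id.max continuous_const) fun s => mem_Ici.2 (le_max_right _ _)

/-- Joint measurability in (t, r) is needed for Tonelli. The position at breaking is y composed with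
r ↦ (τ(r), r), and y is a Carathéodory function once negative times are clipped to 0. -/
theorem IsLagrangianSolution.measurable_energyFactor (hX : IsLagrangianSolution α X₀ X)
    (hα : Continuous α) : Measurable (Function.uncurry (energyFactor α X₀ X)) := by
  have hτ := measurable_breakTime X₀
  have h1 : Measurable fun r => (X (breakTime X₀ r).toReal).y r := by
    have := hX.measurable_y.comp (hτ.ennreal_toReal.prodMk measurable_id)
    have h2 : (fun r => (X (breakTime X₀ r).toReal).y r)
        = (Function.uncurry fun s r => (X (max s 0)).y r) ∘
          fun r => ((breakTime X₀ r).toReal, id r) := by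
      funext r
      simp [Function.uncurry]
    rwa [h2]
  unfold energyFactor Function.uncurry
  refine Measurable.ite ?_ ?_ measurable_const
  · exact MeasurableSet.inter
      (measurableSet_lt (f := fun _ : ℝ × ℝ => (0 : ℝ≥0∞)) (g := fun q => breakTime X₀ q.2)
        measurable_const (hτ.comp measurable_snd))
      (measurableSet_le (f := fun q : ℝ × ℝ => breakTime X₀ q.2) (g := fun q => ENNReal.ofReal q.1)
        (hτ.comp measurable_snd) measurable_fst.ennreal_ofReal)
  · exact measurable_const.sub (hα.measurable.comp (h1.comp measurable_snd))

theorem energyFactor_mem (hα01 : ∀ x, 0 ≤ α x ∧ α x < 1) (s r : ℝ) :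
    0 ≤ energyFactor α X₀ X s r ∧ energyFactor α X₀ X s r ≤ 1 := by
  unfold energyFactor
  split_ifs
  · exact ⟨by linarith [(hα01 ((X (breakTime X₀ r).toReal).y r)).2],
      by linarith [(hα01 ((X (breakTime X₀ r).toReal).y r)).1]⟩
  · exact ⟨zero_le_one, le_rfl⟩

/-- Energy is only lost. Integrals of the density are therefore monotone in time, which gives the
interval integrability of the acceleration. -/
theorem energyFactor_antitone (hα01 : ∀ x, 0 ≤ α x ∧ α x < 1) (r : ℝ) :
    Antitone fun s => energyFactor α X₀ X s r := fun s t hst => by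
  by_cases h : 0 < breakTime X₀ r ∧ breakTime X₀ r ≤ ENNReal.ofReal s
  · have h' : 0 < breakTime X₀ r ∧ breakTime X₀ r ≤ ENNReal.ofReal t :=
      ⟨h.1, h.2.trans (ENNReal.ofReal_le_ofReal hst)⟩
    simp only [energyFactor, if_pos h, if_pos h', le_refl]
  · have : energyFactor α X₀ X s r = 1 := by simp only [energyFactor, if_neg h]
    simp only [this]
    exact (energyFactor_mem hα01 t r).2

theorem breakTime_of_deriv_y_eq_zero {r : ℝ} (h : deriv X₀.y r = 0) :
    breakTime X₀ r = 0 ∨ breakTime X₀ r = ⊤ := by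
  unfold breakTime
  split_ifs
  · exact Or.inl rfl
  · left; simp [h]
  · exact Or.inr rfl

/-- On the flat set the breaking time is 0 or ∞, and neither triggers a loss for t ≥ τ > 0. The gap
of the densities on the flat set is thus frozen at its initial value. -/
theorem energyFactor_of_deriv_y_eq_zero {r : ℝ} (h : deriv X₀.y r = 0) (s : ℝ) :
    energyFactor α X₀ X s r = 1 := by
  unfold energyFactor
  rw [if_neg]
  rcases breakTime_of_deriv_y_eq_zero h with h | h <;> simp [h]

/-- The energy density `V_r(s)` of a solution. -/
def energyDensity (α : ℝ → ℝ) (X₀ : Lagrangian) (X : ℝ → Lagrangian) (s r : ℝ) : ℝ :=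
  energyFactor α X₀ X s r * deriv X₀.V r

theorem IsLagrangianSolution.measurable_energyDensity (hX : IsLagrangianSolution α X₀ X)
    (hα : Continuous α) : Measurable (Function.uncurry (energyDensity α X₀ X)) :=
  (hX.measurable_energyFactor hα).mul ((measurable_deriv _).comp measurable_snd)

theorem IsInitialDatum.energyDensity_mem (h₀ : IsInitialDatum X₀ G)
    (hα01 : ∀ x, 0 ≤ α x ∧ α x < 1) (s r : ℝ) :
    0 ≤ energyDensity α X₀ X s r ∧ energyDensity α X₀ X s r ≤ deriv X₀.V r :=
  ⟨mul_nonneg (energyFactor_mem hα01 s r).1 (h₀.deriv_V_nonneg r),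
    mul_le_of_le_one_left (h₀.deriv_V_nonneg r) (energyFactor_mem hα01 s r).2⟩

theorem IsInitialDatum.integrable_energyDensity (h₀ : IsInitialDatum X₀ G)
    (hX : IsLagrangianSolution α X₀ X) (hα : Continuous α) (hα01 : ∀ x, 0 ≤ α x ∧ α x < 1)
    (s : ℝ) : Integrable (energyDensity α X₀ X s) :=
  (h₀.integrable_deriv_V hX).mono'
    ((hX.measurable_energyDensity hα).of_uncurry_left).aestronglyMeasurable
    (Eventually.of_forall fun r => by
      rw [Real.norm_eq_abs, abs_of_nonneg (h₀.energyDensity_mem hα01 s r).1]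
      exact (h₀.energyDensity_mem hα01 s r).2)

theorem IsInitialDatum.ae_deriv_V_eq (h₀ : IsInitialDatum X₀ G)
    (hX : IsLagrangianSolution α X₀ X) (hα : Continuous α) (hα01 : ∀ x, 0 ≤ α x ∧ α x < 1)
    {s : ℝ} (hs : 0 ≤ s) : ∀ᵐ r, deriv (X s).V r = energyDensity α X₀ X s r := by
  have h1 : (X s).V = fun r => ∫ z in Iic r, energyDensity α X₀ X s z := funext (hX.V_eq s hs)
  rw [h1]
  filter_upwards [ae_hasDerivAt_setIntegral_Iic (h₀.integrable_energyDensity hX hα hα01 s)]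
    with r hr using hr.deriv

/-- The acceleration `U_t = V / 2 - V_∞ / 4` of a solution. -/
def acceleration (α : ℝ → ℝ) (X₀ : Lagrangian) (X : ℝ → Lagrangian) (s r : ℝ) : ℝ :=
  1 / 2 * (∫ z in Iic r, energyDensity α X₀ X s z) - 1 / 4 * ∫ z, energyDensity α X₀ X s z

/-- The expression is a quarter of the integral over `Iic r` minus a quarter of the integral over
its complement, whence the constant 1/4. -/
theorem abs_half_setIntegral_sub_le {g : ℝ → ℝ} (hg : Integrable g) (r : ℝ) :
    |1 / 2 * (∫ z in Iic r, g z) - 1 / 4 * ∫ z, g z| ≤ 1 / 4 * ∫ z, |g z| := by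
  have h1 := integral_add_compl (measurableSet_Iic (a := r)) hg
  have h2 := integral_add_compl (measurableSet_Iic (a := r)) hg.abs
  have h3 := abs_integral_le_integral_abs (f := g) (μ := volume.restrict (Iic r))
  have h4 := abs_integral_le_integral_abs (f := g) (μ := volume.restrict (Iic r)ᶜ)
  rw [← h1, ← h2]
  rw [abs_le] at *
  constructor <;> linarith

theorem IsInitialDatum.abs_acceleration_le (h₀ : IsInitialDatum X₀ G)
    (hX : IsLagrangianSolution α X₀ X) (hα : Continuous α) (hα01 : ∀ x, 0 ≤ α x ∧ α x < 1)
    (s r : ℝ) : |acceleration α X₀ X s r| ≤ 1 / 4 * G := by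
  have hi := h₀.integrable_energyDensity hX hα hα01 s
  refine (abs_half_setIntegral_sub_le hi r).trans ?_
  rw [← h₀.integral_deriv_V hX]
  gcongr
  · exact hi.abs
  · exact h₀.integrable_deriv_V hX
  · intro z
    simp only
    rw [abs_of_nonneg (h₀.energyDensity_mem hα01 s z).1]
    exact (h₀.energyDensity_mem hα01 s z).2

theorem IsInitialDatum.intervalIntegrable_acceleration (h₀ : IsInitialDatum X₀ G)
    (hX : IsLagrangianSolution α X₀ X) (hα : Continuous α) (hα01 : ∀ x, 0 ≤ α x ∧ α x < 1)
    (r a b : ℝ) : IntervalIntegrable (fun s => acceleration α X₀ X s r) volume a b := by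
  have hanti : ∀ (S : Set ℝ), Antitone fun s => ∫ z in S, energyDensity α X₀ X s z := by
    intro S s t hst
    refine integral_mono (h₀.integrable_energyDensity hX hα hα01 t).integrableOn
      (h₀.integrable_energyDensity hX hα hα01 s).integrableOn fun z => ?_
    exact mul_le_mul_of_nonneg_right (energyFactor_antitone hα01 z hst) (h₀.deriv_V_nonneg z)
  have h2 := hanti univ
  simp only [setIntegral_univ] at h2
  exact ((hanti (Iic r)).intervalIntegrable.const_mul _).sub (h2.intervalIntegrable.const_mul _)

theorem IsInitialDatum.U_eq (h₀ : IsInitialDatum X₀ G)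
    (hX : IsLagrangianSolution α X₀ X) (hα : Continuous α) (hα01 : ∀ x, 0 ≤ α x ∧ α x < 1)
    {s : ℝ} (hs : 0 ≤ s) (r : ℝ) :
    (X s).U r = X₀.U r + ∫ z in (0 : ℝ)..s, acceleration α X₀ X z r := by
  obtain ⟨Vinf, h1, h2⟩ := hX.U_eq
  rw [h2 s hs r]
  congr 1
  refine intervalIntegral.integral_congr fun z hz => ?_
  rw [uIcc_of_le hs] at hz
  have h3 : (X z).V = fun r => ∫ w in Iic r, energyDensity α X₀ X z w := funext (hX.V_eq z hz.1)
  have h4 := h1 z hz.1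
  rw [h3] at h4
  have h5 := tendsto_nhds_unique h4 ((aecover_Iic tendsto_id).integral_tendsto_of_countably_generated
    (h₀.integrable_energyDensity hX hα hα01 z))
  simp only [acceleration, h3, h5]

theorem IsInitialDatum.abs_U_le (h₀ : IsInitialDatum X₀ G)
    (hX : IsLagrangianSolution α X₀ X) (hα : Continuous α) (hα01 : ∀ x, 0 ≤ α x ∧ α x < 1)
    {s : ℝ} (hs : 0 ≤ s) (r : ℝ) : |(X s).U r| ≤ |X₀.U r| + 1 / 4 * s * G := by
  rw [h₀.U_eq hX hα hα01 hs r]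
  refine (abs_add_le _ _).trans (add_le_add le_rfl ?_)
  have := intervalIntegral.norm_integral_le_of_norm_le_const
    (f := fun z => acceleration α X₀ X z r) (a := 0) (b := s) (C := 1 / 4 * G)
    fun z _ => h₀.abs_acceleration_le hX hα hα01 z r
  rw [sub_zero, abs_of_nonneg hs, Real.norm_eq_abs] at this
  linarith

/-- The speed of a characteristic is at most |U₀| + T G/4, because the acceleration is at most G/4.
-/
theorem IsInitialDatum.abs_y_sub_le (h₀ : IsInitialDatum X₀ G) (hG : 0 ≤ G)
    (hX : IsLagrangianSolution α X₀ X) (hα : Continuous α) (hα01 : ∀ x, 0 ≤ α x ∧ α x < 1)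
    {s t T : ℝ} (hs : s ∈ Icc 0 T) (ht : t ∈ Icc 0 T) (r : ℝ) :
    |(X t).y r - (X s).y r| ≤ (|X₀.U r| + 1 / 4 * T * G) * |t - s| := by
  refine (convex_Icc (0 : ℝ) T).norm_image_sub_le_of_norm_hasDerivWithin_le
    (f := fun s => (X s).y r) (f' := fun s => (X s).U r)
    (fun z hz => (hX.y_eq z hz.1 r).mono fun w hw => hw.1) (fun z hz => ?_) hs ht
  refine (h₀.abs_U_le hX hα hα01 hz.1 r).trans ?_
  have := hz.2
  gcongr

end Solution

/-! ### Comparison of two solutions with a common initial characteristic -/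

/-- Two solutions with initial data that have the same first component. -/
structure IsSolutionPair (α : ℝ → ℝ) (X₀ Z₀ : Lagrangian) (X Z : ℝ → Lagrangian) (G : ℝ) :
    Prop where
  lipschitz : ∃ K, LipschitzWith K α
  mem : ∀ x, 0 ≤ α x ∧ α x < 1
  left : IsInitialDatum X₀ G
  right : IsInitialDatum Z₀ G
  solution_left : IsLagrangianSolution α X₀ X
  solution_right : IsLagrangianSolution α Z₀ Z
  y_eq : X₀.y = Z₀.y

/-- The distance of the energy densities at time `s`, on the complement of the flat set. -/
def densityGap (α : ℝ → ℝ) (X₀ Z₀ : Lagrangian) (X Z : ℝ → Lagrangian) (s : ℝ) : ℝ :=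
  ∫ r in (flatSet X₀)ᶜ, |energyDensity α X₀ X s r - energyDensity α Z₀ Z s r|

/-- The time integral of `densityGap`. -/
def cumulGap (α : ℝ → ℝ) (X₀ Z₀ : Lagrangian) (X Z : ℝ → Lagrangian) (t : ℝ) : ℝ :=
  ∫ s in (0 : ℝ)..t, densityGap α X₀ Z₀ X Z s

/-- The distance of the initial energy densities, on the complement of the flat set. -/
def initialGap (X₀ Z₀ : Lagrangian) : ℝ :=
  ∫ r in (flatSet X₀)ᶜ, |deriv X₀.V r - deriv Z₀.V r|

theorem measurableSet_flatSet (X₀ : Lagrangian) : MeasurableSet (flatSet X₀) :=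
  measurableSet_eq_fun (measurable_deriv _) measurable_const

section Pair
variable {α : ℝ → ℝ} {X₀ Z₀ : Lagrangian} {X Z : ℝ → Lagrangian} {G : ℝ}

theorem densityGap_nonneg (s : ℝ) : 0 ≤ densityGap α X₀ Z₀ X Z s :=
  integral_nonneg fun _ => abs_nonneg _

theorem initialGap_nonneg : 0 ≤ initialGap X₀ Z₀ :=
  integral_nonneg fun _ => abs_nonneg _

theorem integral_add_sub_sub {μ : Measure ℝ} {f g a b : ℝ → ℝ} (hf : Integrable f μ)
    (ha : Integrable a μ) (hb : Integrable b μ) (hg : Integrable g μ) :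
    ∫ z, (f z + ((a z - b z) - g z)) ∂μ
      = ∫ z, f z ∂μ + ((∫ z, a z ∂μ - ∫ z, b z ∂μ) - ∫ z, g z ∂μ) := by
  have h1 : Integrable (fun z => a z - b z) μ := ha.sub hb
  have h2 : Integrable (fun z => (a z - b z) - g z) μ := h1.sub hg
  rw [integral_add hf h2, integral_sub h1 hg, integral_sub ha hb]

namespace IsSolutionPair

theorem symm (h : IsSolutionPair α X₀ Z₀ X Z G) : IsSolutionPair α Z₀ X₀ Z X G :=
  ⟨h.lipschitz, h.mem, h.right, h.left, h.solution_right, h.solution_left, h.y_eq.symm⟩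

theorem continuous (h : IsSolutionPair α X₀ Z₀ X Z G) : Continuous α := h.lipschitz.choose_spec.continuous

theorem nonneg (h : IsSolutionPair α X₀ Z₀ X Z G) : 0 ≤ G := by
  rw [← h.left.integral_deriv_V h.solution_left]
  exact integral_nonneg h.left.deriv_V_nonneg

theorem flatSet_eq (h : IsSolutionPair α X₀ Z₀ X Z G) : flatSet X₀ = flatSet Z₀ := by unfold flatSet; rw [h.y_eq]

theorem densityGap_symm (h : IsSolutionPair α X₀ Z₀ X Z G) : densityGap α X₀ Z₀ X Z = densityGap α Z₀ X₀ Z X := by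
  funext s
  unfold densityGap
  rw [h.flatSet_eq]
  simp_rw [abs_sub_comm]

theorem cumulGap_symm (h : IsSolutionPair α X₀ Z₀ X Z G) : cumulGap α X₀ Z₀ X Z = cumulGap α Z₀ X₀ Z X := by
  unfold cumulGap
  rw [h.densityGap_symm]

theorem initialGap_symm (h : IsSolutionPair α X₀ Z₀ X Z G) : initialGap X₀ Z₀ = initialGap Z₀ X₀ := by
  unfold initialGap
  rw [h.flatSet_eq]
  simp_rw [abs_sub_comm]

theorem integrable_sub (h : IsSolutionPair α X₀ Z₀ X Z G) (s : ℝ) :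
    Integrable fun r => energyDensity α X₀ X s r - energyDensity α Z₀ Z s r :=
  (h.left.integrable_energyDensity h.solution_left h.continuous h.mem s).sub
    (h.right.integrable_energyDensity h.solution_right h.continuous h.mem s)

theorem measurable_sub (h : IsSolutionPair α X₀ Z₀ X Z G) : Measurable (Function.uncurry fun s r =>
    energyDensity α X₀ X s r - energyDensity α Z₀ Z s r) :=
  (h.solution_left.measurable_energyDensity h.continuous).sub
    (h.solution_right.measurable_energyDensity h.continuous)

theorem densityGap_le (h : IsSolutionPair α X₀ Z₀ X Z G) (s : ℝ) : densityGap α X₀ Z₀ X Z s ≤ 2 * G := by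
  have h1 := h.left.integrable_deriv_V h.solution_left
  have h2 := h.right.integrable_deriv_V h.solution_right
  calc densityGap α X₀ Z₀ X Z s
      ≤ ∫ r, |energyDensity α X₀ X s r - energyDensity α Z₀ Z s r| :=
        setIntegral_le_integral (h.integrable_sub s).abs (Eventually.of_forall fun _ => abs_nonneg _)
    _ ≤ ∫ r, (deriv X₀.V r + deriv Z₀.V r) := by
        refine integral_mono (h.integrable_sub s).abs (h1.add h2) fun r => ?_
        have h3 := h.left.energyDensity_mem (X := X) h.mem s r
        have h4 := h.right.energyDensity_mem (X := Z) h.mem s r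
        simp only
        rw [abs_le]
        constructor <;> linarith
    _ = 2 * G := by
        rw [integral_add h1 h2, h.left.integral_deriv_V h.solution_left,
          h.right.integral_deriv_V h.solution_right]
        ring

theorem intervalIntegrable_densityGap (h : IsSolutionPair α X₀ Z₀ X Z G) (a b : ℝ) :
    IntervalIntegrable (densityGap α X₀ Z₀ X Z) volume a b := by
  have h1 : StronglyMeasurable (densityGap α X₀ Z₀ X Z) := by
    have : StronglyMeasurable (Function.uncurry fun s r =>
        |energyDensity α X₀ X s r - energyDensity α Z₀ Z s r|) :=
      (measurable_norm.comp h.measurable_sub).stronglyMeasurable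
    exact this.integral_prod_right
  refine (intervalIntegrable_const (c := 2 * G)).mono_fun h1.aestronglyMeasurable
    (Eventually.of_forall fun s => ?_)
  simp only [Real.norm_eq_abs, abs_of_nonneg (densityGap_nonneg s)]
  exact (h.densityGap_le s).trans (le_abs_self _)

theorem continuous_cumulGap (h : IsSolutionPair α X₀ Z₀ X Z G) : Continuous (cumulGap α X₀ Z₀ X Z) :=
  intervalIntegral.continuous_primitive h.intervalIntegrable_densityGap 0

/-- The gap on the flat set is the initial gap, which is rewritten as the full initial gap minus its
part off the flat set. The full one integrates over `Iic r` to the difference of the V₀ and, both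
total masses being G, to zero over the line. Two integrals off the flat set remain, each costing a
factor 1/4. -/
theorem abs_acceleration_sub_le (h : IsSolutionPair α X₀ Z₀ X Z G) (s r : ℝ) :
    |acceleration α X₀ X s r - acceleration α Z₀ Z s r|
      ≤ 1 / 4 * densityGap α X₀ Z₀ X Z s
        + (1 / 4 * initialGap X₀ Z₀ + 1 / 2 * |X₀.V r - Z₀.V r|) := by
  have hB := (measurableSet_flatSet X₀).compl
  have h1 := h.left.integrable_deriv_V h.solution_left
  have h2 := h.right.integrable_deriv_V h.solution_right
  have hw := h.integrable_sub s
  have hwB := hw.indicator hB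
  have hgB := (h1.sub h2).indicator hB
  have e1 := h.left.integrable_energyDensity h.solution_left h.continuous h.mem s
  have e2 := h.right.integrable_energyDensity h.solution_right h.continuous h.mem s
  have hdec : ∀ z, energyDensity α X₀ X s z - energyDensity α Z₀ Z s z
      = (flatSet X₀)ᶜ.indicator (fun r => energyDensity α X₀ X s r - energyDensity α Z₀ Z s r) z
        + ((deriv X₀.V z - deriv Z₀.V z)
        - (flatSet X₀)ᶜ.indicator (deriv X₀.V - deriv Z₀.V) z) := by
    intro z
    by_cases hz : z ∈ flatSet X₀
    · have hz' : z ∈ flatSet Z₀ := h.flatSet_eq ▸ hz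
      rw [indicator_of_notMem (notMem_compl_iff.2 hz), indicator_of_notMem (notMem_compl_iff.2 hz)]
      unfold energyDensity
      rw [energyFactor_of_deriv_y_eq_zero hz, energyFactor_of_deriv_y_eq_zero hz']
      ring
    · rw [indicator_of_mem (mem_compl hz), indicator_of_mem (mem_compl hz)]
      simp
  have hA : ∫ z, (energyDensity α X₀ X s z - energyDensity α Z₀ Z s z)
      = (∫ z, (flatSet X₀)ᶜ.indicator
          (fun r => energyDensity α X₀ X s r - energyDensity α Z₀ Z s r) z)
        + ((G - G) - ∫ z, (flatSet X₀)ᶜ.indicator (deriv X₀.V - deriv Z₀.V) z) := by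
    rw [integral_congr_ae (Eventually.of_forall hdec)]
    rw [integral_add_sub_sub hwB h1 h2 hgB, h.left.integral_deriv_V h.solution_left,
      h.right.integral_deriv_V h.solution_right]
  have hI : ∫ z in Iic r, (energyDensity α X₀ X s z - energyDensity α Z₀ Z s z)
      = (∫ z in Iic r, (flatSet X₀)ᶜ.indicator
          (fun r => energyDensity α X₀ X s r - energyDensity α Z₀ Z s r) z)
        + ((X₀.V r - Z₀.V r)
          - ∫ z in Iic r, (flatSet X₀)ᶜ.indicator (deriv X₀.V - deriv Z₀.V) z) := by
    rw [setIntegral_congr_fun measurableSet_Iic fun z _ => hdec z]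
    rw [integral_add_sub_sub hwB.integrableOn h1.integrableOn h2.integrableOn hgB.integrableOn,
      h.left.setIntegral_deriv_V h.solution_left,
      h.right.setIntegral_deriv_V h.solution_right]
  rw [integral_sub e1 e2] at hA
  rw [integral_sub e1.integrableOn e2.integrableOn] at hI
  have b1 := abs_half_setIntegral_sub_le hwB r
  have b2 := abs_half_setIntegral_sub_le hgB r
  have n1 : ∫ z, |(flatSet X₀)ᶜ.indicator
      (fun r => energyDensity α X₀ X s r - energyDensity α Z₀ Z s r) z|
      = densityGap α X₀ Z₀ X Z s := by
    unfold densityGap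
    rw [← integral_indicator hB]
    refine integral_congr_ae (Eventually.of_forall fun z => ?_)
    simp only [← Real.norm_eq_abs, norm_indicator_eq_indicator_norm]
  have n2 : ∫ z, |(flatSet X₀)ᶜ.indicator (deriv X₀.V - deriv Z₀.V) z|
      = initialGap X₀ Z₀ := by
    unfold initialGap
    rw [← integral_indicator hB]
    refine integral_congr_ae (Eventually.of_forall fun z => ?_)
    simp only [← Real.norm_eq_abs, norm_indicator_eq_indicator_norm]
    rfl
  rw [n1] at b1
  rw [n2] at b2
  have hfin : acceleration α X₀ X s r - acceleration α Z₀ Z s r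
      = (1 / 2 * (∫ z in Iic r, (flatSet X₀)ᶜ.indicator
          (fun r => energyDensity α X₀ X s r - energyDensity α Z₀ Z s r) z)
          - 1 / 4 * ∫ z, (flatSet X₀)ᶜ.indicator
          (fun r => energyDensity α X₀ X s r - energyDensity α Z₀ Z s r) z)
        + 1 / 2 * (X₀.V r - Z₀.V r)
        - (1 / 2 * (∫ z in Iic r, (flatSet X₀)ᶜ.indicator (deriv X₀.V - deriv Z₀.V) z)
          - 1 / 4 * ∫ z, (flatSet X₀)ᶜ.indicator (deriv X₀.V - deriv Z₀.V) z) := by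
    unfold acceleration
    linear_combination 1 / 2 * hI - 1 / 4 * hA
  rw [hfin]
  refine (abs_sub _ _).trans ((add_le_add ((abs_add_le _ _).trans (add_le_add b1 le_rfl))
    b2).trans (le_of_eq ?_))
  rw [abs_mul, abs_of_pos (by norm_num : (0 : ℝ) < 1 / 2)]
  ring

theorem abs_U_sub_le (h : IsSolutionPair α X₀ Z₀ X Z G) {s : ℝ} (hs : 0 ≤ s) (r : ℝ) :
    |(X s).U r - (Z s).U r| ≤ |X₀.U r - Z₀.U r| + 1 / 4 * cumulGap α X₀ Z₀ X Z s
      + s * (1 / 4 * initialGap X₀ Z₀ + 1 / 2 * |X₀.V r - Z₀.V r|) := by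
  set E := 1 / 4 * initialGap X₀ Z₀ + 1 / 2 * |X₀.V r - Z₀.V r| with hE
  have i1 := h.left.intervalIntegrable_acceleration h.solution_left h.continuous h.mem r 0 s
  have i2 := h.right.intervalIntegrable_acceleration h.solution_right h.continuous h.mem r 0 s
  have hN := h.intervalIntegrable_densityGap 0 s
  rw [h.left.U_eq h.solution_left h.continuous h.mem hs r,
    h.right.U_eq h.solution_right h.continuous h.mem hs r, add_sub_add_comm,
    ← intervalIntegral.integral_sub i1 i2, add_assoc]
  refine (abs_add_le _ _).trans (add_le_add le_rfl ?_)
  calc _ ≤ ∫ z in (0 : ℝ)..s, |acceleration α X₀ X z r - acceleration α Z₀ Z z r| :=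
        intervalIntegral.abs_integral_le_integral_abs hs
    _ ≤ ∫ z in (0 : ℝ)..s, (1 / 4 * densityGap α X₀ Z₀ X Z z + E) :=
        intervalIntegral.integral_mono_on hs (i1.sub i2).abs
          ((hN.const_mul _).add intervalIntegrable_const)
          fun z _ => h.abs_acceleration_sub_le z r
    _ = _ := by
        rw [intervalIntegral.integral_add (hN.const_mul _) intervalIntegrable_const,
          intervalIntegral.integral_const_mul, intervalIntegral.integral_const, smul_eq_mul,
          sub_zero]
        rfl

/-- The right-hand side is a primitive of the bound for the U difference. It can start from 0
because both data share their first component. -/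
theorem abs_y_sub_le (h : IsSolutionPair α X₀ Z₀ X Z G) {s : ℝ} (hs : 0 ≤ s) (r : ℝ) :
    |(X s).y r - (Z s).y r| ≤ s * |X₀.U r - Z₀.U r|
      + 1 / 4 * (∫ z in (0 : ℝ)..s, cumulGap α X₀ Z₀ X Z z)
      + s ^ 2 / 2 * (1 / 4 * initialGap X₀ Z₀ + 1 / 2 * |X₀.V r - Z₀.V r|) := by
  set E := 1 / 4 * initialGap X₀ Z₀ + 1 / 2 * |X₀.V r - Z₀.V r| with hE
  have hc := h.continuous_cumulGap
  have hder : ∀ x ∈ Ici (0 : ℝ), HasDerivWithinAt (fun s => (X s).y r - (Z s).y r)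
      ((X x).U r - (Z x).U r) (Ici 0) x := fun x hx =>
    (h.solution_left.y_eq x hx r).sub (h.solution_right.y_eq x hx r)
  have hbd : ∀ x : ℝ, HasDerivAt (fun s => s * |X₀.U r - Z₀.U r|
      + 1 / 4 * (∫ z in (0 : ℝ)..s, cumulGap α X₀ Z₀ X Z z) + s ^ 2 / 2 * E)
      (|X₀.U r - Z₀.U r| + 1 / 4 * cumulGap α X₀ Z₀ X Z x + x * E) x := by
    intro x
    have d1 : HasDerivAt (fun s => ∫ z in (0 : ℝ)..s, cumulGap α X₀ Z₀ X Z z)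
        (cumulGap α X₀ Z₀ X Z x) x :=
      intervalIntegral.integral_hasDerivAt_right (hc.intervalIntegrable _ _)
        hc.stronglyMeasurable.stronglyMeasurableAtFilter hc.continuousAt
    have d2 := (((hasDerivAt_id x).mul_const |X₀.U r - Z₀.U r|).add (d1.const_mul (1 / 4))).add
      ((((hasDerivAt_id x).pow 2).div_const 2).mul_const E)
    refine d2.congr_deriv ?_
    simp only [id]
    push_cast
    ring
  have hinit : ‖(X 0).y r - (Z 0).y r‖ ≤ (0 : ℝ) * |X₀.U r - Z₀.U r|
      + 1 / 4 * (∫ z in (0 : ℝ)..0, cumulGap α X₀ Z₀ X Z z) + 0 ^ 2 / 2 * E := by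
    rw [h.solution_left.initial, h.solution_right.initial, h.y_eq]
    simp
  exact image_norm_le_of_norm_deriv_right_le_deriv_boundary
    (f := fun s => (X s).y r - (Z s).y r) (a := 0) (b := s)
    (fun x hx => ((hder x hx.1).continuousWithinAt).mono fun z hz => hz.1)
    (fun x hx => (hder x hx.1).mono (Ici_subset_Ici.2 hx.1)) hinit hbd
    (fun x hx => h.abs_U_sub_le hx.1 r) (right_mem_Icc.2 hs)

end IsSolutionPair

end Pair

/-! ### Time-integrated energy gap at a fixed point -/

section Pointwise
variable {α : ℝ → ℝ} {X₀ Z₀ : Lagrangian} {X Z : ℝ → Lagrangian} {G : ℝ}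

/-- The finite value `-2 y_ξ / U_ξ` of the wave breaking function. -/
def breakPoint (X₀ : Lagrangian) (r : ℝ) : ℝ := -(2 * deriv X₀.y r / deriv X₀.U r)

theorem breakPoint_pos {r : ℝ} (hp : 0 < deriv X₀.y r) (hv : deriv X₀.U r < 0) :
    0 < breakPoint X₀ r :=
  neg_pos.2 (div_neg_of_pos_of_neg (by linarith) hv)

theorem breakPoint_mul {r : ℝ} (hv : deriv X₀.U r < 0) :
    breakPoint X₀ r * -deriv X₀.U r = 2 * deriv X₀.y r := by
  unfold breakPoint
  have := hv.ne
  field_simp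

theorem breakTime_of_deriv_U_neg {r : ℝ} (hp : 0 < deriv X₀.y r) (hv : deriv X₀.U r < 0) :
    breakTime X₀ r = ENNReal.ofReal (breakPoint X₀ r) := by
  unfold breakTime
  rw [if_neg fun h => hp.ne' h.1, if_pos hv]
  rfl

theorem breakTime_of_deriv_U_nonneg {r : ℝ} (hp : deriv X₀.y r ≠ 0) (hv : 0 ≤ deriv X₀.U r) :
    breakTime X₀ r = ⊤ := by
  unfold breakTime
  rw [if_neg fun h => hp h.1, if_neg (not_lt.2 hv)]

theorem energyFactor_of_deriv_U_nonneg {r : ℝ} (hp : deriv X₀.y r ≠ 0) (hv : 0 ≤ deriv X₀.U r)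
    (s : ℝ) : energyFactor α X₀ X s r = 1 := by
  unfold energyFactor
  rw [if_neg]
  simp [breakTime_of_deriv_U_nonneg hp hv]

theorem energyFactor_of_deriv_U_neg {r : ℝ} (hp : 0 < deriv X₀.y r) (hv : deriv X₀.U r < 0)
    (s : ℝ) : energyFactor α X₀ X s r
      = if breakPoint X₀ r ≤ s then 1 - α ((X (breakPoint X₀ r)).y r) else 1 := by
  have hpos := breakPoint_pos hp hv
  unfold energyFactor
  rw [breakTime_of_deriv_U_neg hp hv, ENNReal.toReal_ofReal hpos.le]
  by_cases h : breakPoint X₀ r ≤ s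
  · rw [if_pos h, if_pos ⟨ENNReal.ofReal_pos.2 hpos, ENNReal.ofReal_le_ofReal h⟩]
  · rw [if_neg h, if_neg]
    rintro ⟨-, h2⟩
    rw [not_le] at h
    exact absurd h2 (not_le.2 ((ENNReal.ofReal_lt_ofReal_iff hpos).2 h))

/-- For a gap that is at most c, except for an extra b between the two breaking times. Empty windows
cover the cases without a second breaking. -/
theorem setLIntegral_ofReal_le {w : ℝ → ℝ} {c b τ τ' t : ℝ} (ht : 0 ≤ t) (hc : 0 ≤ c) (hb : 0 ≤ b)
    (hw : ∀ s ∈ Ioc 0 t, w s ≤ c + (Ico τ τ').indicator (fun _ => b) s) (hτ : τ ≤ τ') :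
    ∫⁻ s in Ioc 0 t, ENNReal.ofReal (w s) ≤ ENNReal.ofReal (t * c + b * (τ' - τ)) := by
  calc ∫⁻ s in Ioc 0 t, ENNReal.ofReal (w s)
      ≤ ∫⁻ s in Ioc 0 t, (ENNReal.ofReal c + (Ico τ τ').indicator (fun _ => ENNReal.ofReal b) s) := by
        refine setLIntegral_mono' measurableSet_Ioc fun s hs => ?_
        refine (ENNReal.ofReal_le_ofReal (hw s hs)).trans ?_
        by_cases h : s ∈ Ico τ τ'
        · rw [indicator_of_mem h, indicator_of_mem h, ENNReal.ofReal_add hc hb]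
        · rw [indicator_of_notMem h, indicator_of_notMem h, add_zero, add_zero]
    _ = ENNReal.ofReal c * volume (Ioc 0 t)
        + ∫⁻ s in Ioc 0 t, (Ico τ τ').indicator (fun _ => ENNReal.ofReal b) s := by
        rw [lintegral_add_left measurable_const, setLIntegral_const]
    _ ≤ ENNReal.ofReal c * volume (Ioc 0 t) + ENNReal.ofReal b * volume (Ico τ τ') := by
        gcongr
        refine (setLIntegral_le_lintegral _ _).trans ?_
        rw [lintegral_indicator_const measurableSet_Ico]
    _ = _ := by
        rw [Real.volume_Ioc, Real.volume_Ico, sub_zero, ← ENNReal.ofReal_mul hc,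
          ← ENNReal.ofReal_mul hb, ← ENNReal.ofReal_add (mul_nonneg hc ht)
          (mul_nonneg hb (sub_nonneg.2 hτ)), mul_comm c]

/-- The points at which one of the two initial data breaks before time `T`. -/
def breakSet (X₀ Z₀ : Lagrangian) (T : ℝ) : Set ℝ :=
  {r | breakTime X₀ r ≤ ENNReal.ofReal T ∨ breakTime Z₀ r ≤ ENNReal.ofReal T}

theorem measurableSet_breakSet (X₀ Z₀ : Lagrangian) (T : ℝ) :
    MeasurableSet (breakSet X₀ Z₀ T) :=
  MeasurableSet.union (measurableSet_le (measurable_breakTime _) measurable_const)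
    (measurableSet_le (measurable_breakTime _) measurable_const)

theorem breakSet_symm (X₀ Z₀ : Lagrangian) (T : ℝ) : breakSet X₀ Z₀ T = breakSet Z₀ X₀ T := by
  ext r; exact or_comm

namespace IsSolutionPair

/-- Only one of the two solutions breaks. -/
theorem abs_energyDensity_sub_le_of_left (h : IsSolutionPair α X₀ Z₀ X Z G) {t T : ℝ}
    (htT : t ≤ T) {r M : ℝ} (hp : 0 < deriv X₀.y r)
    (hsq : deriv X₀.U r ^ 2 = deriv X₀.y r * deriv X₀.V r) (hM : |X₀.U r| ≤ M)
    (hv : deriv X₀.U r < 0) (hv' : 0 ≤ deriv Z₀.U r) {s : ℝ} (hs : s ∈ Ioc 0 t) :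
    |energyDensity α X₀ X s r - energyDensity α Z₀ Z s r|
      ≤ |deriv X₀.V r - deriv Z₀.V r| + |gFun α X₀ r - gFun α Z₀ r|
        + 2 * (supNorm (deriv α) * (M + 1 / 4 * T * G))
          * (breakSet X₀ Z₀ T).indicator (fun r => |deriv X₀.U r - deriv Z₀.U r|) r := by
  obtain ⟨K, hK⟩ := h.lipschitz
  have hG := h.nonneg
  have hA := supNorm_nonneg (deriv α)
  have hT : 0 ≤ T := hs.1.le.trans (hs.2.trans htT)
  have hM0 : 0 ≤ M := (abs_nonneg _).trans hM
  have hpz : deriv Z₀.y r ≠ 0 := by rw [← h.y_eq]; exact hp.ne'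
  have hτ := breakPoint_pos hp hv
  unfold energyDensity
  rw [energyFactor_of_deriv_U_neg hp hv, energyFactor_of_deriv_U_nonneg hpz hv', one_mul]
  have hind : 0 ≤ (breakSet X₀ Z₀ T).indicator (fun r => |deriv X₀.U r - deriv Z₀.U r|) r :=
    indicator_nonneg (fun _ _ => abs_nonneg _) _
  have hlast : 0 ≤ 2 * (supNorm (deriv α) * (M + 1 / 4 * T * G))
      * (breakSet X₀ Z₀ T).indicator (fun r => |deriv X₀.U r - deriv Z₀.U r|) r := by positivity
  split_ifs with hb
  · have hmem : r ∈ breakSet X₀ Z₀ T := Or.inl (by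
      rw [breakTime_of_deriv_U_neg hp hv]
      exact ENNReal.ofReal_le_ofReal (hb.trans (hs.2.trans htT)))
    rw [indicator_of_mem hmem] at *
    have hy : |(X (breakPoint X₀ r)).y r - X₀.y r| ≤ (M + 1 / 4 * T * G) * breakPoint X₀ r := by
      have := h.left.abs_y_sub_le hG h.solution_left h.continuous h.mem (s := 0)
        (t := breakPoint X₀ r) (T := T) ⟨le_rfl, hT⟩ ⟨hτ.le, hb.trans (hs.2.trans htT)⟩ r
      rw [h.solution_left.initial, sub_zero, abs_of_pos hτ] at this
      exact this.trans (by gcongr)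
    have hα := abs_sub_le_supNorm_deriv hK ((X (breakPoint X₀ r)).y r) (X₀.y r)
    -- Combine U_r² = y_r V_r with τ|U_r| = 2y_r and cancel y_r > 0.
    have hτa : breakPoint X₀ r * deriv X₀.V r = 2 * -deriv X₀.U r := by
      have h1 := breakPoint_mul hv
      have : deriv X₀.y r * (breakPoint X₀ r * deriv X₀.V r)
          = deriv X₀.y r * (2 * -deriv X₀.U r) := by
        linear_combination -breakPoint X₀ r * hsq - deriv X₀.U r * h1
      exact mul_left_cancel₀ hp.ne' this
    have ha := h.left.deriv_V_nonneg r
    have hg : gFun α X₀ r - gFun α Z₀ r = (1 - α (X₀.y r)) * deriv X₀.V r - deriv Z₀.V r := by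
      unfold gFun; rw [if_pos hv, if_neg (not_lt.2 hv')]
    have hkey : |(α (X₀.y r) - α ((X (breakPoint X₀ r)).y r)) * deriv X₀.V r|
        ≤ 2 * (supNorm (deriv α) * (M + 1 / 4 * T * G)) * |deriv X₀.U r - deriv Z₀.U r| := by
      rw [abs_mul, abs_of_nonneg ha, abs_sub_comm]
      calc _ ≤ supNorm (deriv α) * ((M + 1 / 4 * T * G) * breakPoint X₀ r) * deriv X₀.V r := by
            gcongr; exact hα.trans (by gcongr)
        _ = supNorm (deriv α) * (M + 1 / 4 * T * G) * (breakPoint X₀ r * deriv X₀.V r) := by ring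
        _ = supNorm (deriv α) * (M + 1 / 4 * T * G) * (2 * -deriv X₀.U r) := by rw [hτa]
        _ ≤ supNorm (deriv α) * (M + 1 / 4 * T * G) * (2 * |deriv X₀.U r - deriv Z₀.U r|) := by
            gcongr
            -- The slopes have opposite signs, so the negative one is no larger in size than their
            -- difference.
            rw [abs_sub_comm]
            exact (by linarith : -deriv X₀.U r ≤ deriv Z₀.U r - deriv X₀.U r).trans (le_abs_self _)
        _ = _ := by ring
    have heq : (1 - α ((X (breakPoint X₀ r)).y r)) * deriv X₀.V r - deriv Z₀.V r
        = (gFun α X₀ r - gFun α Z₀ r)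
          + (α (X₀.y r) - α ((X (breakPoint X₀ r)).y r)) * deriv X₀.V r := by
      rw [hg]; ring
    rw [heq]
    have := abs_add_le (gFun α X₀ r - gFun α Z₀ r)
      ((α (X₀.y r) - α ((X (breakPoint X₀ r)).y r)) * deriv X₀.V r)
    linarith [abs_nonneg (deriv X₀.V r - deriv Z₀.V r)]
  · rw [one_mul]
    linarith [abs_nonneg (gFun α X₀ r - gFun α Z₀ r)]

/-- Both solutions break, and the first one breaks first. -/
theorem lintegral_energyDensity_sub_le_of_le (h : IsSolutionPair α X₀ Z₀ X Z G) {t T : ℝ}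
    (ht : 0 ≤ t) (htT : t ≤ T) {r M : ℝ} (hp : 0 < deriv X₀.y r)
    (hsq : deriv X₀.U r ^ 2 = deriv X₀.y r * deriv X₀.V r)
    (hsq' : deriv Z₀.U r ^ 2 = deriv X₀.y r * deriv Z₀.V r) (hM : |X₀.U r| ≤ M)
    (hv : deriv X₀.U r < 0) (hv' : deriv Z₀.U r < 0) (hle : deriv X₀.U r ≤ deriv Z₀.U r) :
    ∫⁻ s in Ioc 0 t, ENNReal.ofReal |energyDensity α X₀ X s r - energyDensity α Z₀ Z s r|
      ≤ ENNReal.ofReal (T * |deriv X₀.V r - deriv Z₀.V r|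
        + 2 * (1 + T * (supNorm (deriv α) * (M + 1 / 4 * T * G)))
          * (breakSet X₀ Z₀ T).indicator (fun r => |deriv X₀.U r - deriv Z₀.U r|) r
        + T * supNorm (deriv α) * (min (deriv X₀.V r) (deriv Z₀.V r)
          * (T * |X₀.U r - Z₀.U r| + 1 / 4 * (∫ z in (0 : ℝ)..t, cumulGap α X₀ Z₀ X Z z)
            + T ^ 2 / 8 * initialGap X₀ Z₀))
        + T * supNorm (deriv α) * (deriv X₀.y r * |X₀.V r - Z₀.V r|)) := by
  obtain ⟨K, hK⟩ := h.lipschitz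
  have hG := h.nonneg
  have hA := supNorm_nonneg (deriv α)
  have hT : 0 ≤ T := ht.trans htT
  have hM0 : 0 ≤ M := (abs_nonneg _).trans hM
  have hpz : 0 < deriv Z₀.y r := by rw [← h.y_eq]; exact hp
  have hτ := breakPoint_pos hp hv
  have hτ' := breakPoint_pos hpz hv'
  have m1 := breakPoint_mul hv
  have m2 := breakPoint_mul hv'
  rw [← h.y_eq] at m2
  have hL := initialGap_nonneg (X₀ := X₀) (Z₀ := Z₀)
  have ha := h.left.deriv_V_nonneg r
  have hb := h.right.deriv_V_nonneg r
  set A := supNorm (deriv α) with hAdef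
  set p := deriv X₀.y r with hpdef
  set a := deriv X₀.V r with hadef
  set b := deriv Z₀.V r with hbdef
  set P := -deriv X₀.U r with hP
  set Q := -deriv Z₀.U r with hQ
  set τ := breakPoint X₀ r with hτdef
  set τ' := breakPoint Z₀ r with hτdef'
  have hP0 : 0 < P := by linarith
  have hQ0 : 0 < Q := by linarith
  have hPQ : Q ≤ P := by linarith
  have hUd : |deriv X₀.U r - deriv Z₀.U r| = P - Q := by
    rw [abs_sub_comm, abs_of_nonneg (by linarith)]; linarith
  have hPa : P ^ 2 = p * a := by rw [hP, neg_sq, hsq]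
  have hQb : Q ^ 2 = p * b := by rw [hQ, neg_sq, hsq']
  -- The common factor p orders the energies like the squared slopes, and the steeper solution
  -- breaks first.
  have hba : b ≤ a := by
    have : p * b ≤ p * a := by rw [← hPa, ← hQb]; gcongr
    exact le_of_mul_le_mul_left this hp
  have hττ : τ ≤ τ' := by
    have h1 : τ * P ≤ τ' * P := by
      rw [m1, ← m2]; gcongr
    exact le_of_mul_le_mul_right h1 hP0
  have hbτ' : b * τ' = 2 * Q := by
    refine mul_left_cancel₀ hp.ne' ?_
    linear_combination -τ' * hQb + Q * m2
  -- Here b τ' = 2Q and b τ = 2Q²/P, so the difference is 2Q(P - Q)/P.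
  have hbτ : b * (τ' - τ) ≤ 2 * (P - Q) := by
    have h1 : P * (b * τ) = 2 * Q * Q := by
      have : τ * P = τ' * Q := by rw [m1, m2]
      linear_combination b * this + Q * hbτ'
    have h2 : P * (b * (τ' - τ)) ≤ P * (2 * (P - Q)) := by
      have : P * (b * (τ' - τ)) = P * (2 * Q) - 2 * Q * Q := by
        linear_combination P * hbτ' - h1
      rw [this]
      nlinarith [sq_nonneg (P - Q)]
    exact le_of_mul_le_mul_left h2 hP0
  -- This identity turns the factor τ'² in front of |V₀ - V₀_Δ| into y_r, making the substitution x
  -- = y(r) available later.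
  have hbτ'2 : b * τ' ^ 2 = 4 * p := by
    linear_combination τ' * hbτ' + 2 * m2
  have hmin : min a b = b := min_eq_right hba
  have hJ : ∀ x y : ℝ, x ≤ y → 0 ≤ x → ∫ z in (0 : ℝ)..x, cumulGap α X₀ Z₀ X Z z
      ≤ ∫ z in (0 : ℝ)..y, cumulGap α X₀ Z₀ X Z z := by
    intro x y hxy hx
    refine intervalIntegral.integral_mono_interval le_rfl hx hxy ?_
      (h.continuous_cumulGap.intervalIntegrable _ _)
    refine (ae_restrict_iff' measurableSet_Ioc).2 (Eventually.of_forall fun z hz => ?_)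
    exact intervalIntegral.integral_nonneg hz.1.le fun _ _ => densityGap_nonneg _
  have hJ0 : 0 ≤ ∫ z in (0 : ℝ)..t, cumulGap α X₀ Z₀ X Z z := by
    have := hJ 0 t ht le_rfl
    rwa [intervalIntegral.integral_same] at this
  set J := ∫ z in (0 : ℝ)..t, cumulGap α X₀ Z₀ X Z z with hJdef
  set L := initialGap X₀ Z₀ with hLdef
  set D := |X₀.V r - Z₀.V r| with hD
  set W := |X₀.U r - Z₀.U r| with hW
  have hD0 : 0 ≤ D := abs_nonneg _
  have hW0 : 0 ≤ W := abs_nonneg _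
  rw [hmin]
  -- R bounds the gap caused by evaluating α at two breaking positions: the first summand is the
  -- motion of one characteristic between τ and τ', the others are the distance of the two
  -- characteristics at τ'.
  set R := A * (2 * (M + 1 / 4 * T * G) * (P - Q) + b * (T * W + 1 / 4 * J + T ^ 2 / 8 * L) + p * D)
    with hR
  have hPQ0 : 0 ≤ P - Q := by linarith
  have hR0 : 0 ≤ R := by positivity
  have hαd : τ' ≤ t → b * |α ((X τ).y r) - α ((Z τ').y r)| ≤ R := by
    intro hτt
    have hτ't : τ' ≤ T := hτt.trans htT
    have y1 : |(X τ').y r - (X τ).y r| ≤ (M + 1 / 4 * T * G) * (τ' - τ) := by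
      have := h.left.abs_y_sub_le hG h.solution_left h.continuous h.mem (s := τ) (t := τ')
        (T := T) ⟨hτ.le, hττ.trans hτ't⟩ ⟨hτ'.le, hτ't⟩ r
      rw [abs_of_nonneg (sub_nonneg.2 hττ)] at this
      refine this.trans ?_
      have : 0 ≤ τ' - τ := by linarith
      gcongr
    have y2 := h.abs_y_sub_le hτ'.le r
    have y3 := hJ τ' t hτt hτ'.le
    have y4 : |(X τ).y r - (Z τ').y r| ≤ |(X τ').y r - (X τ).y r| + |(X τ').y r - (Z τ').y r| := by
      rw [abs_sub_comm ((X τ').y r)]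
      exact abs_sub_le _ _ _
    have y5 : b * |(X τ).y r - (Z τ').y r| ≤ 2 * (M + 1 / 4 * T * G) * (P - Q)
        + b * (T * W + 1 / 4 * J + T ^ 2 / 8 * L) + p * D := by
      have e1 : b * |(X τ').y r - (X τ).y r| ≤ 2 * (M + 1 / 4 * T * G) * (P - Q) := by
        calc _ ≤ b * ((M + 1 / 4 * T * G) * (τ' - τ)) := by gcongr
          _ = (M + 1 / 4 * T * G) * (b * (τ' - τ)) := by ring
          _ ≤ (M + 1 / 4 * T * G) * (2 * (P - Q)) := by gcongr
          _ = _ := by ring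
      have e2 : b * |(X τ').y r - (Z τ').y r|
          ≤ b * (T * W + 1 / 4 * J + T ^ 2 / 8 * L) + p * D := by
        calc _ ≤ b * (τ' * W + 1 / 4 * (∫ z in (0 : ℝ)..τ', cumulGap α X₀ Z₀ X Z z)
              + τ' ^ 2 / 2 * (1 / 4 * L + 1 / 2 * D)) := by gcongr
          _ = b * (τ' * W + 1 / 4 * (∫ z in (0 : ℝ)..τ', cumulGap α X₀ Z₀ X Z z)
              + τ' ^ 2 / 8 * L) + 1 / 4 * D * (b * τ' ^ 2) := by ring
          _ = b * (τ' * W + 1 / 4 * (∫ z in (0 : ℝ)..τ', cumulGap α X₀ Z₀ X Z z)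
              + τ' ^ 2 / 8 * L) + p * D := by rw [hbτ'2]; ring
          _ ≤ _ := by gcongr
      calc _ ≤ b * (|(X τ').y r - (X τ).y r| + |(X τ').y r - (Z τ').y r|) := by gcongr
        _ ≤ _ := by rw [mul_add]; linarith
    calc _ ≤ b * (A * |(X τ).y r - (Z τ').y r|) := by
          gcongr; exact abs_sub_le_supNorm_deriv hK _ _
      _ = A * (b * |(X τ).y r - (Z τ').y r|) := by ring
      _ ≤ R := by rw [hR]; gcongr
  have hw : ∀ s, energyDensity α X₀ X s r - energyDensity α Z₀ Z s r
      = (if τ ≤ s then 1 - α ((X τ).y r) else 1) * a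
        - (if τ' ≤ s then 1 - α ((Z τ').y r) else 1) * b := fun s => by
    unfold energyDensity
    rw [energyFactor_of_deriv_U_neg hp hv, energyFactor_of_deriv_U_neg hpz hv']
  simp_rw [hw]
  have hα1 := h.mem ((X τ).y r)
  have hα2 := h.mem ((Z τ').y r)
  have hab0 : 0 ≤ |a - b| := abs_nonneg _
  rcases le_or_gt τ t with hτt | hτt
  · have hmem : r ∈ breakSet X₀ Z₀ T := Or.inl (by
      rw [breakTime_of_deriv_U_neg hp hv]
      exact ENNReal.ofReal_le_ofReal (hτt.trans htT))
    rw [indicator_of_mem hmem, hUd]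
    -- Three regimes: before τ the gap is |a - b|; between τ and τ' the energy lost by one solution
    -- alone adds at most b; after τ' the difference of the two values of α adds at most R.
    have hmain : ∀ s ∈ Ioc 0 t, |(if τ ≤ s then 1 - α ((X τ).y r) else 1) * a
        - (if τ' ≤ s then 1 - α ((Z τ').y r) else 1) * b|
        ≤ (|a - b| + R) + (Ico τ τ').indicator (fun _ => b) s := by
      intro s hs
      by_cases h1 : τ ≤ s
      · rw [if_pos h1]
        by_cases h2 : τ' ≤ s
        · rw [if_pos h2, indicator_of_notMem fun hc => absurd hc.2 (not_lt.2 h2), add_zero]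
          have e : (1 - α ((X τ).y r)) * a - (1 - α ((Z τ').y r)) * b
              = (1 - α ((X τ).y r)) * (a - b) - b * (α ((X τ).y r) - α ((Z τ').y r)) := by ring
          rw [e]
          refine (abs_sub _ _).trans (add_le_add ?_ ?_)
          · rw [abs_mul, abs_of_nonneg (by linarith)]
            exact mul_le_of_le_one_left hab0 (by linarith)
          · rw [abs_mul, abs_of_nonneg hb]
            exact hαd (h2.trans hs.2)
        · rw [if_neg h2, indicator_of_mem (show s ∈ Ico τ τ' from ⟨h1, not_le.1 h2⟩), one_mul]
          have e : (1 - α ((X τ).y r)) * a - b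
              = (1 - α ((X τ).y r)) * (a - b) - α ((X τ).y r) * b := by ring
          rw [e]
          have e1 : |(1 - α ((X τ).y r)) * (a - b)| ≤ |a - b| := by
            rw [abs_mul, abs_of_nonneg (by linarith)]
            exact mul_le_of_le_one_left hab0 (by linarith)
          have e2 : |α ((X τ).y r) * b| ≤ b := by
            rw [abs_of_nonneg (mul_nonneg hα1.1 hb)]
            exact mul_le_of_le_one_left hb hα1.2.le
          linarith [abs_sub ((1 - α ((X τ).y r)) * (a - b)) (α ((X τ).y r) * b)]
      · rw [if_neg h1, if_neg fun h2 => h1 (hττ.trans h2),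
          indicator_of_notMem fun hc => h1 hc.1, one_mul, one_mul]
        linarith
    refine (setLIntegral_ofReal_le ht (add_nonneg hab0 hR0) hb hmain hττ).trans
      (ENNReal.ofReal_le_ofReal ?_)
    calc t * (|a - b| + R) + b * (τ' - τ) ≤ T * (|a - b| + R) + 2 * (P - Q) := by gcongr
      _ = _ := by rw [hR]; ring
  · have hmain : ∀ s ∈ Ioc 0 t, |(if τ ≤ s then 1 - α ((X τ).y r) else 1) * a
        - (if τ' ≤ s then 1 - α ((Z τ').y r) else 1) * b|
        ≤ |a - b| + (Ico (0 : ℝ) 0).indicator (fun _ => (0 : ℝ)) s := by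
      intro s hs
      have h1 : ¬ τ ≤ s := fun h => absurd (h.trans hs.2) (not_le.2 hτt)
      rw [if_neg h1, if_neg fun h2 => h1 (hττ.trans h2), one_mul, one_mul]
      simp
    refine (setLIntegral_ofReal_le ht hab0 le_rfl hmain le_rfl).trans
      (ENNReal.ofReal_le_ofReal ?_)
    have hind : 0 ≤ (breakSet X₀ Z₀ T).indicator (fun r => |deriv X₀.U r - deriv Z₀.U r|) r :=
      indicator_nonneg (fun _ _ => abs_nonneg _) _
    have e1 : t * |a - b| ≤ T * |a - b| := by gcongr
    have e2 : 0 ≤ 2 * (1 + T * (A * (M + 1 / 4 * T * G)))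
      * (breakSet X₀ Z₀ T).indicator (fun r => |deriv X₀.U r - deriv Z₀.U r|) r := by positivity
    have e3 : 0 ≤ T * A * (b * (T * W + 1 / 4 * J + T ^ 2 / 8 * L)) := by positivity
    have e4 : 0 ≤ T * A * (p * D) := by positivity
    linarith

theorem lintegral_energyDensity_sub_le (h : IsSolutionPair α X₀ Z₀ X Z G) {t T : ℝ}
    (ht : 0 ≤ t) (htT : t ≤ T) {r M : ℝ} (hp : deriv X₀.y r ≠ 0)
    (hsq : deriv X₀.U r ^ 2 = deriv X₀.y r * deriv X₀.V r)
    (hsq' : deriv Z₀.U r ^ 2 = deriv X₀.y r * deriv Z₀.V r) (hM : |X₀.U r| ≤ M)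
    (hM' : |Z₀.U r| ≤ M) :
    ∫⁻ s in Ioc 0 t, ENNReal.ofReal |energyDensity α X₀ X s r - energyDensity α Z₀ Z s r|
      ≤ ENNReal.ofReal (T * |deriv X₀.V r - deriv Z₀.V r|
        + T * |gFun α X₀ r - gFun α Z₀ r|
        + 2 * (1 + T * (supNorm (deriv α) * (M + 1 / 4 * T * G)))
          * (breakSet X₀ Z₀ T).indicator (fun r => |deriv X₀.U r - deriv Z₀.U r|) r
        + T * supNorm (deriv α) * (min (deriv X₀.V r) (deriv Z₀.V r)
          * (T * |X₀.U r - Z₀.U r| + 1 / 4 * (∫ z in (0 : ℝ)..t, cumulGap α X₀ Z₀ X Z z)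
            + T ^ 2 / 8 * initialGap X₀ Z₀))
        + T * supNorm (deriv α) * (deriv X₀.y r * |X₀.V r - Z₀.V r|)) := by
  have hG := h.nonneg
  have hA := supNorm_nonneg (deriv α)
  have hT : 0 ≤ T := ht.trans htT
  have hM0 : 0 ≤ M := (abs_nonneg _).trans hM
  have hp0 : 0 < deriv X₀.y r := lt_of_le_of_ne (h.left.deriv_y_nonneg r) hp.symm
  have hpz : 0 < deriv Z₀.y r := by rw [← h.y_eq]; exact hp0
  have hL := initialGap_nonneg (X₀ := X₀) (Z₀ := Z₀)
  have hmin : 0 ≤ min (deriv X₀.V r) (deriv Z₀.V r) :=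
    le_min (h.left.deriv_V_nonneg r) (h.right.deriv_V_nonneg r)
  have hJ0 : 0 ≤ ∫ z in (0 : ℝ)..t, cumulGap α X₀ Z₀ X Z z :=
    intervalIntegral.integral_nonneg ht fun z hz =>
      intervalIntegral.integral_nonneg hz.1 fun _ _ => densityGap_nonneg _
  have hind : 0 ≤ (breakSet X₀ Z₀ T).indicator (fun r => |deriv X₀.U r - deriv Z₀.U r|) r :=
    indicator_nonneg (fun _ _ => abs_nonneg _) _
  have hindsymm : (breakSet Z₀ X₀ T).indicator (fun r => |deriv Z₀.U r - deriv X₀.U r|) r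
      = (breakSet X₀ Z₀ T).indicator (fun r => |deriv X₀.U r - deriv Z₀.U r|) r := by
    rw [breakSet_symm]; simp_rw [abs_sub_comm]
  have e4 : 0 ≤ T * supNorm (deriv α) * (min (deriv X₀.V r) (deriv Z₀.V r)
      * (T * |X₀.U r - Z₀.U r| + 1 / 4 * (∫ z in (0 : ℝ)..t, cumulGap α X₀ Z₀ X Z z)
        + T ^ 2 / 8 * initialGap X₀ Z₀)) := by positivity
  have e5 : 0 ≤ T * supNorm (deriv α) * (deriv X₀.y r * |X₀.V r - Z₀.V r|) := by positivity
  have e2 : 0 ≤ T * |gFun α X₀ r - gFun α Z₀ r| := by positivity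
  have e3 : 0 ≤ 2 * (supNorm (deriv α) * (M + 1 / 4 * T * G))
    * (breakSet X₀ Z₀ T).indicator (fun r => |deriv X₀.U r - deriv Z₀.U r|) r := by positivity
  -- When at most one solution breaks, the bound is uniform in time, so integrating costs a factor t
  -- ≤ T and the window is empty.
  have hone : ∀ c : ℝ, c ≤ |deriv X₀.V r - deriv Z₀.V r| + |gFun α X₀ r - gFun α Z₀ r|
        + 2 * (supNorm (deriv α) * (M + 1 / 4 * T * G))
          * (breakSet X₀ Z₀ T).indicator (fun r => |deriv X₀.U r - deriv Z₀.U r|) r → 0 ≤ c →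
      t * c + 0 * ((0 : ℝ) - 0) ≤ T * |deriv X₀.V r - deriv Z₀.V r|
        + T * |gFun α X₀ r - gFun α Z₀ r|
        + 2 * (1 + T * (supNorm (deriv α) * (M + 1 / 4 * T * G)))
          * (breakSet X₀ Z₀ T).indicator (fun r => |deriv X₀.U r - deriv Z₀.U r|) r
        + T * supNorm (deriv α) * (min (deriv X₀.V r) (deriv Z₀.V r)
          * (T * |X₀.U r - Z₀.U r| + 1 / 4 * (∫ z in (0 : ℝ)..t, cumulGap α X₀ Z₀ X Z z)
            + T ^ 2 / 8 * initialGap X₀ Z₀))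
        + T * supNorm (deriv α) * (deriv X₀.y r * |X₀.V r - Z₀.V r|) := by
    intro c hc hc0
    have h1 : t * c ≤ T * (|deriv X₀.V r - deriv Z₀.V r| + |gFun α X₀ r - gFun α Z₀ r|
        + 2 * (supNorm (deriv α) * (M + 1 / 4 * T * G))
          * (breakSet X₀ Z₀ T).indicator (fun r => |deriv X₀.U r - deriv Z₀.U r|) r) := by
      gcongr
    linarith
  have hind0 : ∀ s : ℝ, (Ico (0 : ℝ) 0).indicator (fun _ => (0 : ℝ)) s = 0 := fun s => by simp
  rcases lt_or_ge (deriv X₀.U r) 0 with hv | hv <;> rcases lt_or_ge (deriv Z₀.U r) 0 with hv' | hv'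
  · rcases le_total (deriv X₀.U r) (deriv Z₀.U r) with hle | hle
    · refine (h.lintegral_energyDensity_sub_le_of_le ht htT hp0 hsq hsq' hM hv hv' hle).trans
        (ENNReal.ofReal_le_ofReal ?_)
      linarith
    -- The second solution breaks first: exchange the roles, all terms of the bound being symmetric.
    · have hyr : deriv Z₀.y r = deriv X₀.y r := by rw [h.y_eq]
      have := h.symm.lintegral_energyDensity_sub_le_of_le ht htT hpz (hyr ▸ hsq') (hyr ▸ hsq) hM'
        hv' hv hle
      rw [hindsymm, ← h.cumulGap_symm, ← h.initialGap_symm, hyr, abs_sub_comm (Z₀.U r),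
        abs_sub_comm (Z₀.V r), min_comm, abs_sub_comm (deriv Z₀.V r)] at this
      simp_rw [abs_sub_comm (energyDensity α Z₀ Z _ r)] at this
      refine this.trans (ENNReal.ofReal_le_ofReal ?_)
      linarith
  · refine (setLIntegral_ofReal_le ht (by positivity) le_rfl (fun s hs => ?_) le_rfl).trans
      (ENNReal.ofReal_le_ofReal (hone _ le_rfl (by positivity)))
    rw [hind0, add_zero]
    exact h.abs_energyDensity_sub_le_of_left htT hp0 hsq hM hv hv' hs
  · refine (setLIntegral_ofReal_le ht (by positivity) le_rfl (fun s hs => ?_) le_rfl).trans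
      (ENNReal.ofReal_le_ofReal (hone _ le_rfl (by positivity)))
    rw [hind0, add_zero]
    have hyr : deriv Z₀.y r = deriv X₀.y r := by rw [h.y_eq]
    have := h.symm.abs_energyDensity_sub_le_of_left htT hpz (hyr ▸ hsq') hM' hv' hv hs
    rwa [hindsymm, abs_sub_comm, abs_sub_comm (deriv Z₀.V r), abs_sub_comm (gFun α Z₀ r)] at this
  · refine (setLIntegral_ofReal_le ht (abs_nonneg (deriv X₀.V r - deriv Z₀.V r)) le_rfl
      (fun s hs => ?_) le_rfl).trans
      (ENNReal.ofReal_le_ofReal (hone _ ?_ (by positivity)))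
    · rw [hind0, add_zero]
      unfold energyDensity
      rw [energyFactor_of_deriv_U_nonneg hp hv, energyFactor_of_deriv_U_nonneg hpz.ne' hv',
        one_mul, one_mul]
    · linarith [abs_nonneg (gFun α X₀ r - gFun α Z₀ r)]

end IsSolutionPair

end Pointwise

/-! ### Integration off the flat set and Grönwall's inequality -/

section Integrated
variable {α : ℝ → ℝ} {X₀ Z₀ : Lagrangian} {X Z : ℝ → Lagrangian} {G : ℝ}

theorem measurable_gFun (hα : Continuous α) (hy : Measurable X₀.y) : Measurable (gFun α X₀) := by
  unfold gFun
  exact Measurable.ite (measurableSet_lt (measurable_deriv _) measurable_const)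
    ((measurable_const.sub (hα.measurable.comp hy)).mul (measurable_deriv _)) (measurable_deriv _)

theorem IsInitialDatum.integrable_gFun (h₀ : IsInitialDatum X₀ G)
    (hX : IsLagrangianSolution α X₀ X) (hα : Continuous α) (hα01 : ∀ x, 0 ≤ α x ∧ α x < 1) :
    Integrable (gFun α X₀) := by
  refine (h₀.integrable_deriv_V hX).mono'
    (measurable_gFun hα h₀.y_mono.measurable).aestronglyMeasurable
    (Eventually.of_forall fun r => ?_)
  have h1 := h₀.deriv_V_nonneg r
  have h2 := hα01 (X₀.y r)
  unfold gFun
  split_ifs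
  · rw [Real.norm_eq_abs, abs_of_nonneg (mul_nonneg (by linarith) h1)]
    exact mul_le_of_le_one_left h1 (by linarith)
  · rw [Real.norm_eq_abs, abs_of_nonneg h1]

theorem eLpNorm_one_eq_lintegral_ofReal (f : ℝ → ℝ) (μ : Measure ℝ) :
    eLpNorm f 1 μ = ∫⁻ r, ENNReal.ofReal |f r| ∂μ := by
  rw [eLpNorm_one_eq_lintegral_enorm]
  exact lintegral_congr fun r => by rw [← Real.norm_eq_abs, ofReal_norm]

theorem lintegral_ofReal_abs_eq_normOn {A : Set ℝ} {f : ℝ → ℝ}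
    (hf : Integrable f (volume.restrict A)) :
    ∫⁻ r in A, ENNReal.ofReal |f r| = ENNReal.ofReal (normOn 1 A f) := by
  unfold normOn
  rw [ENNReal.ofReal_toReal (memLp_one_iff_integrable.2 hf).2.ne, eLpNorm_one_eq_lintegral_ofReal]

namespace IsSolutionPair

theorem initialGap_eq_normOn (h : IsSolutionPair α X₀ Z₀ X Z G) :
    initialGap X₀ Z₀ = normOn 1 (flatSet X₀)ᶜ fun r => deriv X₀.H r - deriv Z₀.H r := by
  rw [← h.left.V_eq_H, ← h.right.V_eq_H]
  unfold initialGap normOn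
  rw [eLpNorm_one_eq_lintegral_ofReal, integral_eq_lintegral_of_nonneg_ae
    (Eventually.of_forall fun _ => abs_nonneg _)]
  exact (measurable_norm.comp
    ((measurable_deriv X₀.V).sub (measurable_deriv Z₀.V))).aestronglyMeasurable

theorem ae_deriv_sum (h : IsSolutionPair α X₀ Z₀ X Z G)
    (hsum : ∀ r, 2 * X₀.y r + X₀.V r + Z₀.V r = 2 * r) :
    ∀ᵐ r, 2 * deriv X₀.y r + deriv X₀.V r + deriv Z₀.V r = 2 := by
  filter_upwards [h.left.y_mono.ae_differentiableAt, h.left.V_mono.ae_differentiableAt,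
    h.right.V_mono.ae_differentiableAt] with r h1 h2 h3
  have h4 : HasDerivAt (fun r => 2 * X₀.y r + X₀.V r + Z₀.V r)
      (2 * deriv X₀.y r + deriv X₀.V r + deriv Z₀.V r) r :=
    ((h1.hasDerivAt.const_mul 2).add h2.hasDerivAt).add h3.hasDerivAt
  simp_rw [hsum] at h4
  have h5 := (hasDerivAt_id r).const_mul (2 : ℝ)
  simp only [id, mul_one] at h5
  exact h4.unique h5

theorem ae_deriv_sq (h : IsSolutionPair α X₀ Z₀ X Z G) :
    ∀ᵐ r, deriv X₀.y r ≠ 0 → deriv X₀.U r ^ 2 = deriv X₀.y r * deriv X₀.V r ∧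
      deriv Z₀.U r ^ 2 = deriv X₀.y r * deriv Z₀.V r := by
  filter_upwards [h.left.U_sq, h.right.U_sq] with r h1 h2 hp
  rw [← h.y_eq] at h2
  exact ⟨h1 hp, h2 hp⟩

/-- Breaking before T means 2y_r ≤ T|U_r|, hence y_r ≤ (T²/4)V_r for the solution that breaks. With
2y_r + V_r + V_Δ,r = 2 this gives 1 ≤ (T²/4 + 1/2)(V_r + V_Δ,r), and the two densities have total
integral 2G. -/
theorem volume_breakSet_le (h : IsSolutionPair α X₀ Z₀ X Z G)
    (hsum : ∀ r, 2 * X₀.y r + X₀.V r + Z₀.V r = 2 * r) {T : ℝ} (hT : 0 ≤ T) :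
    volume (breakSet X₀ Z₀ T ∩ (flatSet X₀)ᶜ) ≤ ENNReal.ofReal (G * (1 + T ^ 2 / 2)) := by
  have hm : MeasurableSet (breakSet X₀ Z₀ T ∩ (flatSet X₀)ᶜ) :=
    (measurableSet_breakSet _ _ _).inter (measurableSet_flatSet _).compl
  have i1 := h.left.integrable_deriv_V h.solution_left
  have i2 := h.right.integrable_deriv_V h.solution_right
  have key : ∀ {W₀ : Lagrangian} {r : ℝ}, 0 < deriv W₀.y r →
      deriv W₀.U r ^ 2 = deriv W₀.y r * deriv W₀.V r → breakTime W₀ r ≤ ENNReal.ofReal T →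
      deriv W₀.y r ≤ T ^ 2 / 4 * deriv W₀.V r := by
    intro W₀ r hp hsq hb
    rcases lt_or_ge (deriv W₀.U r) 0 with hv | hv
    · rw [breakTime_of_deriv_U_neg hp hv, ENNReal.ofReal_le_ofReal_iff hT] at hb
      have h1 := breakPoint_mul hv
      have h2 : 2 * deriv W₀.y r ≤ T * -deriv W₀.U r := by
        rw [← h1]; exact mul_le_mul_of_nonneg_right hb (by linarith)
      have h3 : (2 * deriv W₀.y r) ^ 2 ≤ (T * -deriv W₀.U r) ^ 2 := by gcongr
      refine le_of_mul_le_mul_left (a := deriv W₀.y r) ?_ hp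
      nlinarith
    · rw [breakTime_of_deriv_U_nonneg hp.ne' hv] at hb
      exact absurd hb (not_le.2 ENNReal.ofReal_lt_top)
  have hae : ∀ᵐ r, r ∈ breakSet X₀ Z₀ T ∩ (flatSet X₀)ᶜ →
      (1 : ℝ≥0∞) ≤ ENNReal.ofReal ((T ^ 2 / 4 + 1 / 2) * (deriv X₀.V r + deriv Z₀.V r)) := by
    filter_upwards [h.ae_deriv_sum hsum, h.ae_deriv_sq] with r h1 h2 hr
    obtain ⟨h3, h4⟩ := h2 hr.2
    have hp : 0 < deriv X₀.y r := lt_of_le_of_ne (h.left.deriv_y_nonneg r) (Ne.symm hr.2)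
    have ha := h.left.deriv_V_nonneg r
    have hb := h.right.deriv_V_nonneg r
    have h5 : deriv X₀.y r ≤ T ^ 2 / 4 * (deriv X₀.V r + deriv Z₀.V r) := by
      rcases hr.1 with hc | hc
      · have := key hp h3 hc
        have h6 : 0 ≤ T ^ 2 / 4 * deriv Z₀.V r := by positivity
        linarith
      · have := key (h.y_eq ▸ hp) (h.y_eq ▸ h4) hc
        rw [← h.y_eq] at this
        have h6 : 0 ≤ T ^ 2 / 4 * deriv X₀.V r := by positivity
        linarith
    rw [ENNReal.one_le_ofReal]
    linarith
  calc volume (breakSet X₀ Z₀ T ∩ (flatSet X₀)ᶜ)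
      = ∫⁻ _ in breakSet X₀ Z₀ T ∩ (flatSet X₀)ᶜ, 1 := by simp
    _ ≤ ∫⁻ r in breakSet X₀ Z₀ T ∩ (flatSet X₀)ᶜ,
        ENNReal.ofReal ((T ^ 2 / 4 + 1 / 2) * (deriv X₀.V r + deriv Z₀.V r)) :=
        lintegral_mono_ae ((ae_restrict_iff' hm).2 hae)
    _ ≤ ∫⁻ r, ENNReal.ofReal ((T ^ 2 / 4 + 1 / 2) * (deriv X₀.V r + deriv Z₀.V r)) :=
        setLIntegral_le_lintegral _ _
    _ = ENNReal.ofReal (G * (1 + T ^ 2 / 2)) := by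
        have i3 : Integrable fun r => deriv X₀.V r + deriv Z₀.V r := i1.add i2
        rw [← ofReal_integral_eq_lintegral_ofReal (i3.const_mul _)
          (Eventually.of_forall fun r => mul_nonneg (by positivity)
            (add_nonneg (h.left.deriv_V_nonneg r) (h.right.deriv_V_nonneg r))),
          integral_const_mul, integral_add i1 i2, h.left.integral_deriv_V h.solution_left,
          h.right.integral_deriv_V h.solution_right]
        congr 1
        ring

/-- Finiteness ensures that `normOn` is the true norm rather than the default 0. It follows from
(U_r - U_Δ,r)² ≤ 2y_r(V_r + V_Δ,r) and y_r ≤ 1. -/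
theorem eLpNorm_deriv_U_ne_top (h : IsSolutionPair α X₀ Z₀ X Z G)
    (hsum : ∀ r, 2 * X₀.y r + X₀.V r + Z₀.V r = 2 * r) :
    eLpNorm (fun r => deriv X₀.U r - deriv Z₀.U r) 2 (volume.restrict (flatSet X₀)ᶜ) ≠ ∞ := by
  have hm : Measurable fun r => deriv X₀.U r - deriv Z₀.U r :=
    (measurable_deriv _).sub (measurable_deriv _)
  have i1 := h.left.integrable_deriv_V h.solution_left
  have i2 := h.right.integrable_deriv_V h.solution_right
  refine MemLp.eLpNorm_ne_top ?_
  rw [memLp_two_iff_integrable_sq hm.aestronglyMeasurable]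
  refine ((i1.add i2).const_mul 2).integrableOn.mono' (hm.pow_const 2).aestronglyMeasurable ?_
  refine (ae_restrict_iff' (measurableSet_flatSet X₀).compl).2 ?_
  filter_upwards [h.ae_deriv_sum hsum, h.ae_deriv_sq] with r h1 h2 hr
  obtain ⟨h3, h4⟩ := h2 hr
  have ha := h.left.deriv_V_nonneg r
  have hb := h.right.deriv_V_nonneg r
  have hp := h.left.deriv_y_nonneg r
  have hp1 : deriv X₀.y r ≤ 1 := by linarith
  rw [Real.norm_eq_abs, abs_of_nonneg (sq_nonneg _)]
  simp only [Pi.add_apply]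
  nlinarith [sq_nonneg (deriv X₀.U r + deriv Z₀.U r), mul_le_of_le_one_left ha hp1,
    mul_le_of_le_one_left hb hp1]

/-- Cauchy-Schwarz on a set of finite measure: restricting to the break set is what makes an L² norm
of the slopes sufficient. -/
theorem lintegral_breakSet_le (h : IsSolutionPair α X₀ Z₀ X Z G)
    (hsum : ∀ r, 2 * X₀.y r + X₀.V r + Z₀.V r = 2 * r) {T : ℝ} (hT : 0 ≤ T) :
    ∫⁻ r in (flatSet X₀)ᶜ, ENNReal.ofReal
        ((breakSet X₀ Z₀ T).indicator (fun r => |deriv X₀.U r - deriv Z₀.U r|) r)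
      ≤ ENNReal.ofReal (√(G * (1 + T ^ 2 / 2))
        * normOn 2 (flatSet X₀)ᶜ fun r => deriv X₀.U r - deriv Z₀.U r) := by
  have hG := h.nonneg
  have hm : Measurable fun r => deriv X₀.U r - deriv Z₀.U r :=
    (measurable_deriv _).sub (measurable_deriv _)
  have hS := measurableSet_breakSet X₀ Z₀ T
  have e1 : ∀ r, ENNReal.ofReal
      ((breakSet X₀ Z₀ T).indicator (fun r => |deriv X₀.U r - deriv Z₀.U r|) r)
      = (breakSet X₀ Z₀ T).indicator
        (fun r => ENNReal.ofReal |deriv X₀.U r - deriv Z₀.U r|) r := fun r => by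
    by_cases hr : r ∈ breakSet X₀ Z₀ T
    · rw [indicator_of_mem hr, indicator_of_mem hr]
    · rw [indicator_of_notMem hr, indicator_of_notMem hr, ENNReal.ofReal_zero]
  simp_rw [e1]
  rw [lintegral_indicator hS, Measure.restrict_restrict hS,
    ← eLpNorm_one_eq_lintegral_ofReal (fun r => deriv X₀.U r - deriv Z₀.U r)]
  have e2 := eLpNorm_le_eLpNorm_mul_rpow_measure_univ (p := 1) (q := 2)
    (μ := volume.restrict (breakSet X₀ Z₀ T ∩ (flatSet X₀)ᶜ)) (by norm_num)
    (f := fun r => deriv X₀.U r - deriv Z₀.U r) hm.aestronglyMeasurable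
  refine e2.trans ?_
  rw [Measure.restrict_apply_univ, mul_comm, ENNReal.ofReal_mul (Real.sqrt_nonneg _)]
  refine mul_le_mul' ?_ ?_
  · have e3 : (1 / (1 : ℝ≥0∞).toReal - 1 / (2 : ℝ≥0∞).toReal) = 1 / 2 := by norm_num
    rw [e3, Real.sqrt_eq_rpow, ← ENNReal.ofReal_rpow_of_nonneg (by positivity) (by norm_num)]
    exact ENNReal.rpow_le_rpow (h.volume_breakSet_le hsum hT) (by norm_num)
  · unfold normOn
    rw [ENNReal.ofReal_toReal (h.eLpNorm_deriv_U_ne_top hsum)]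
    exact eLpNorm_mono_measure _ (Measure.restrict_mono inter_subset_right le_rfl)

theorem ofReal_cumulGap (h : IsSolutionPair α X₀ Z₀ X Z G) {t : ℝ} (ht : 0 ≤ t) :
    ENNReal.ofReal (cumulGap α X₀ Z₀ X Z t)
      = ∫⁻ s in Ioc 0 t, ENNReal.ofReal (densityGap α X₀ Z₀ X Z s) := by
  unfold cumulGap
  rw [intervalIntegral.integral_of_le ht, ofReal_integral_eq_lintegral_ofReal
    (h.intervalIntegrable_densityGap 0 t).1 (Eventually.of_forall fun s => densityGap_nonneg s)]

theorem ofReal_densityGap (h : IsSolutionPair α X₀ Z₀ X Z G) (s : ℝ) :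
    ENNReal.ofReal (densityGap α X₀ Z₀ X Z s) = ∫⁻ r in (flatSet X₀)ᶜ,
      ENNReal.ofReal |energyDensity α X₀ X s r - energyDensity α Z₀ Z s r| :=
  ofReal_integral_eq_lintegral_ofReal (h.integrable_sub s).abs.integrableOn
    (Eventually.of_forall fun _ => abs_nonneg _)

theorem lintegral_eLpNorm_deriv_V (h : IsSolutionPair α X₀ Z₀ X Z G) {t : ℝ} (ht : 0 ≤ t) :
    ∫⁻ s in Icc 0 t, eLpNorm (fun r => deriv (X s).V r - deriv (Z s).V r) 1
        (volume.restrict (flatSet X₀)ᶜ)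
      = ENNReal.ofReal (cumulGap α X₀ Z₀ X Z t) := by
  rw [h.ofReal_cumulGap ht, setLIntegral_congr Ioc_ae_eq_Icc.symm]
  refine setLIntegral_congr_fun measurableSet_Ioc fun s hs => ?_
  rw [h.ofReal_densityGap, eLpNorm_one_eq_lintegral_ofReal]
  refine lintegral_congr_ae (ae_restrict_of_ae ?_)
  filter_upwards [h.left.ae_deriv_V_eq h.solution_left h.continuous h.mem hs.1.le,
    h.right.ae_deriv_V_eq h.solution_right h.continuous h.mem hs.1.le] with r h1 h2
  rw [h1, h2]

theorem cumulGap_le (h : IsSolutionPair α X₀ Z₀ X Z G)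
    (hsum : ∀ r, 2 * X₀.y r + X₀.V r + Z₀.V r = 2 * r) {t T M W E : ℝ} (ht : 0 ≤ t) (htT : t ≤ T)
    (hM0 : 0 ≤ M) (hW0 : 0 ≤ W) (hE0 : 0 ≤ E)
    (hM : ∀ᵐ r, deriv X₀.y r ≠ 0 → |X₀.U r| ≤ M ∧ |Z₀.U r| ≤ M)
    (hW : ∀ᵐ r, deriv X₀.y r ≠ 0 → |X₀.U r - Z₀.U r| ≤ W)
    (hE : ∫⁻ r in (flatSet X₀)ᶜ, ENNReal.ofReal (deriv X₀.y r * |X₀.V r - Z₀.V r|)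
      ≤ ENNReal.ofReal E) :
    cumulGap α X₀ Z₀ X Z t ≤ (T * initialGap X₀ Z₀
        + T * normOn 1 (flatSet X₀)ᶜ (fun r => gFun α X₀ r - gFun α Z₀ r)
        + 2 * (1 + T * (supNorm (deriv α) * (M + 1 / 4 * T * G)))
          * (√(G * (1 + T ^ 2 / 2))
            * normOn 2 (flatSet X₀)ᶜ fun r => deriv X₀.U r - deriv Z₀.U r)
        + T * supNorm (deriv α) * (G * (T * W + T ^ 2 / 8 * initialGap X₀ Z₀))
        + T * supNorm (deriv α) * E)
      + 1 / 4 * T * supNorm (deriv α) * G * ∫ z in (0 : ℝ)..t, cumulGap α X₀ Z₀ X Z z := by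
  have hG := h.nonneg
  have hA := supNorm_nonneg (deriv α)
  have hT : 0 ≤ T := ht.trans htT
  have hL := initialGap_nonneg (X₀ := X₀) (Z₀ := Z₀)
  have i1 := h.left.integrable_deriv_V h.solution_left
  have i2 := h.right.integrable_deriv_V h.solution_right
  have ig := (h.left.integrable_gFun h.solution_left h.continuous h.mem).sub
    (h.right.integrable_gFun h.solution_right h.continuous h.mem)
  have hB := (measurableSet_flatSet X₀).compl
  set A := supNorm (deriv α) with hAdef
  set L := initialGap X₀ Z₀ with hLdef
  have hJ0 : 0 ≤ ∫ z in (0 : ℝ)..t, cumulGap α X₀ Z₀ X Z z :=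
    intervalIntegral.integral_nonneg ht fun z hz =>
      intervalIntegral.integral_nonneg hz.1 fun _ _ => densityGap_nonneg _
  set J := ∫ z in (0 : ℝ)..t, cumulGap α X₀ Z₀ X Z z with hJdef
  set N1 := normOn 1 (flatSet X₀)ᶜ (fun r => gFun α X₀ r - gFun α Z₀ r) with hN1
  set N2 := normOn 2 (flatSet X₀)ᶜ (fun r => deriv X₀.U r - deriv Z₀.U r) with hN2
  have hN1' : 0 ≤ N1 := ENNReal.toReal_nonneg
  have hN2' : 0 ≤ N2 := ENNReal.toReal_nonneg
  set c3 := 2 * (1 + T * (A * (M + 1 / 4 * T * G))) with hc3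
  set c4 := T * W + 1 / 4 * J + T ^ 2 / 8 * L with hc4
  have hc3' : 0 ≤ c3 := by positivity
  have hc4' : 0 ≤ c4 := by positivity
  have mV : Measurable fun r => |deriv X₀.V r - deriv Z₀.V r| :=
    measurable_norm.comp ((measurable_deriv X₀.V).sub (measurable_deriv Z₀.V))
  have mg : Measurable fun r => |gFun α X₀ r - gFun α Z₀ r| :=
    measurable_norm.comp ((measurable_gFun h.continuous h.left.y_mono.measurable).sub
      (measurable_gFun h.continuous h.right.y_mono.measurable))
  have mU : Measurable fun r =>
      (breakSet X₀ Z₀ T).indicator (fun r => |deriv X₀.U r - deriv Z₀.U r|) r :=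
    (measurable_norm.comp ((measurable_deriv X₀.U).sub (measurable_deriv Z₀.U))).indicator
      (measurableSet_breakSet _ _ _)
  have mm : Measurable fun r => min (deriv X₀.V r) (deriv Z₀.V r) :=
    (measurable_deriv X₀.V).min (measurable_deriv Z₀.V)
  -- Tonelli puts the time integral inside, where the pointwise case analysis applies.
  have hswap : ENNReal.ofReal (cumulGap α X₀ Z₀ X Z t) = ∫⁻ r in (flatSet X₀)ᶜ, ∫⁻ s in Ioc 0 t,
      ENNReal.ofReal |energyDensity α X₀ X s r - energyDensity α Z₀ Z s r| := by
    rw [h.ofReal_cumulGap ht]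
    simp_rw [h.ofReal_densityGap]
    refine lintegral_lintegral_swap ?_
    exact (measurable_norm.comp h.measurable_sub).ennreal_ofReal.aemeasurable
  have hpt : ∀ᵐ r ∂(volume.restrict (flatSet X₀)ᶜ), ∫⁻ s in Ioc 0 t,
      ENNReal.ofReal |energyDensity α X₀ X s r - energyDensity α Z₀ Z s r|
      ≤ ENNReal.ofReal T * ENNReal.ofReal |deriv X₀.V r - deriv Z₀.V r|
        + (ENNReal.ofReal T * ENNReal.ofReal |gFun α X₀ r - gFun α Z₀ r|
        + (ENNReal.ofReal c3 * ENNReal.ofReal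
          ((breakSet X₀ Z₀ T).indicator (fun r => |deriv X₀.U r - deriv Z₀.U r|) r)
        + (ENNReal.ofReal (T * A * c4) * ENNReal.ofReal (min (deriv X₀.V r) (deriv Z₀.V r))
        + ENNReal.ofReal (T * A) * ENNReal.ofReal (deriv X₀.y r * |X₀.V r - Z₀.V r|)))) := by
    refine (ae_restrict_iff' hB).2 ?_
    filter_upwards [h.ae_deriv_sq, hM, hW] with r hsq hMr hWr hr
    obtain ⟨h1, h2⟩ := hsq hr
    obtain ⟨h3, h4⟩ := hMr hr
    have hmin : 0 ≤ min (deriv X₀.V r) (deriv Z₀.V r) :=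
      le_min (h.left.deriv_V_nonneg r) (h.right.deriv_V_nonneg r)
    have hind : 0 ≤ (breakSet X₀ Z₀ T).indicator (fun r => |deriv X₀.U r - deriv Z₀.U r|) r :=
      indicator_nonneg (fun _ _ => abs_nonneg _) _
    have hpy := h.left.deriv_y_nonneg r
    refine (h.lintegral_energyDensity_sub_le ht htT hr h1 h2 h3 h4).trans ?_
    rw [← ENNReal.ofReal_mul hT, ← ENNReal.ofReal_mul hT, ← ENNReal.ofReal_mul hc3',
      ← ENNReal.ofReal_mul (by positivity), ← ENNReal.ofReal_mul (by positivity),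
      ← ENNReal.ofReal_add (by positivity) (by positivity),
      ← ENNReal.ofReal_add (by positivity) (by positivity),
      ← ENNReal.ofReal_add (by positivity) (by positivity),
      ← ENNReal.ofReal_add (by positivity) (by positivity)]
    refine ENNReal.ofReal_le_ofReal ?_
    have h5 : T * A * (min (deriv X₀.V r) (deriv Z₀.V r)
        * (T * |X₀.U r - Z₀.U r| + 1 / 4 * J + T ^ 2 / 8 * L))
        ≤ T * A * c4 * min (deriv X₀.V r) (deriv Z₀.V r) := by
      rw [mul_assoc (T * A), mul_comm c4]
      have := hWr hr
      rw [hc4]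
      gcongr
    rw [← hAdef, ← hJdef, ← hLdef, ← hc3]
    linarith
  -- The minimum of the energy densities multiplies everything that is uniform in r, including the
  -- `cumulGap` integral, so the Grönwall constant carries a single factor G.
  have hminI : ∫⁻ r in (flatSet X₀)ᶜ, ENNReal.ofReal (min (deriv X₀.V r) (deriv Z₀.V r))
      ≤ ENNReal.ofReal G := by
    calc _ ≤ ∫⁻ r, ENNReal.ofReal (deriv X₀.V r) :=
          (setLIntegral_le_lintegral _ _).trans
            (lintegral_mono fun r => ENNReal.ofReal_le_ofReal (min_le_left _ _))
      _ = ENNReal.ofReal G := by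
          rw [← ofReal_integral_eq_lintegral_ofReal i1
            (Eventually.of_forall h.left.deriv_V_nonneg), h.left.integral_deriv_V h.solution_left]
  have hVI : ∫⁻ r in (flatSet X₀)ᶜ, ENNReal.ofReal |deriv X₀.V r - deriv Z₀.V r|
      = ENNReal.ofReal L := by
    rw [hLdef]
    exact (ofReal_integral_eq_lintegral_ofReal (i1.sub i2).abs.integrableOn
      (Eventually.of_forall fun _ => abs_nonneg _)).symm
  have hfinal : ENNReal.ofReal (cumulGap α X₀ Z₀ X Z t) ≤ ENNReal.ofReal (T * L + (T * N1
      + (c3 * (√(G * (1 + T ^ 2 / 2)) * N2) + (T * A * c4 * G + T * A * E)))) := by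
    rw [hswap]
    refine (lintegral_mono_ae hpt).trans ?_
    rw [lintegral_add_left (by fun_prop), lintegral_add_left (by fun_prop),
      lintegral_add_left (by fun_prop), lintegral_add_left (by fun_prop),
      lintegral_const_mul' _ _ ENNReal.ofReal_ne_top, lintegral_const_mul' _ _ ENNReal.ofReal_ne_top,
      lintegral_const_mul' _ _ ENNReal.ofReal_ne_top, lintegral_const_mul' _ _ ENNReal.ofReal_ne_top,
      lintegral_const_mul' _ _ ENNReal.ofReal_ne_top, hVI,
      lintegral_ofReal_abs_eq_normOn (f := fun r => gFun α X₀ r - gFun α Z₀ r) ig.integrableOn]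
    rw [ENNReal.ofReal_add (by positivity) (by positivity),
      ENNReal.ofReal_add (by positivity) (by positivity),
      ENNReal.ofReal_add (by positivity) (by positivity),
      ENNReal.ofReal_add (by positivity) (by positivity), ENNReal.ofReal_mul (q := L) hT,
      ENNReal.ofReal_mul (q := N1) hT, ENNReal.ofReal_mul hc3', ENNReal.ofReal_mul (p := T * A * c4)
      (by positivity), ENNReal.ofReal_mul (p := T * A) (q := E) (by positivity)]
    gcongr
    exact h.lintegral_breakSet_le hsum hT
  rw [ENNReal.ofReal_le_ofReal_iff (by positivity)] at hfinal
  refine hfinal.trans (le_of_eq ?_)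
  rw [hc4]
  ring

theorem cumulGap_le_mul_exp (h : IsSolutionPair α X₀ Z₀ X Z G)
    (hsum : ∀ r, 2 * X₀.y r + X₀.V r + Z₀.V r = 2 * r) {t T M W E : ℝ} (ht : 0 ≤ t) (htT : t ≤ T)
    (hM0 : 0 ≤ M) (hW0 : 0 ≤ W) (hE0 : 0 ≤ E)
    (hM : ∀ᵐ r, deriv X₀.y r ≠ 0 → |X₀.U r| ≤ M ∧ |Z₀.U r| ≤ M)
    (hW : ∀ᵐ r, deriv X₀.y r ≠ 0 → |X₀.U r - Z₀.U r| ≤ W)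
    (hE : ∫⁻ r in (flatSet X₀)ᶜ, ENNReal.ofReal (deriv X₀.y r * |X₀.V r - Z₀.V r|)
      ≤ ENNReal.ofReal E) :
    cumulGap α X₀ Z₀ X Z t ≤ (T * initialGap X₀ Z₀
        + T * normOn 1 (flatSet X₀)ᶜ (fun r => gFun α X₀ r - gFun α Z₀ r)
        + 2 * (1 + T * (supNorm (deriv α) * (M + 1 / 4 * T * G)))
          * (√(G * (1 + T ^ 2 / 2))
            * normOn 2 (flatSet X₀)ᶜ fun r => deriv X₀.U r - deriv Z₀.U r)
        + T * supNorm (deriv α) * (G * (T * W + T ^ 2 / 8 * initialGap X₀ Z₀))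
        + T * supNorm (deriv α) * E)
      * Real.exp (1 / 4 * T * supNorm (deriv α) * G * t) := by
  have hT : 0 ≤ T := ht.trans htT
  have hA := supNorm_nonneg (deriv α)
  have hG := h.nonneg
  exact le_mul_exp_of_le_add_integral h.continuous_cumulGap ht (by positivity)
    fun s hs => h.cumulGap_le hsum hs.1 (hs.2.trans htT) hM0 hW0 hE0 hM hW hE

end IsSolutionPair

end Integrated

/-! ### From Eulerian data to a solution pair -/

/-- The relabeled initial data of a triplet and its projection. -/
theorem isSolutionPair_relabel {α : ℝ → ℝ} (hα : MemW1inf α) (hα01 : ∀ x, 0 ≤ α x ∧ α x < 1)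
    {d : Eulerian} (hd : MemD0 d) {Δx : ℝ} (hΔ : 0 < Δx) {σ : ℤ → ℝ}
    (hσ : ∀ j, σ j = 1 ∨ σ j = -1) {X Z : ℝ → Lagrangian}
    (hX : IsLagrangianSolution α
      ((mapL d).relabel (phiMap (mapL d) (mapL (proj Δx σ d)))) X)
    (hZ : IsLagrangianSolution α
      ((mapL (proj Δx σ d)).relabel (psiMap (mapL d) (mapL (proj Δx σ d)))) Z) :
    IsSolutionPair α ((mapL d).relabel (phiMap (mapL d) (mapL (proj Δx σ d))))
      ((mapL (proj Δx σ d)).relabel (psiMap (mapL d) (mapL (proj Δx σ d)))) X Z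
      (d.μ.real univ) := by
  have := hd.1.finite_nu
  obtain ⟨hfin, hmass⟩ := proj_finite hd hΔ hσ
  obtain ⟨t1, t2, t3, t4⟩ := tendsto_phiMap_psiMap d (proj Δx σ d)
  have m1 : Monotone (mapL d).y := charY_mono d.ν
  have m2 : Monotone (mapL (proj Δx σ d)).y := charY_mono (proj Δx σ d).ν
  have b1 : Tendsto (mapL d).y atBot atBot := tendsto_charY_atBot d.ν
  have b2 : Tendsto (mapL d).y atTop atTop := tendsto_charY_atTop d.ν
  refine ⟨hα.1, hα01, ?_, ?_, hX, hZ, ?_⟩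
  · rw [hd.2]
    refine isInitialDatum_relabel d hd.2 ?_ (phiMap_mono m1 b1 b2 m2) t1 t2
    rw [← hd.2]
    exact hd.ae_hasDerivAt
  · rw [← hmass]
    refine isInitialDatum_relabel (proj Δx σ d) rfl ?_ (psiMap_mono m1 b1 b2 m2) t3 t4
    rw [cumul_proj hd hΔ hσ]
    exact ae_hasDerivAt_proj d hΔ σ
  · funext r
    exact apply_phiMap_eq m1 b1 b2 (lipschitzWith_charY d.ν).continuous m2
      (lipschitzWith_charY (proj Δx σ d).ν).continuous r

/-- The initial energies differ by the difference of the cumulative energies of a triplet and its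
projection, which agree at the even mesh points. -/
theorem lintegral_deriv_mul_abs_sub_V_le {d : Eulerian} (hd : MemD0 d) {Δx : ℝ} (hΔ : 0 < Δx)
    {σ : ℤ → ℝ} (hσ : ∀ j, σ j = 1 ∨ σ j = -1) {X₀ Z₀ : Lagrangian}
    (hX₀ : X₀ = (mapL d).relabel (phiMap (mapL d) (mapL (proj Δx σ d))))
    (hZ₀ : Z₀ = (mapL (proj Δx σ d)).relabel (psiMap (mapL d) (mapL (proj Δx σ d))))
    (hy : X₀.y = Z₀.y) (hmono : Monotone X₀.y) :
    ∫⁻ r in (flatSet X₀)ᶜ, ENNReal.ofReal (deriv X₀.y r * |X₀.V r - Z₀.V r|)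
      ≤ ENNReal.ofReal (4 * Δx * d.μ.real univ) := by
  have := hd.1.finite_nu
  have := hd.finite_mu
  obtain ⟨hfin, hmass⟩ := proj_finite hd hΔ hσ
  -- At common continuity points both energies equal the cumulative functions evaluated at the same
  -- point 𝒴(r).
  have hc : ∀ᵐ x, ContinuousAt (cumul d.ν) x ∧ ContinuousAt (cumul (proj Δx σ d).ν) x := by
    filter_upwards [ae_hasDerivAt_cumul d.ν, ae_hasDerivAt_cumul (proj Δx σ d).ν] with x h1 h2
    exact ⟨h1.continuousAt, h2.continuousAt⟩
  have hle : ∀ᵐ r, r ∈ (flatSet X₀)ᶜ → ENNReal.ofReal (deriv X₀.y r * |X₀.V r - Z₀.V r|)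
      ≤ ENNReal.ofReal (deriv X₀.y r)
        * ENNReal.ofReal (cumul d.μ (X₀.y r + 2 * Δx) - cumul d.μ (X₀.y r - 2 * Δx)) := by
    filter_upwards [ae_comp_of_deriv_ne_zero hmono hc] with r hr hr0
    obtain ⟨h1, h2⟩ := hr hr0
    have hp : 0 ≤ deriv X₀.y r := hmono.deriv_nonneg
    rw [← ENNReal.ofReal_mul hp]
    refine ENNReal.ofReal_le_ofReal (mul_le_mul_of_nonneg_left ?_ hp)
    have e1 : X₀.V r = cumul d.ν (X₀.y r) := by
      subst hX₀
      change (mapL d).V _ = _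
      rw [mapL_V d hd.2]
      exact charH_eq_cumul d.ν h1
    have e2 : Z₀.V r = cumul (proj Δx σ d).ν (X₀.y r) := by
      rw [hy] at h2 ⊢
      subst hZ₀
      change (mapL (proj Δx σ d)).V _ = _
      rw [mapL_V (proj Δx σ d) rfl]
      exact charH_eq_cumul (proj Δx σ d).ν h2
    rw [e1, e2, cumul_proj hd hΔ hσ, ← hd.2]
    exact (abs_cumul_sub_projF_le hd hΔ hσ _).2.2
  calc _ ≤ ∫⁻ r in (flatSet X₀)ᶜ, ENNReal.ofReal (deriv X₀.y r)
        * ENNReal.ofReal (cumul d.μ (X₀.y r + 2 * Δx) - cumul d.μ (X₀.y r - 2 * Δx)) :=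
        lintegral_mono_ae ((ae_restrict_iff' (measurableSet_flatSet X₀).compl).2 hle)
    _ ≤ ∫⁻ r, ENNReal.ofReal (deriv X₀.y r)
        * ENNReal.ofReal (cumul d.μ (X₀.y r + 2 * Δx) - cumul d.μ (X₀.y r - 2 * Δx)) :=
        setLIntegral_le_lintegral _ _
    _ ≤ ∫⁻ x, ENNReal.ofReal (cumul d.μ (x + 2 * Δx) - cumul d.μ (x - 2 * Δx)) :=
        lintegral_deriv_mul_comp_le hmono
          fun x => ENNReal.ofReal (cumul d.μ (x + 2 * Δx) - cumul d.μ (x - 2 * Δx))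
    _ = ENNReal.ofReal (4 * Δx * d.μ.real univ) := by
        have e : 4 * Δx * d.μ.real univ = 2 * (2 * Δx) * d.μ.real univ := by ring
        rw [lintegral_cumul_sub d.μ (2 * Δx) (by positivity), e,
          ENNReal.ofReal_mul (p := 2 * (2 * Δx)) (by positivity), ofReal_measureReal]

end HunterSaxton

end

/-! ### Assembly of the estimate -/

theorem theorem3p10
    -- the dissipation rate `α ∈ W^{1,∞}(ℝ, [0, 1))`
    (α : ℝ → ℝ) (hα : MemW1inf α) (hα01 : ∀ x, 0 ≤ α x ∧ α x < 1)
    -- the initial data, and the mesh size and signs of the projection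
    (d : Eulerian) (hd : MemD0 d)
    (Δx : ℝ) (hΔ0 : 0 < Δx) (hΔ1 : Δx ≤ 1)
    (σ : ℤ → ℝ) (hσ : ∀ j, σ j = 1 ∨ σ j = -1)
    (T t : ℝ) (ht0 : 0 ≤ t) (htT : t ≤ T)
    -- the relabeled initial data
    (Xbar XbarΔ : Lagrangian)
    (hXbar : Xbar =
      (mapL d).relabel (phiMap (mapL d) (mapL (proj Δx σ d))))
    (hXbarΔ : XbarΔ =
      (mapL (proj Δx σ d)).relabel (psiMap (mapL d) (mapL (proj Δx σ d))))
    -- the solutions with these initial data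
    (X XΔ : ℝ → Lagrangian)
    (hX : IsLagrangianSolution α Xbar X)
    (hXΔ : IsLagrangianSolution α XbarΔ XΔ)
    -- the set `𝓑`, the total energies and the norms of `α'` and `u`
    (B : Set ℝ) (hB : B = flatSet Xbar)
    (Finf Ginf A u0 : ℝ)
    (hF : Finf = d.μ.real Set.univ) (hG : Ginf = d.ν.real Set.univ)
    (hA : A = supNorm (deriv α)) (hu0 : u0 = supNorm d.u) :
    ∫⁻ s in Set.Icc 0 t,
        eLpNorm (fun r => deriv (X s).V r - deriv (XΔ s).V r) 1 (volume.restrict Bᶜ)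
      ≤ ENNReal.ofReal
        ((T * (4 + T * A * (u0 + 1 / 4 * T * Finf))
              * normOn 1 Bᶜ (fun r => deriv Xbar.H r - deriv XbarΔ.H r)
            + T * normOn 1 Bᶜ (fun r => gFun α Xbar r - gFun α XbarΔ r)
            + 4 * (1 + T * A * (u0 + (1 + √2) * √Finf * √Δx + 1 / 4 * T * Finf))
              * (1 + 1 / 2 * T) * √Ginf
              * normOn 2 Bᶜ (fun r => deriv Xbar.U r - deriv XbarΔ.U r)
            + T ^ 2 * A * Finf * supNorm (fun x => d.u x - (proj Δx σ d).u x)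
            + 4 * T * A * Ginf * Δx)
          * Real.exp (1 / 4 * T ^ 2 * A * Ginf)) := by
  have hpair : IsSolutionPair α Xbar XbarΔ X XΔ (d.μ.real univ) := by
    subst hXbar hXbarΔ
    exact isSolutionPair_relabel hα hα01 hd hΔ0 hσ hX hXΔ
  have := hd.1.finite_nu
  have := hd.finite_mu
  obtain ⟨hfin, -⟩ := proj_finite hd hΔ0 hσ
  have hFG : Ginf = Finf := by rw [hF, hG, hd.2]
  have hT : 0 ≤ T := ht0.trans htT
  -- y + H is the identity before relabeling, so the sum is φ(r) + ψ(r) = 2r.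
  have hsum : ∀ r, 2 * Xbar.y r + Xbar.V r + XbarΔ.V r = 2 * r := by
    intro r
    rw [hpair.left.V_eq_H, hpair.right.V_eq_H]
    have hy := congrFun hpair.y_eq r
    subst hXbar hXbarΔ
    simp only [Lagrangian.relabel, mapL, psiMap] at hy ⊢
    rw [← hy]
    ring
  obtain ⟨Cu, hCu⟩ := hd.1.memE2.bounded
  have hu : ∀ x, |d.u x| ≤ u0 := hu0 ▸ abs_le_supNorm hd.1.memE2.continuous hCu
  have hu00 : 0 ≤ u0 := hu0 ▸ supNorm_nonneg _
  have hA0 : 0 ≤ A := hA ▸ supNorm_nonneg _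
  have hF0 : 0 ≤ Finf := hF ▸ measureReal_nonneg
  have hproj := abs_projU_le hd hΔ0 hσ hu
  rw [← hF] at hproj
  have hs : 0 ≤ √Finf * √Δx := by positivity
  have hs2 : 0 ≤ √2 * (√Finf * √Δx) := by positivity
  -- The projected profile is bounded by u0 + √Finf √Δx, so the factor 1 + √2 leaves room.
  have hM : ∀ᵐ r, deriv Xbar.y r ≠ 0 → |Xbar.U r| ≤ u0 + (1 + √2) * √Finf * √Δx ∧
      |XbarΔ.U r| ≤ u0 + (1 + √2) * √Finf * √Δx := by
    refine Eventually.of_forall fun r _ => ⟨?_, ?_⟩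
    · have h1 : |Xbar.U r| ≤ u0 := by subst hXbar; exact hu _
      linarith
    · have h1 : |XbarΔ.U r| ≤ u0 + √Finf * √Δx := by subst hXbarΔ; exact hproj _
      linarith
  have hW : ∀ᵐ r, deriv Xbar.y r ≠ 0 → |Xbar.U r - XbarΔ.U r|
      ≤ supNorm (fun x => d.u x - (proj Δx σ d).u x) := by
    have h1 := ae_abs_le_supNorm (f := fun x => d.u x - (proj Δx σ d).u x)
      (C := u0 + (u0 + √Finf * √Δx)) fun x =>
        (abs_sub _ _).trans (add_le_add (hu x) (hproj x))
    filter_upwards [ae_comp_of_deriv_ne_zero hpair.left.y_mono h1] with r hr hr0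
    have h2 : Xbar.U r = d.u (Xbar.y r) := by subst hXbar; rfl
    have h3 : XbarΔ.U r = (proj Δx σ d).u (Xbar.y r) := by
      rw [hpair.y_eq]; subst hXbarΔ; rfl
    rw [h2, h3]
    exact hr hr0
  have hmain := hpair.cumulGap_le_mul_exp hsum ht0 htT (by positivity) (supNorm_nonneg _)
    (by positivity) hM hW
    (lintegral_deriv_mul_abs_sub_V_le hd hΔ0 hσ hXbar hXbarΔ hpair.y_eq hpair.left.y_mono)
  rw [hB, hpair.lintegral_eLpNorm_deriv_V ht0]
  refine ENNReal.ofReal_le_ofReal (hmain.trans ?_)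
  rw [hpair.initialGap_eq_normOn, ← hF, ← hA, hFG]
  have hW0 : 0 ≤ supNorm (fun x => d.u x - (proj Δx σ d).u x) := supNorm_nonneg _
  have hN0 : 0 ≤ normOn 1 (flatSet Xbar)ᶜ (fun r => deriv Xbar.H r - deriv XbarΔ.H r) :=
    ENNReal.toReal_nonneg
  have hN1 : 0 ≤ normOn 1 (flatSet Xbar)ᶜ (fun r => gFun α Xbar r - gFun α XbarΔ r) :=
    ENNReal.toReal_nonneg
  have hN2 : 0 ≤ normOn 2 (flatSet Xbar)ᶜ (fun r => deriv Xbar.U r - deriv XbarΔ.U r) :=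
    ENNReal.toReal_nonneg
  set W := supNorm (fun x => d.u x - (proj Δx σ d).u x)
  set N0 := normOn 1 (flatSet Xbar)ᶜ (fun r => deriv Xbar.H r - deriv XbarΔ.H r)
  set N1 := normOn 1 (flatSet Xbar)ᶜ (fun r => gFun α Xbar r - gFun α XbarΔ r)
  set N2 := normOn 2 (flatSet Xbar)ᶜ (fun r => deriv Xbar.U r - deriv XbarΔ.U r)
  set m := u0 + (1 + √2) * √Finf * √Δx + 1 / 4 * T * Finf with hm
  have hm0 : 0 ≤ m := by positivity
  -- Uses 1 + T²/2 ≤ (2 + T)², which produces the factor 4(1 + T/2) of the statement.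
  have hsqrt : √(Finf * (1 + T ^ 2 / 2)) ≤ √Finf * (2 * (1 + 1 / 2 * T)) := by
    rw [Real.sqrt_mul hF0]
    gcongr
    refine Real.sqrt_le_iff.2 ⟨by positivity, ?_⟩
    nlinarith
  -- The initial gap enters twice, directly and through the distance of the characteristics.
  have t0 : T * N0 + T * A * (Finf * (T ^ 2 / 8 * N0))
      ≤ T * (4 + T * A * (u0 + 1 / 4 * T * Finf)) * N0 := by
    have e1 : 0 ≤ T * N0 := by positivity
    have e2 : 0 ≤ T * (T * A * u0) * N0 := by positivity
    have e3 : 0 ≤ T ^ 3 * A * Finf * N0 := by positivity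
    linarith
  have t2 : 2 * (1 + T * (A * m)) * (√(Finf * (1 + T ^ 2 / 2)) * N2)
      ≤ 4 * (1 + T * A * m) * (1 + 1 / 2 * T) * √Finf * N2 := by
    calc _ ≤ 2 * (1 + T * (A * m)) * (√Finf * (2 * (1 + 1 / 2 * T)) * N2) := by gcongr
      _ = _ := by ring
  have hexp : Real.exp (1 / 4 * T * A * Finf * t) ≤ Real.exp (1 / 4 * T ^ 2 * A * Finf) := by
    rw [Real.exp_le_exp]
    calc _ ≤ 1 / 4 * T * A * Finf * T := by gcongr
      _ = _ := by ring
  refine mul_le_mul ?_ hexp (Real.exp_pos _).le (by positivity)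
  linarith
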